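/- Let $d\ge 1$. For a $(d-1)$-tuple $I=(i_1,\dots,i_{d-1})$ of positive integers (a jump tuple) and a $(d-1)$-tuple $R=(r_1,\dots,r_{d-1})$ of positive integers (an intersection tuple), the pentagram map $T_{I,R}$ sends a polygon $(v_k)_{k\in\mathbb Z}$ in $\mathbb{RP}^d$ to the polygon $\hat v_k=P_k\cap P_{k+r_1}\cap\dots\cap P_{k+r_1+\dots+r_{d-1}}$, where $P_k=\mathrm{span}\langle v_k,v_{k+i_1},\dots,v_{k+i_1+\dots+i_{d-1}}\rangle$ (defined when all $P_k$ are hyperplanes and each intersection is one point). A normalized quasi-periodic curve is a smooth $G:\mathbb R\to\mathbb R^{d+1}$ with $\det(G,G',\dots,G^{(d)})\equiv 1$ and $G(x+2\pi)=MG(x)$ for some $M\in SL_{d+1}(\mathbb R)$. It satisfies $\mathcal L G=0$ for a unique operator $\mathcal L=\partial^{d+1}+u_{d-1}\partial^{d-1}+\dots+u_1\partial+u_0$, whose coefficients are smooth and $2\pi$-periodic. Given $I$ and an integer $m\ge1$, let $k_0<\dots<k_{d-1}$ be the numbers $0,\,i_1,\,i_1+i_2,\dots,\,i_1+\dots+i_{d-1}$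 shifted by a common constant so that $\sum_l k_l=0$. For small $\varepsilon>0$ let $L_\varepsilon$ be the smooth curve in $\mathbb R^{d+1}$ with $\det(L_\varepsilon,L_\varepsilon',\dots,L_\varepsilon^{(d)})\equiv1$ and $$\det\bigl(G(x+mk_0\varepsilon),\dots,G(x+mk_{d-1}\varepsilon),L_\varepsilon^{(j)}(x)\bigr)=0,\qquad j=0,\dots,d-1,\ x\in\mathbb R,$$ and $L_\varepsilon\to G$ as $\varepsilon\to0^+$ (the normalized lift of the envelope of the hyperplanes through $d$ points of the curve). If $L_\varepsilon^{(d+1)}+\sum_{j=0}^{d-1}u_{j,\varepsilon}L_\varepsilon^{(j)}=0$ and $u_{j,\varepsilon}=u_j+\varepsilon^2w_j+O(\varepsilon^3)$, then the system $du_j/dt=w_j$, $j=0,\dots,d-1$, is called the continuous limit of $T_{I,m(1,\dots,1)}$. The $(2,d+1)$-KdV equation of the Adler–Gelfand–Dickey hierarchy is $d\mathcal L/dt=[Q_2,\mathcal L]$, where $Q_2=(\mathcal L^{2/(d+1)})_+$ is the differential part of the fractional power of $\mathcal L$ in the algebra of formal pseudo-differential operators. **Theorem.** For every jump tuple $I$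 and every integer $m\ge1$ there is a constant $C\neq0$, depending only on $d,m,I$, such that: 1. For every normalized quasi-periodic curve $G$ with monodromy $M$ a family $L_\varepsilon$ as above exists, and for every such family, for all small $\varepsilon>0$ the curve $L_\varepsilon$ is a normalized quasi-periodic curve with the same monodromy $M$. Moreover $$L_\varepsilon=G+\varepsilon^2C\Bigl(\partial^2+\tfrac{2}{d+1}u_{d-1}\Bigr)G+O(\varepsilon^3)$$ uniformly on compact sets, and $u_{j,\varepsilon}=u_j+\varepsilon^2w_j+O(\varepsilon^3)$ uniformly on $\mathbb R$, where $\sum_jw_j\partial^j=C\,[Q_2,\mathcal L]$. 2. The continuous limit of $T_{I,m(1,\dots,1)}$ is the $(2,d+1)$-KdV flow on the circle up to a constant rescaling of time: a time-dependent tuple $u(t)$, for which $u(t)$ is at the time $t$ considered the coefficient tuple of some normalized quasi-periodic curve, satisfies the continuous limit system at time $t$ if and only if $s\mapsto u(s/C)$ satisfies the $(2,d+1)$-KdV equation at time $Ct$. In particular this covers the inverses of long-diagonal pentagram maps. Let $m\ge 1$ and let $R$ be the tuple of differences of consecutive elements of the union of two disjoint finite arithmetic progressions with common difference $m$ and $d$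 elements in total, and let $R^*$ be $R$ read backwards. Then $T_{R^*,(m,\dots,m)}$ is, modulo a shift of indices, the inverse of the long-diagonal map $T_{(m,\dots,m),R}$ (both composites, where defined, are the same index shift), and the continuous limit of $T_{R^*,(m,\dots,m)}$ is the $(2,d+1)$-KdV flow in the sense of part 2. -/

import Mathlib

open Set Filter Topology
open scoped ContDiff Matrix

noncomputable section

namespace PentagramLimit

/-! ### Jump tuples and pentagram maps on polygons in real projective space -/

/-- The partial sum `i₁ + ⋯ + i_l` of a tuple; for `l = 0, …, d - 1` these are the index offsets of
the vertices (or hyperplanes) prescribed by the tuple. -/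
def offset {d : ℕ} (I : Fin (d - 1) → ℕ) (l : ℕ) : ℕ :=
  ∑ i ∈ Finset.univ.filter (fun i : Fin (d - 1) => i.val < l), I i

/-- A polygon in `ℝP^d`: a bi-infinite sequence of points. -/
abbrev Polygon (d : ℕ) := ℤ → Projectivization ℝ (Fin (d + 1) → ℝ)

/-- `P_k = span ⟨v_k, v_{k+i₁}, …, v_{k+i₁+⋯+i_{d-1}}⟩`, as a linear subspace of `ℝ^{d+1}`. -/
def diagPlane {d : ℕ} (I : Fin (d - 1) → ℕ) (v : Polygon d) (k : ℤ) :
    Submodule ℝ (Fin (d + 1) → ℝ) :=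
  ⨆ l : Fin d, (v (k + (offset I l : ℤ))).submodule

/-- `w = T_{I,R} v`: all the `P_k` are hyperplanes, and for every `k` the hyperplanes
`P_k, P_{k+r₁}, …, P_{k+r₁+⋯+r_{d-1}}` meet in exactly one point, which is `w_k`. -/
def IsPentagramImage {d : ℕ} (I R : Fin (d - 1) → ℕ) (v w : Polygon d) : Prop :=
  (∀ k, Module.finrank ℝ (diagPlane I v k) = d) ∧
  ∀ k, ⨅ l : Fin d, diagPlane I v (k + (offset R l : ℤ)) = (w k).submodule

/-- `T_{I',R'}` is the inverse of `T_{I,R}`, modulo a shift of the indices: both composites are, where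
they are defined, the same shift. -/
def AreInverseUpToShift {d : ℕ} (I R I' R' : Fin (d - 1) → ℕ) : Prop :=
  ∃ s : ℤ,
    (∀ v w v' : Polygon d, IsPentagramImage I R v w → IsPentagramImage I' R' w v' →
      ∀ k, v' k = v (k + s)) ∧
    (∀ v w v' : Polygon d, IsPentagramImage I' R' v w → IsPentagramImage I R w v' →
      ∀ k, v' k = v (k + s))

/-- A tuple read backwards. -/
def reversed {d : ℕ} (I : Fin (d - 1) → ℕ) : Fin (d - 1) → ℕ := fun i => I i.rev

/-- A finite arithmetic progression with common difference `m`. -/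
def IsArithProg (m : ℕ) (S : Finset ℤ) : Prop :=
  ∃ (a : ℤ) (n : ℕ), S = (Finset.range n).image (fun j : ℕ => a + (m : ℤ) * (j : ℤ))

/-- `R` is the intersection tuple of a long-diagonal pentagram map `T_{(m,…,m),R}`: it is the sequence
of differences of consecutive elements of the union of two disjoint arithmetic `m`-progressions
with `d` elements in total. -/
def IsLongDiagonalTuple (d m : ℕ) (R : Fin (d - 1) → ℕ) : Prop :=
  (∀ i, 0 < R i) ∧
  ∃ Rm Rp : Finset ℤ, IsArithProg m Rm ∧ IsArithProg m Rp ∧ Disjoint Rm Rp ∧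
    Rm.card + Rp.card = d ∧
    ∃ a : ℤ, ∀ z : ℤ, z ∈ Rm ∪ Rp ↔ ∃ l : Fin d, z = a + (offset R l : ℤ)

/-! ### Curves and their differential operators -/

/-- `det (Λ(x), Λ'(x), …, Λ^{(d)}(x))`. -/
def wronskian {d : ℕ} (Λ : ℝ → Fin (d + 1) → ℝ) (x : ℝ) : ℝ :=
  Matrix.det (Matrix.of fun i : Fin (d + 1) => iteratedDeriv (i : ℕ) Λ x)

/-- `G` is the normalized lift to `ℝ^{d+1}` of a smooth nondegenerate quasi-periodic curve in `ℝP^d`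
with monodromy `M`. -/
structure IsNormalizedLift {d : ℕ} (M : Matrix.SpecialLinearGroup (Fin (d + 1)) ℝ)
    (G : ℝ → Fin (d + 1) → ℝ) : Prop where
  smooth : ContDiff ℝ ∞ G
  wronskian_eq_one : ∀ x, wronskian G x = 1
  monodromy : ∀ x, G (x + 2 * Real.pi) = (M : Matrix (Fin (d + 1)) (Fin (d + 1)) ℝ) *ᵥ G x

/-- `G^{(d+1)} + u_{d-1} G^{(d-1)} + ⋯ + u₁ G' + u₀ G = 0`. -/
def HasCoeffs {d : ℕ} (G : ℝ → Fin (d + 1) → ℝ) (u : Fin d → ℝ → ℝ) : Prop :=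
  ∀ x, iteratedDeriv (d + 1) G x + ∑ j : Fin d, u j x • iteratedDeriv (j : ℕ) G x = 0

/-- The coefficient tuple `u` of an operator is that of some normalized quasi-periodic curve. -/
def IsCurveCoeffs {d : ℕ} (u : Fin d → ℝ → ℝ) : Prop :=
  ∃ (M : Matrix.SpecialLinearGroup (Fin (d + 1)) ℝ) (G : ℝ → Fin (d + 1) → ℝ),
    IsNormalizedLift M G ∧ HasCoeffs G u

/-! ### Envelopes and the continuous limit -/

/-- The offsets `k₀ < k₁ < ⋯ < k_{d-1}` of a jump tuple, shifted so that their sum is `0`. -/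
def centeredOffset {d : ℕ} (I : Fin (d - 1) → ℕ) (l : Fin d) : ℝ :=
  (offset I l : ℝ) - (∑ l' : Fin d, (offset I l' : ℝ)) / d

/-- `Λ` is a normalized lift of the envelope of the hyperplanes `P_ε(x)` through the points of the
curve `G` with parameters `x + k₀ ε, …, x + k_{d-1} ε`, i.e.
`det (G(x + k₀ ε), …, G(x + k_{d-1} ε), Λ^{(j)}(x)) = 0` for `j = 0, …, d - 1`. -/
structure IsEnvelope {d : ℕ} (k : Fin d → ℝ) (G : ℝ → Fin (d + 1) → ℝ) (ε : ℝ)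
    (Λ : ℝ → Fin (d + 1) → ℝ) : Prop where
  smooth : ContDiff ℝ ∞ Λ
  wronskian_eq_one : ∀ x, wronskian Λ x = 1
  osculating : ∀ x, ∀ j : Fin d,
    Matrix.det (Matrix.of (Fin.snoc (α := fun _ => Fin (d + 1) → ℝ)
      (fun l : Fin d => G (x + k l * ε)) (iteratedDeriv (j : ℕ) Λ x))) = 0

/-- The family `L_ε`, for small `ε > 0`, of envelopes attached to the map `T_{I,R}` with
`R = (m, …, m)` and the curve `G`: `ε` is rescaled to `m ε`, and `L_ε → G` as `ε → 0`. -/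
def IsEnvelopeFamily {d : ℕ} (I : Fin (d - 1) → ℕ) (m : ℕ) (G : ℝ → Fin (d + 1) → ℝ)
    (L : ℝ → ℝ → Fin (d + 1) → ℝ) : Prop :=
  (∀ᶠ ε in 𝓝[>] (0 : ℝ), IsEnvelope (centeredOffset I) G ((m : ℝ) * ε) (L ε)) ∧
  ∀ x, Tendsto (fun ε => L ε x) (𝓝[>] 0) (𝓝 (G x))

/-- `u_{j,ε}(x) = u_j(x) + ε² w_j(x) + O(ε³)` as `ε → 0+`, uniformly in `x`. -/
def HasSecondOrderExpansion {d : ℕ} (uε : ℝ → Fin d → ℝ → ℝ) (u w : Fin d → ℝ → ℝ) : Prop :=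
  ∃ K : ℝ, ∀ᶠ ε in 𝓝[>] (0 : ℝ), ∀ j x, |uε ε j x - u j x - ε ^ 2 * w j x| ≤ K * ε ^ 3

/-- `w` is the value at `u` of the vector field which is the continuous limit of `T_{I,(m,…,m)}`. -/
def IsContinuousLimitField {d : ℕ} (I : Fin (d - 1) → ℕ) (m : ℕ) (u w : Fin d → ℝ → ℝ) : Prop :=
  ∃ (M : Matrix.SpecialLinearGroup (Fin (d + 1)) ℝ) (G : ℝ → Fin (d + 1) → ℝ)
    (L : ℝ → ℝ → Fin (d + 1) → ℝ) (uε : ℝ → Fin d → ℝ → ℝ),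
    IsNormalizedLift M G ∧ HasCoeffs G u ∧ IsEnvelopeFamily I m G L ∧
    (∀ᶠ ε in 𝓝[>] (0 : ℝ), HasCoeffs (L ε) (uε ε)) ∧ HasSecondOrderExpansion uε u w

/-- The time-dependent tuple `u` (arguments: time, index, space variable) satisfies at time `t` the
system `du_j/dt = w_j` which is the continuous limit of `T_{I,(m,…,m)}`. -/
def SolvesContinuousLimitAt {d : ℕ} (I : Fin (d - 1) → ℕ) (m : ℕ) (u : ℝ → Fin d → ℝ → ℝ)
    (t : ℝ) : Prop :=
  ∃ w : Fin d → ℝ → ℝ, IsContinuousLimitField I m (u t) w ∧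
    ∀ j x, HasDerivAt (fun s => u s j x) (w j x) t

/-! ### Formal pseudo-differential operators and the KdV flows -/

/-- The formal pseudo-differential operator `∑_{s ≥ 0} coeff s ∂^{order - s}`. -/
structure PsiDO where
  order : ℤ
  coeff : ℕ → ℝ → ℝ

namespace PsiDO

/-- The identity operator. -/
def one : PsiDO := ⟨0, fun s _ => if s = 0 then 1 else 0⟩

/-- Composition, determined by `a ∂^i ∘ b ∂^j = ∑_{l ≥ 0} (i choose l) a b^{(l)} ∂^{i+j-l}`. -/
def comp (A B : PsiDO) : PsiDO where
  order := A.order + B.order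
  coeff n x := ∑ p ∈ Finset.HasAntidiagonal.antidiagonal n,
    ∑ q ∈ Finset.HasAntidiagonal.antidiagonal p.2,
      ((Ring.choose (A.order - (p.1 : ℤ)) q.2 : ℤ) : ℝ) *
        (A.coeff p.1 x * iteratedDeriv q.2 (B.coeff q.1) x)

/-- Powers. -/
def pow (A : PsiDO) : ℕ → PsiDO
  | 0 => one
  | n + 1 => A.comp (A.pow n)

/-- The action on functions of the purely differential part `A₊` of `A`. -/
def diffPart (A : PsiDO) (f : ℝ → ℝ) (x : ℝ) : ℝ :=
  ∑ s ∈ Finset.range (A.order + 1).toNat, A.coeff s x * iteratedDeriv (A.order - s).toNat f x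

end PsiDO

/-- `L = ∂^{d+1} + u_{d-1} ∂^{d-1} + ⋯ + u₁ ∂ + u₀` as a formal pseudo-differential operator. -/
def lOp {d : ℕ} (u : Fin d → ℝ → ℝ) : PsiDO where
  order := (d : ℤ) + 1
  coeff s x := if s = 0 then 1 else if h : 2 ≤ s ∧ s ≤ d + 1 then u ⟨d + 1 - s, by omega⟩ x else 0

/-- `P = L^{1/(d+1)}`: `P = ∂ + p₀ + p₁ ∂⁻¹ + ⋯` with smooth periodic coefficients, and
`P^{d+1} = L`. -/
structure IsRootOfL {d : ℕ} (u : Fin d → ℝ → ℝ) (P : PsiDO) : Prop where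
  order_eq : P.order = 1
  monic : ∀ x, P.coeff 0 x = 1
  smooth : ∀ s, ContDiff ℝ ∞ (P.coeff s)
  periodic : ∀ s, Function.Periodic (P.coeff s) (2 * Real.pi)
  pow_eq : P.pow (d + 1) = lOp u

/-- `w` is the value at `u` of the `(k, d+1)`-KdV vector field: with `Q_k = (L^{k/(d+1)})₊`, the
operators `∑_j w_j ∂^j` and `[Q_k, L] = Q_k L - L Q_k` are equal. -/
def IsKdVField {d : ℕ} (k : ℕ) (u w : Fin d → ℝ → ℝ) : Prop :=
  ∃ P : PsiDO, IsRootOfL u P ∧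
    ∀ f : ℝ → ℝ, ContDiff ℝ ∞ f → ∀ x,
      ∑ j : Fin d, w j x * iteratedDeriv (j : ℕ) f x =
        (P.pow k).diffPart ((lOp u).diffPart f) x - (lOp u).diffPart ((P.pow k).diffPart f) x

/-- The time-dependent tuple `u` satisfies the `(k, d+1)`-KdV equation `dL/dt = [Q_k, L]` at time
`t`. -/
def SolvesKdVAt {d : ℕ} (k : ℕ) (u : ℝ → Fin d → ℝ → ℝ) (t : ℝ) : Prop :=
  ∃ w : Fin d → ℝ → ℝ, IsKdVField k (u t) w ∧ ∀ j x, HasDerivAt (fun s => u s j x) (w j x) t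

end PentagramLimit

end

open PentagramLimit

/-! Let `H_ε(x)` be the covector of the hyperplane through the points `G(x + k_l ε)`. Inverting a
Vandermonde matrix in the Taylor formula replaces these points by a basis of the same hyperplane
that extends smoothly to `ε = 0`, where it becomes `G, …, G^{(d-1)}` (`point_eq_sum_envBasis`). So
`H` is smooth in `(ε, x)`, and `H_0` is the curve dual to `G`. Dualizing once more and rescaling the
Wronskian to one gives a smooth family of envelopes starting at `G`
(`exists_jointlySmooth_envelope`). A normalized envelope is unique up to sign
(`eq_or_eq_neg_of_envelope`), and the limit `G` decides the sign. Hence all quantities expand in `ε`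
with remainders smooth in `(ε, x)`, and periodicity makes the bounds on the operator coefficients
uniform.

Write `L_ε = G + ε A₁ + ε² A₂ + …`. For `j < d` the pairing `H_ε · G^{(j)}` is `O(ε²)`, and its `ε²`
term is nonzero only for `j = d - 2`, where it is `-C` with `C` a positive multiple of `∑ k_l²`
(`hasExpansion_envCovector`). The envelope equations then say that `H_0` annihilates `A₁` and `A₂ -
C G''` together with their derivatives of order below `d`, so by duality both are function multiples
of `G`. Linearizing the condition that the Wronskian is one gives a vanishing trace, which
determines the two functions: `A₁ = 0` and `A₂ = C (G'' + 2/(d+1) u_{d-1} G)`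
(`envelope_expansion`). For `d = 1` this last vector is zero and the constant is arbitrary.

Put `Q = ∂² + 2/(d+1) u_{d-1}`, which is the differential part of `𝓛^{2/(d+1)}`
(`IsRootOfL.sq_diffPart`). Varying `𝓛 G = 0` in the direction `C Q G` gives `∑ w_j G^{(j)} = -C 𝓛 Q
G = C [Q, 𝓛] G`. The commutator has order below `d` (`isDiffOpLT_commutator`) and `G, …, G^{(d-1)}`
are independent, so the coefficients agree. Passing from `ε` to `m ε` multiplies `C` by `m²`.

The statement on inverses is incidence geometry: reading both tuples backwards recovers first the
planes and then the vertices (`IsPentagramImage.eq_shift`). -/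

namespace PentagramLimit

/-! ### Smooth dependence on a parameter -/

section Smooth

variable {E : Type} [NormedAddCommGroup E] [NormedSpace ℝ E]

/-- `F ε x` is a smooth function of both arguments. -/
def JointlySmooth (F : ℝ → ℝ → E) : Prop := ContDiff ℝ ∞ fun p : ℝ × ℝ => F p.1 p.2

/-- The derivative under the integral sign is again a parametric integral, now with values in `P
→L[ℝ] F`; this is why the induction generalizes over the target space. -/
theorem contDiff_intervalIntegral_nat (n : ℕ) {P F : Type} [NormedAddCommGroup P]
    [NormedSpace ℝ P] [ProperSpace P] [NormedAddCommGroup F] [NormedSpace ℝ F] [CompleteSpace F]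
    {f : P → ℝ → F} (hf : ContDiff ℝ ∞ fun q : P × ℝ => f q.1 q.2) :
    ContDiff ℝ n fun p => ∫ s in (0 : ℝ)..1, f p s := by
  induction n generalizing F with
  | zero =>
    exact contDiff_zero.2
      (intervalIntegral.continuous_parametric_intervalIntegral_of_continuous' hf.continuous 0 1)
  | succ n ih =>
    have hd : Differentiable ℝ fun q : P × ℝ => f q.1 q.2 := hf.differentiable (by simp)
    let f' : P → ℝ → P →L[ℝ] F := fun p s =>
      (fderiv ℝ (fun q : P × ℝ => f q.1 q.2) (p, s)).comp (ContinuousLinearMap.inl ℝ P ℝ)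
    have hf' : ContDiff ℝ ∞ fun q : P × ℝ => f' q.1 q.2 :=
      ((contDiff_infty_iff_fderiv.1 hf).2).clm_comp contDiff_const
    have hder : ∀ p s, HasFDerivAt (fun p => f p s) (f' p s) p := fun p s =>
      (hd (p, s)).hasFDerivAt.comp (f := fun p => (p, s)) p (hasFDerivAt_prodMk_left p s)
    have key : ∀ p, HasFDerivAt (fun p => ∫ s in (0 : ℝ)..1, f p s)
        (∫ s in (0 : ℝ)..1, f' p s) p := by
      intro p
      -- Properness of `P` makes this set compact, so a constant dominates the derivative near `p`.
      have hK : IsCompact (Metric.closedBall p 1 ×ˢ Icc (0 : ℝ) 1) :=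
        (isCompact_closedBall p 1).prod isCompact_Icc
      obtain ⟨B, hB⟩ := hK.exists_bound_of_continuousOn hf'.continuous.continuousOn
      refine intervalIntegral.hasFDerivAt_integral_of_dominated_of_fderiv_le
        (bound := fun _ => B) (Metric.closedBall_mem_nhds p one_pos)
        (Eventually.of_forall fun p => ?_) ?_ ?_ (Eventually.of_forall fun s hs q hq => ?_) ?_
        (Eventually.of_forall fun s _ q _ => hder q s)
      · exact (hf.continuous.comp (Continuous.prodMk_right p)).aestronglyMeasurable
      · exact (hf.continuous.comp (Continuous.prodMk_right p)).intervalIntegrable _ _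
      · exact (hf'.continuous.comp (Continuous.prodMk_right p)).aestronglyMeasurable
      · rw [uIoc_of_le zero_le_one] at hs
        exact hB (q, s) ⟨hq, hs.1.le, hs.2⟩
      · exact intervalIntegrable_const
    push_cast
    refine contDiff_succ_iff_fderiv.2 ⟨fun p => (key p).differentiableAt, by simp, ?_⟩
    rw [show fderiv ℝ (fun p => ∫ s in (0 : ℝ)..1, f p s) = fun p => ∫ s in (0 : ℝ)..1, f' p s from
      funext fun p => (key p).fderiv]
    exact ih hf'

theorem JointlySmooth.intervalIntegral [CompleteSpace E] {f : ℝ → ℝ → ℝ → E}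
    (hf : ContDiff ℝ ∞ fun q : (ℝ × ℝ) × ℝ => f q.1.1 q.1.2 q.2) :
    JointlySmooth fun ε x => ∫ s in (0 : ℝ)..1, f ε x s :=
  contDiff_infty.2 fun n => contDiff_intervalIntegral_nat n (f := fun (p : ℝ × ℝ) s => f p.1 p.2 s) hf

theorem JointlySmooth.contDiff_right {F : ℝ → ℝ → E} (hF : JointlySmooth F) (ε : ℝ) :
    ContDiff ℝ ∞ (F ε) :=
  ContDiff.comp (g := fun p : ℝ × ℝ => F p.1 p.2) hF (contDiff_prodMk_right ε)

theorem JointlySmooth.contDiff_left {F : ℝ → ℝ → E} (hF : JointlySmooth F) (x : ℝ) :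
    ContDiff ℝ ∞ fun ε => F ε x :=
  ContDiff.comp (g := fun p : ℝ × ℝ => F p.1 p.2) hF (contDiff_prodMk_left x)

theorem JointlySmooth.continuous {F : ℝ → ℝ → E} (hF : JointlySmooth F) :
    Continuous fun p : ℝ × ℝ => F p.1 p.2 := ContDiff.continuous hF

theorem JointlySmooth.of_right {G : ℝ → E} (hG : ContDiff ℝ ∞ G) : JointlySmooth fun _ x => G x :=
  hG.comp contDiff_snd

theorem JointlySmooth.comp_mul_left {F : ℝ → ℝ → E} (hF : JointlySmooth F) (c : ℝ) :
    JointlySmooth fun ε x => F (c * ε) x :=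
  ContDiff.comp (g := fun p : ℝ × ℝ => F p.1 p.2) hF
    (f := fun p : ℝ × ℝ => (c * p.1, p.2)) (by fun_prop)

/-- An `x`-derivative is the total derivative applied to `(0, 1)`, so no smoothness in `ε` is lost.
-/
theorem JointlySmooth.iteratedDeriv {F : ℝ → ℝ → E} (hF : JointlySmooth F) (j : ℕ) :
    JointlySmooth fun ε x => iteratedDeriv j (F ε) x := by
  induction j with
  | zero => simpa using hF
  | succ j ih =>
    have h : ∀ ε x, _root_.iteratedDeriv (j + 1) (F ε) x =
        fderiv ℝ (fun p : ℝ × ℝ => _root_.iteratedDeriv j (F p.1) p.2) (ε, x) (0, 1) := by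
      intro ε x
      rw [iteratedDeriv_succ]
      have h1 := (ContDiff.differentiable ih (by simp) (ε, x)).hasFDerivAt
      have h2 : HasDerivAt (fun x : ℝ => (ε, x)) ((0 : ℝ), (1 : ℝ)) x :=
        (hasDerivAt_const x ε).prodMk (hasDerivAt_id x)
      exact (h1.comp_hasDerivAt x h2).deriv
    simp only [h]
    exact (contDiff_infty_iff_fderiv.1 ih).2.clm_apply contDiff_const

theorem contDiff_iteratedDeriv {G : ℝ → E} (hG : ContDiff ℝ ∞ G) (j : ℕ) :
    ContDiff ℝ ∞ (iteratedDeriv j G) :=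
  ((JointlySmooth.of_right hG).iteratedDeriv j).contDiff_right 0

theorem hasDerivAt_iteratedDeriv {G : ℝ → E} (hG : ContDiff ℝ ∞ G) (j : ℕ) (x : ℝ) :
    HasDerivAt (iteratedDeriv j G) (iteratedDeriv (j + 1) G x) x := by
  rw [iteratedDeriv_succ]
  exact ((contDiff_iteratedDeriv hG j).differentiable (by simp) x).hasDerivAt

theorem iteratedDeriv_clm_comp {F : Type} [NormedAddCommGroup F] [NormedSpace ℝ F] (A : E →L[ℝ] F)
    {G : ℝ → E} (hG : ContDiff ℝ ∞ G) (j : ℕ) (x : ℝ) :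
    iteratedDeriv j (fun x => A (G x)) x = A (iteratedDeriv j G x) := by
  induction j generalizing x with
  | zero => simp
  | succ j ih =>
    rw [iteratedDeriv_succ, funext ih]
    exact (A.hasFDerivAt.comp_hasDerivAt x (hasDerivAt_iteratedDeriv hG j x)).deriv

theorem iteratedDeriv_smul_of_contDiff {f : ℝ → ℝ} {G : ℝ → E} (hf : ContDiff ℝ ∞ f)
    (hG : ContDiff ℝ ∞ G) (n : ℕ) (x : ℝ) :
    iteratedDeriv n (fun x => f x • G x) x = ∑ j ∈ Finset.range (n + 1),
      ((n.choose j : ℝ) * iteratedDeriv (n - j) f x) • iteratedDeriv j G x := by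
  have := iteratedDerivWithin_smul (n := n) (mem_univ x) uniqueDiffOn_univ
    ((hf.of_le (by exact_mod_cast le_top)).contDiffAt.contDiffWithinAt (s := univ))
    ((hG.of_le (by exact_mod_cast le_top)).contDiffAt.contDiffWithinAt (s := univ))
  simp only [iteratedDerivWithin_univ] at this
  refine this.trans ?_
  rw [← Finset.sum_flip]
  refine Finset.sum_congr rfl fun j hj => ?_
  have hj' : j ≤ n := Nat.lt_succ_iff.1 (Finset.mem_range.1 hj)
  rw [Nat.choose_symm hj', Nat.sub_sub_self hj', ← Nat.cast_smul_eq_nsmul ℝ, smul_smul]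

theorem iteratedDeriv_add_right {G : ℝ → E} {T : ℝ} (A : E →L[ℝ] E) (hG : ContDiff ℝ ∞ G)
    (hT : ∀ x, G (x + T) = A (G x)) (j : ℕ) (x : ℝ) :
    iteratedDeriv j G (x + T) = A (iteratedDeriv j G x) := by
  rw [← iteratedDeriv_clm_comp A hG, ← funext hT, iteratedDeriv_comp_add_const]

theorem hasDerivAt_comp_add_mul {G : ℝ → E} (hG : ContDiff ℝ ∞ G) (j : ℕ) (x h s : ℝ) :
    HasDerivAt (fun s : ℝ => iteratedDeriv j G (x + s * h))
      (h • iteratedDeriv (j + 1) G (x + s * h)) s := by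
  have := (hasDerivAt_iteratedDeriv hG j (x + s * h)).scomp (h := fun s => x + s * h) s
    (((hasDerivAt_id s).mul_const h).const_add x)
  rwa [one_mul] at this

/-- Hadamard's lemma. -/
theorem JointlySmooth.exists_eq_add_smul [CompleteSpace E] {F : ℝ → ℝ → E} (hF : JointlySmooth F) :
    ∃ R : ℝ → ℝ → E, JointlySmooth R ∧ ∀ ε x, F ε x = F 0 x + ε • R ε x := by
  let D : ℝ → ℝ → E := fun ε x => fderiv ℝ (fun p : ℝ × ℝ => F p.1 p.2) (ε, x) (1, 0)
  have hD : JointlySmooth D := (contDiff_infty_iff_fderiv.1 hF).2.clm_apply contDiff_const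
  have hder : ∀ ε x, HasDerivAt (fun ε => F ε x) (D ε x) ε := fun ε x =>
    (ContDiff.differentiable hF (by simp) (ε, x)).hasFDerivAt.comp_hasDerivAt ε
      (f := fun ε => (ε, x)) ((hasDerivAt_id ε).prodMk (hasDerivAt_const ε x))
  -- The quotient is the mean of the `ε`-derivative over the segment from `0` to `ε`, which is
  -- defined and smooth also at `ε = 0`.
  refine ⟨fun ε x => ∫ s in (0 : ℝ)..1, D (s * ε) x, JointlySmooth.intervalIntegral ?_, ?_⟩
  · exact ContDiff.comp (g := fun p : ℝ × ℝ => D p.1 p.2) hD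
      (f := fun q : (ℝ × ℝ) × ℝ => (q.2 * q.1.1, q.1.2)) (by fun_prop)
  · intro ε x
    have hc : Continuous fun s : ℝ => ε • D (s * ε) x :=
      continuous_const.smul ((hD.contDiff_left x).continuous.comp (by fun_prop))
    have := intervalIntegral.integral_eq_sub_of_hasDerivAt (a := 0) (b := 1)
      (f := fun s => F (s * ε) x) (f' := fun s => ε • D (s * ε) x)
      (fun s _ => by
        simpa using! (hder (s * ε) x).scomp s ((hasDerivAt_id s).mul_const ε))
      (hc.intervalIntegrable _ _)
    rw [intervalIntegral.integral_smul] at this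
    simp [this]

/-- The integral remainder of the Taylor formula:
`G (x + h) = ∑_{j ≤ n} h^j / j! G^{(j)}(x) + h^{n+1} taylorRemainder n G h x`. -/
noncomputable def taylorRemainder (n : ℕ) (G : ℝ → E) (h x : ℝ) : E :=
  ∫ s in (0 : ℝ)..1, ((1 - s) ^ n / (n.factorial : ℝ)) • iteratedDeriv (n + 1) G (x + s * h)

/-- The integral form involves no division by `h`, hence it stays smooth through `h = 0`. -/
theorem jointlySmooth_taylorRemainder [CompleteSpace E] {G : ℝ → E} (hG : ContDiff ℝ ∞ G) (n : ℕ) :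
    JointlySmooth (taylorRemainder n G) := by
  refine JointlySmooth.intervalIntegral ?_
  exact ContDiff.smul (by fun_prop) ((contDiff_iteratedDeriv hG (n + 1)).comp (by fun_prop))

/-- Integration by parts in `s`. At `h = 0` it also evaluates the remainder. -/
theorem taylorRemainder_succ [CompleteSpace E] {G : ℝ → E} (hG : ContDiff ℝ ∞ G) (n : ℕ) (h x : ℝ) :
    taylorRemainder n G h x = (1 / ((n + 1).factorial : ℝ)) • iteratedDeriv (n + 1) G x +
      h • taylorRemainder (n + 1) G h x := by
  have hd : ∀ s : ℝ, HasDerivAt (fun s : ℝ => (-((1 - s) ^ (n + 1) / ((n + 1).factorial : ℝ))) •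
      iteratedDeriv (n + 1) G (x + s * h))
      (((1 - s) ^ n / (n.factorial : ℝ)) • iteratedDeriv (n + 1) G (x + s * h) -
        h • (((1 - s) ^ (n + 1) / ((n + 1).factorial : ℝ)) •
          iteratedDeriv (n + 1 + 1) G (x + s * h))) s := by
    intro s
    have h1 : HasDerivAt (fun s : ℝ => -((1 - s) ^ (n + 1) / ((n + 1).factorial : ℝ)))
        ((1 - s) ^ n / (n.factorial : ℝ)) s := by
      refine ((((hasDerivAt_id s).const_sub 1).pow (n + 1)).div_const
        ((n + 1).factorial : ℝ)).neg.congr_deriv ?_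
      have h0 : (n.factorial : ℝ) ≠ 0 := by positivity
      have h1 : (n : ℝ) + 1 ≠ 0 := by positivity
      rw [Nat.factorial_succ]
      push_cast
      simp only [id]
      field_simp
    have h2 : HasDerivAt (fun s : ℝ => iteratedDeriv (n + 1) G (x + s * h))
        (h • iteratedDeriv (n + 1 + 1) G (x + s * h)) s := hasDerivAt_comp_add_mul hG (n + 1) x h s
    refine (h1.smul h2).congr_deriv ?_
    module
  have hc1 : Continuous fun s : ℝ =>
      ((1 - s) ^ n / (n.factorial : ℝ)) • iteratedDeriv (n + 1) G (x + s * h) :=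
    Continuous.smul (by fun_prop) ((contDiff_iteratedDeriv hG (n + 1)).continuous.comp (by fun_prop))
  have hc2 : Continuous fun s : ℝ => ((1 - s) ^ (n + 1) / ((n + 1).factorial : ℝ)) •
      iteratedDeriv (n + 1 + 1) G (x + s * h) :=
    Continuous.smul (by fun_prop)
      ((contDiff_iteratedDeriv hG (n + 1 + 1)).continuous.comp (by fun_prop))
  have := intervalIntegral.integral_eq_sub_of_hasDerivAt (a := 0) (b := 1) (fun s _ => hd s)
    ((hc1.sub (hc2.const_smul h)).intervalIntegrable _ _)
  rw [intervalIntegral.integral_sub (hc1.intervalIntegrable _ _)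
    (Continuous.intervalIntegrable (by exact hc2.const_smul h) _ _),
    intervalIntegral.integral_smul] at this
  unfold taylorRemainder
  rw [sub_eq_iff_eq_add] at this
  rw [this]
  simp

theorem taylor_eq [CompleteSpace E] {G : ℝ → E} (hG : ContDiff ℝ ∞ G) (n : ℕ) (h x : ℝ) :
    G (x + h) = ∑ j ∈ Finset.range (n + 1), (h ^ j / (j.factorial : ℝ)) • iteratedDeriv j G x +
      h ^ (n + 1) • taylorRemainder n G h x := by
  induction n with
  | zero =>
    have hd : ∀ s : ℝ, HasDerivAt (fun s : ℝ => G (x + s * h))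
        (h • iteratedDeriv 1 G (x + s * h)) s := fun s => by
      simpa using hasDerivAt_comp_add_mul hG 0 x h s
    have hc : Continuous fun s : ℝ => iteratedDeriv 1 G (x + s * h) :=
      (contDiff_iteratedDeriv hG 1).continuous.comp (by fun_prop)
    have := intervalIntegral.integral_eq_sub_of_hasDerivAt (a := 0) (b := 1) (fun s _ => hd s)
      ((hc.const_smul h).intervalIntegrable _ _)
    rw [intervalIntegral.integral_smul] at this
    simp only [one_mul, zero_mul, add_zero] at this
    rw [← iteratedDeriv_zero (f := G)]
    simp [taylorRemainder, -iteratedDeriv_one, this]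
  | succ n ih =>
    rw [ih, Finset.sum_range_succ _ (n + 1), taylorRemainder_succ hG n h x]
    module

theorem taylorRemainder_add [CompleteSpace E] {G : ℝ → E} {T : ℝ} (A : E →L[ℝ] E) (hG : ContDiff ℝ ∞ G)
    (hT : ∀ x, G (x + T) = A (G x)) (n : ℕ) (h x : ℝ) :
    taylorRemainder n G h (x + T) = A (taylorRemainder n G h x) := by
  unfold taylorRemainder
  rw [← A.intervalIntegral_comp_comm]
  · congr 1
    ext s
    rw [add_right_comm, iteratedDeriv_add_right A hG hT, map_smul]
  · exact (Continuous.smul (by fun_prop)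
      ((contDiff_iteratedDeriv hG (n + 1)).continuous.comp (by fun_prop))).intervalIntegrable _ _

end Smooth

/-! ### Generalized cross product -/

section CrossProduct

variable {d : ℕ}

/-- The matrix with rows `v₀, …, v_{d-1}, w`. -/
def snocMatrix (v : Fin d → Fin (d + 1) → ℝ) (w : Fin (d + 1) → ℝ) :
    Matrix (Fin (d + 1)) (Fin (d + 1)) ℝ :=
  Matrix.of (Fin.snoc (α := fun _ => Fin (d + 1) → ℝ) v w)

@[simp] theorem snocMatrix_castSucc (v : Fin d → Fin (d + 1) → ℝ) (w : Fin (d + 1) → ℝ)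
    (i : Fin d) : snocMatrix v w i.castSucc = v i :=
  Fin.snoc_castSucc (α := fun _ => Fin (d + 1) → ℝ) w v i

@[simp] theorem snocMatrix_last (v : Fin d → Fin (d + 1) → ℝ) (w : Fin (d + 1) → ℝ) :
    snocMatrix v w (Fin.last d) = w :=
  Fin.snoc_last (α := fun _ => Fin (d + 1) → ℝ) w v

theorem snocMatrix_mul_transpose (v : Fin d → Fin (d + 1) → ℝ) (w : Fin (d + 1) → ℝ)
    (A : Matrix (Fin (d + 1)) (Fin (d + 1)) ℝ) :
    snocMatrix v w * Aᵀ = snocMatrix (fun l => A *ᵥ v l) (A *ᵥ w) := by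
  ext i j
  have h : ∀ u : Fin (d + 1) → ℝ, (A *ᵥ u) j = ∑ k, u k * Aᵀ k j := fun u => by
    simp [Matrix.mulVec, dotProduct, mul_comm]
  induction i using Fin.lastCases with
  | last => rw [Matrix.mul_apply, snocMatrix_last, snocMatrix_last, h]
  | cast i => rw [Matrix.mul_apply, snocMatrix_castSucc, snocMatrix_castSucc, h]

/-- The vector representing the linear form `w ↦ det (v₀, …, v_{d-1}, w)`. -/
def crossProd (v : Fin d → Fin (d + 1) → ℝ) : Fin (d + 1) → ℝ :=
  fun i => (snocMatrix v (Pi.single i 1)).det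

/-- `Matrix.cramer` presents the determinant as a linear map of its last row, so it suffices to
expand `w` in the standard basis. -/
theorem dotProduct_crossProd (v : Fin d → Fin (d + 1) → ℝ) (w : Fin (d + 1) → ℝ) :
    w ⬝ᵥ crossProd v = (snocMatrix v w).det := by
  have h : ∀ w, (snocMatrix v w).det =
      Matrix.cramer (snocMatrix v 0)ᵀ w (Fin.last d) := by
    intro w
    rw [Matrix.cramer_transpose_apply]
    congr 1
    ext i : 1
    induction i using Fin.lastCases with
    | last => simp
    | cast i => rw [Matrix.updateRow_ne (Fin.castSucc_lt_last i).ne]; simp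
  have hw : w = ∑ i, w i • (Pi.single i 1 : Fin (d + 1) → ℝ) := by
    ext j
    simp [Finset.sum_apply, Pi.single_apply]
  conv_rhs => rw [hw, h, map_sum, Finset.sum_apply]
  refine Finset.sum_congr rfl fun i _ => ?_
  rw [map_smul, Pi.smul_apply, ← h, smul_eq_mul, crossProd]

theorem dotProduct_crossProd_self (v : Fin d → Fin (d + 1) → ℝ) (i : Fin d) :
    v i ⬝ᵥ crossProd v = 0 := by
  rw [dotProduct_crossProd]
  exact Matrix.det_zero_of_row_eq (Fin.castSucc_lt_last i).ne (by simp)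

theorem mulVec_snocMatrix_eq_zero {v : Fin d → Fin (d + 1) → ℝ} {u w : Fin (d + 1) → ℝ}
    (h : ∀ i, v i ⬝ᵥ w = 0) (hu : u ⬝ᵥ w = 0) : snocMatrix v u *ᵥ w = 0 := by
  ext i
  induction i using Fin.lastCases with
  | last => simpa [Matrix.mulVec] using hu
  | cast i => simpa [Matrix.mulVec] using h i

/-- A vector orthogonal to independent `v₀, …, v_{d-1}` is a multiple of any nonzero such vector. -/
theorem eq_smul_of_dotProduct_eq_zero {v : Fin d → Fin (d + 1) → ℝ} {y z : Fin (d + 1) → ℝ}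
    (hv : crossProd v ≠ 0) (hz : z ≠ 0) (hvz : ∀ i, v i ⬝ᵥ z = 0) (hvy : ∀ i, v i ⬝ᵥ y = 0) :
    y = ((y ⬝ᵥ z) / (z ⬝ᵥ z)) • z := by
  -- This determinant is the squared length of `crossProd v`.
  have hdet : (snocMatrix v (crossProd v)).det ≠ 0 := by
    rw [← dotProduct_crossProd]
    exact fun h => hv (dotProduct_self_eq_zero.1 h)
  have hzz : z ⬝ᵥ z ≠ 0 := fun h => hz (dotProduct_self_eq_zero.1 h)
  have hcz : crossProd v ⬝ᵥ z ≠ 0 := fun h =>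
    hz (Matrix.eq_zero_of_mulVec_eq_zero hdet (mulVec_snocMatrix_eq_zero hvz h))
  have key : ∃ c : ℝ, y = c • z := by
    refine ⟨(crossProd v ⬝ᵥ y) / (crossProd v ⬝ᵥ z), ?_⟩
    rw [← sub_eq_zero]
    refine Matrix.eq_zero_of_mulVec_eq_zero hdet (mulVec_snocMatrix_eq_zero (fun i => ?_) ?_)
    · simp [dotProduct_sub, hvz i, hvy i]
    · rw [dotProduct_sub, dotProduct_smul, smul_eq_mul, div_mul_cancel₀ _ hcz, sub_self]
  obtain ⟨c, hc⟩ := key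
  rw [hc, smul_dotProduct, smul_eq_mul, mul_div_assoc, div_self hzz, mul_one]

/-- Covectors transform by the inverse transpose; no scalar factor appears because `det A = 1`. -/
theorem crossProd_mulVec (A : Matrix.SpecialLinearGroup (Fin (d + 1)) ℝ)
    (v : Fin d → Fin (d + 1) → ℝ) :
    crossProd (fun i => A.1 *ᵥ v i) = (A⁻¹).1ᵀ *ᵥ crossProd v := by
  refine dotProduct_eq _ _ fun w => ?_
  have hA : A.1 *ᵥ ((A⁻¹).1 *ᵥ w) = w := by
    rw [Matrix.mulVec_mulVec, ← Matrix.SpecialLinearGroup.coe_mul, mul_inv_cancel]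
    simp
  rw [dotProduct_comm, dotProduct_crossProd, Matrix.mulVec_transpose,
    ← Matrix.dotProduct_mulVec, dotProduct_comm, dotProduct_crossProd]
  conv_lhs => rw [← hA, ← snocMatrix_mul_transpose]
  simp

theorem det_snocMatrix_sum (N : Matrix (Fin d) (Fin d) ℝ) (v : Fin d → Fin (d + 1) → ℝ)
    (w : Fin (d + 1) → ℝ) :
    (snocMatrix (fun l => ∑ j, N l j • v j) w).det = N.det * (snocMatrix v w).det := by
  -- `B` is the block matrix `diag (N, 1)`, which carries the old rows to the new ones and fixes the
  -- last row.
  let B : Matrix (Fin (d + 1)) (Fin (d + 1)) ℝ :=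
    snocMatrix (fun l => Fin.snoc (α := fun _ => ℝ) (N l) 0) (Pi.single (Fin.last d) 1)
  have hB : B.det = N.det := by
    rw [Matrix.det_succ_row B (Fin.last d), Fin.sum_univ_castSucc]
    have h1 : ∀ j : Fin d, B (Fin.last d) j.castSucc = 0 := fun j => by
      simp [B, (Fin.castSucc_lt_last j).ne]
    have h2 : B.submatrix (Fin.last d).succAbove (Fin.last d).succAbove = N := by
      ext i j
      simp [B, Fin.succAbove_last]
    simp only [h1, h2]
    simp [B]
  rw [← hB, ← Matrix.det_mul]
  congr 1
  ext i j
  rw [Matrix.mul_apply, Fin.sum_univ_castSucc]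
  induction i using Fin.lastCases with
  | last => simp [B, fun i : Fin d => (Fin.castSucc_lt_last i).ne]
  | cast i => simp [B, Finset.sum_apply]

theorem contDiff_det {n : ℕ} {P : Type} [NormedAddCommGroup P] [NormedSpace ℝ P]
    {A : P → Matrix (Fin n) (Fin n) ℝ} (hA : ∀ i j, ContDiff ℝ ∞ fun p => A p i j) :
    ContDiff ℝ ∞ fun p => (A p).det := by
  simp only [Matrix.det_apply']
  exact ContDiff.sum fun σ _ => contDiff_const.mul (contDiff_prod fun i _ => hA _ _)

theorem contDiff_crossProd {P : Type} [NormedAddCommGroup P] [NormedSpace ℝ P]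
    {v : Fin d → P → Fin (d + 1) → ℝ} (hv : ∀ i, ContDiff ℝ ∞ (v i)) :
    ContDiff ℝ ∞ fun p => crossProd fun i => v i p := by
  refine contDiff_pi.2 fun k => contDiff_det fun i j => ?_
  induction i using Fin.lastCases with
  | last => simpa using contDiff_const
  | cast i => simpa using (contDiff_pi.1 (hv i)) j

end CrossProduct

/-! ### Derivatives of determinants -/

section Det

variable {n : ℕ}

/-- The determinant as a continuous multilinear map of the rows. -/
def detMultilinear (n : ℕ) : ContinuousMultilinearMap ℝ (fun _ : Fin n => Fin n → ℝ) ℝ where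
  toMultilinearMap := (Matrix.detRowAlternating (n := Fin n) (R := ℝ)).toMultilinearMap
  cont := Continuous.matrix_det (A := fun v : Fin n → Fin n → ℝ => Matrix.of v) continuous_id

theorem hasDerivAt_det {A A' : ℝ → Fin n → Fin n → ℝ} {x : ℝ}
    (hA : ∀ i, HasDerivAt (fun x => A x i) (A' x i) x) :
    HasDerivAt (fun x => (Matrix.of (A x)).det)
      (∑ i, ((Matrix.of (A x)).updateRow i (A' x i)).det) x := by
  have h := ((detMultilinear n).hasFDerivAt (A x)).comp_hasDerivAt x (hasDerivAt_pi.2 hA)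
  rw [ContinuousMultilinearMap.linearDeriv_apply] at h
  exact h

/-- If `det (1 + t B) = 1` along `t → 0`, `B → B₀`, then the trace of `B₀` vanishes. -/
theorem trace_eq_zero_of_det_one_add {l : Filter ℝ} [l.NeBot] {t : ℝ → ℝ}
    {B : ℝ → Matrix (Fin n) (Fin n) ℝ} {B₀ : Matrix (Fin n) (Fin n) ℝ} (ht : Tendsto t l (𝓝 0))
    (ht0 : ∀ᶠ ε in l, t ε ≠ 0) (hB : ∀ i j, Tendsto (fun ε => B ε i j) l (𝓝 (B₀ i j)))
    (hdet : ∀ᶠ ε in l, (1 + t ε • B ε).det = 1) : B₀.trace = 0 := by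
  let one : Fin n → Fin n → ℝ := fun i => (1 : Matrix (Fin n) (Fin n) ℝ) i
  have hfd := (detMultilinear n).hasFDerivAt one
  -- The derivative of the determinant at the identity is the trace.
  have htr : ∀ y : Fin n → Fin n → ℝ, (detMultilinear n).linearDeriv one y = ∑ i, y i i := by
    intro y
    rw [ContinuousMultilinearMap.linearDeriv_apply]
    refine Finset.sum_congr rfl fun i _ => ?_
    have h1 : Function.update one i (y i) =
        (1 : Matrix (Fin n) (Fin n) ℝ).updateRow i (∑ k, y i k • (1 : Matrix _ _ ℝ) k) := by
      change _ = Function.update one i _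
      congr 1
      ext k
      simp [Finset.sum_apply, Matrix.one_apply]
    rw [h1]
    refine (Matrix.det_updateRow_sum (1 : Matrix (Fin n) (Fin n) ℝ) i (y i)).trans ?_
    simp
  have hBt : Tendsto (fun ε => (fun i j => B ε i j : Fin n → Fin n → ℝ)) l
      (𝓝 fun i j => B₀ i j) := tendsto_pi_nhds.2 fun i => tendsto_pi_nhds.2 fun j => hB i j
  -- The difference quotients with step `t ε` tend to the derivative in the direction `B₀`, yet they
  -- vanish because the determinant stays equal to `1`.
  have hlim := hfd.hasFDerivWithinAt.lim (s := univ) (l := l) (c := fun ε => (t ε)⁻¹)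
    (d := fun ε => t ε • (fun i j => B ε i j : Fin n → Fin n → ℝ)) (v := fun i j => B₀ i j)
    (by simpa using ht.smul hBt) (by simp)
    (hBt.congr' (by
      filter_upwards [ht0] with ε hε
      rw [smul_smul, inv_mul_cancel₀ hε, one_smul]))
  rw [htr] at hlim
  refine tendsto_nhds_unique hlim (tendsto_const_nhds.congr' ?_)
  filter_upwards [hdet] with ε hε
  have h1 : detMultilinear n one = 1 := Matrix.det_one
  have h2 : detMultilinear n (one + t ε • (fun i j => B ε i j : Fin n → Fin n → ℝ)) = 1 := hε
  rw [h1, h2, sub_self, smul_zero]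

/-- Right multiplication by `F⁻¹` moves the base point to the identity. With `F` a moving frame, `P`
is the matrix of its variation in that frame, so this is the linearized Wronskian condition. -/
theorem trace_eq_zero_of_det_add {l : Filter ℝ} [l.NeBot] {t : ℝ → ℝ}
    {N : ℝ → Matrix (Fin n) (Fin n) ℝ} {F P : Matrix (Fin n) (Fin n) ℝ} (hF : F.det = 1)
    (ht : Tendsto t l (𝓝 0)) (ht0 : ∀ᶠ ε in l, t ε ≠ 0)
    (hN : ∀ i j, Tendsto (fun ε => N ε i j) l (𝓝 ((P * F) i j)))
    (hdet : ∀ᶠ ε in l, (F + t ε • N ε).det = 1) : P.trace = 0 := by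
  have hu : IsUnit F.det := by simp [hF]
  have hP : P = P * F * F⁻¹ := by rw [Matrix.mul_assoc, Matrix.mul_nonsing_inv _ hu, mul_one]
  refine trace_eq_zero_of_det_one_add (B := fun ε => N ε * F⁻¹) ht ht0 (fun i j => ?_) ?_
  · rw [hP]
    simp only [Matrix.mul_apply (N := F⁻¹)]
    exact tendsto_finsetSum _ fun k _ => (hN i k).mul_const _
  · filter_upwards [hdet] with ε hε
    rw [show 1 + t ε • (N ε * F⁻¹) = (F + t ε • N ε) * F⁻¹ by
      rw [Matrix.add_mul, Matrix.mul_nonsing_inv _ hu, Matrix.smul_mul], Matrix.det_mul, hε,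
      Matrix.det_nonsing_inv, hF]
    simp

end Det

/-! ### The moving frame of a curve -/

section Frame

variable {d : ℕ}

/-- The matrix with rows `G, G', …, G^{(d)}`. -/
noncomputable def frame (G : ℝ → Fin (d + 1) → ℝ) (x : ℝ) : Matrix (Fin (d + 1)) (Fin (d + 1)) ℝ :=
  Matrix.of fun i : Fin (d + 1) => iteratedDeriv (i : ℕ) G x

theorem wronskian_eq_det_frame (G : ℝ → Fin (d + 1) → ℝ) (x : ℝ) :
    wronskian G x = (frame G x).det := rfl

theorem frame_apply (G : ℝ → Fin (d + 1) → ℝ) (x : ℝ) (i : Fin (d + 1)) :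
    frame G x i = iteratedDeriv (i : ℕ) G x := rfl

theorem hasDerivAt_wronskian {G : ℝ → Fin (d + 1) → ℝ} (hG : ContDiff ℝ ∞ G) (x : ℝ) :
    HasDerivAt (wronskian G)
      ((frame G x).updateRow (Fin.last d) (iteratedDeriv (d + 1) G x)).det x := by
  have h := hasDerivAt_det (A := fun x (i : Fin (d + 1)) => iteratedDeriv (i : ℕ) G x)
    (A' := fun x (i : Fin (d + 1)) => iteratedDeriv ((i : ℕ) + 1) G x) (x := x)
    fun i => hasDerivAt_iteratedDeriv hG i x
  refine h.congr_deriv ?_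
  rw [Fin.sum_univ_castSucc]
  refine (add_eq_right.2 (Finset.sum_eq_zero fun i _ => ?_)).trans rfl
  -- Differentiating any row but the last reproduces the next row.
  exact Matrix.det_updateRow_eq_zero (M := frame G x) (i := i.succ) (j := i.castSucc)
    (Fin.castSucc_lt_succ).ne'

/-- Minus the coordinates of `G^{(d+1)}` with respect to the moving frame, by Cramer's rule. -/
noncomputable def curveCoeff (G : ℝ → Fin (d + 1) → ℝ) (j : Fin (d + 1)) (x : ℝ) : ℝ :=
  -((frame G x).updateRow j (iteratedDeriv (d + 1) G x)).det

theorem eq_zero_of_sum_frame {G : ℝ → Fin (d + 1) → ℝ} {x : ℝ} (hG : wronskian G x = 1)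
    {c : Fin (d + 1) → ℝ} (hc : ∑ j, c j • iteratedDeriv (j : ℕ) G x = 0) : c = 0 := by
  refine Matrix.eq_zero_of_vecMul_eq_zero (M := frame G x)
    (by rw [← wronskian_eq_det_frame, hG]; exact one_ne_zero) ?_
  rw [← hc]
  ext k
  simp [Matrix.vecMul, dotProduct, Finset.sum_apply, frame]

theorem eq_zero_of_sum_frame' {G : ℝ → Fin (d + 1) → ℝ} {x : ℝ} (hG : wronskian G x = 1)
    {c : Fin d → ℝ} (hc : ∑ j, c j • iteratedDeriv (j : ℕ) G x = 0) : c = 0 := by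
  have := eq_zero_of_sum_frame hG (c := Fin.snoc (α := fun _ => ℝ) c 0)
    (by rw [Fin.sum_univ_castSucc]; simpa using hc)
  ext j
  simpa using congrFun this j.castSucc

/-- Cramer's rule gives all coordinates of `G^{(d+1)}`; the one along `G^{(d)}` is the derivative of
the constant Wronskian, hence zero. -/
theorem hasCoeffs_curveCoeff {G : ℝ → Fin (d + 1) → ℝ} (hG : ContDiff ℝ ∞ G)
    (hW : ∀ x, wronskian G x = 1) : HasCoeffs G fun j => curveCoeff G j.castSucc := by
  intro x
  have h1 : ∑ j, curveCoeff G j x • iteratedDeriv (j : ℕ) G x = -iteratedDeriv (d + 1) G x := by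
    have := Matrix.mulVec_cramer (frame G x)ᵀ (iteratedDeriv (d + 1) G x)
    rw [Matrix.det_transpose, ← wronskian_eq_det_frame, hW, one_smul] at this
    rw [← this]
    ext k
    simp only [Matrix.mulVec, dotProduct, Matrix.cramer_transpose_apply, Finset.sum_apply,
      Pi.smul_apply, smul_eq_mul, Pi.neg_apply, curveCoeff, neg_mul, Finset.sum_neg_distrib]
    congr 1
    refine Finset.sum_congr rfl fun j _ => mul_comm _ _
  have h2 : curveCoeff G (Fin.last d) x = 0 := by
    have h := hasDerivAt_wronskian hG x
    rw [show wronskian G = fun _ => 1 from funext hW] at h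
    rw [curveCoeff, h.unique (hasDerivAt_const x 1), neg_zero]
  rw [Fin.sum_univ_castSucc, h2, zero_smul, add_zero] at h1
  rw [← neg_eq_iff_add_eq_zero, ← h1]
  rfl

theorem HasCoeffs.unique {G : ℝ → Fin (d + 1) → ℝ} {u u' : Fin d → ℝ → ℝ}
    (hW : ∀ x, wronskian G x = 1) (h : HasCoeffs G u) (h' : HasCoeffs G u') : u = u' := by
  ext j x
  have := eq_zero_of_sum_frame' (hW x) (c := fun j => u j x - u' j x) (by
    simp only [sub_smul, Finset.sum_sub_distrib]
    rw [sub_eq_zero]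
    exact add_left_cancel ((h x).trans (h' x).symm))
  exact sub_eq_zero.1 (congrFun this j)

theorem jointlySmooth_apply {F : ℝ → ℝ → Fin (d + 1) → ℝ} (hF : JointlySmooth F) (i : Fin (d + 1)) :
    JointlySmooth fun ε x => F ε x i := contDiff_pi.1 hF i

theorem jointlySmooth_wronskian {F : ℝ → ℝ → Fin (d + 1) → ℝ} (hF : JointlySmooth F) :
    JointlySmooth fun ε x => wronskian (F ε) x :=
  contDiff_det fun i j => jointlySmooth_apply (hF.iteratedDeriv i) j

theorem jointlySmooth_curveCoeff {F : ℝ → ℝ → Fin (d + 1) → ℝ} (hF : JointlySmooth F)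
    (j : Fin (d + 1)) : JointlySmooth fun ε x => curveCoeff (F ε) j x := by
  refine (contDiff_det fun i k => ?_).neg
  by_cases h : i = j
  · subst h
    simpa using! jointlySmooth_apply (hF.iteratedDeriv (d + 1)) k
  · simpa [h, frame] using! jointlySmooth_apply (hF.iteratedDeriv i) k

theorem iteratedDeriv_add_right_mulVec {G : ℝ → Fin (d + 1) → ℝ} {T : ℝ}
    {A : Matrix (Fin (d + 1)) (Fin (d + 1)) ℝ} (hG : ContDiff ℝ ∞ G)
    (hT : ∀ x, G (x + T) = A *ᵥ G x) (j : ℕ) (x : ℝ) :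
    iteratedDeriv j G (x + T) = A *ᵥ iteratedDeriv j G x :=
  iteratedDeriv_add_right (LinearMap.toContinuousLinearMap A.mulVecLin) hG hT j x

theorem curveCoeff_periodic {G : ℝ → Fin (d + 1) → ℝ} {T : ℝ}
    (A : Matrix.SpecialLinearGroup (Fin (d + 1)) ℝ) (hG : ContDiff ℝ ∞ G)
    (hT : ∀ x, G (x + T) = A.1 *ᵥ G x) (j : Fin (d + 1)) : Function.Periodic (curveCoeff G j) T := by
  intro x
  have h : (frame G (x + T)).updateRow j (iteratedDeriv (d + 1) G (x + T)) =
      (frame G x).updateRow j (iteratedDeriv (d + 1) G x) * A.1ᵀ := by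
    ext i k
    have h : ∀ u : Fin (d + 1) → ℝ, (A.1 *ᵥ u) k = ∑ l, u l * A.1ᵀ l k := fun u => by
      simp [Matrix.mulVec, dotProduct, mul_comm]
    rw [Matrix.mul_apply]
    by_cases hi : i = j
    · subst hi
      rw [Matrix.updateRow_self, Matrix.updateRow_self, iteratedDeriv_add_right_mulVec hG hT, h]
    · rw [Matrix.updateRow_ne hi, Matrix.updateRow_ne hi, frame_apply, frame_apply,
        iteratedDeriv_add_right_mulVec hG hT, h]
  rw [curveCoeff, h, Matrix.det_mul, Matrix.det_transpose, A.2, mul_one, curveCoeff]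

theorem wronskian_periodic {G : ℝ → Fin (d + 1) → ℝ} {T : ℝ}
    (A : Matrix.SpecialLinearGroup (Fin (d + 1)) ℝ) (hG : ContDiff ℝ ∞ G)
    (hT : ∀ x, G (x + T) = A.1 *ᵥ G x) : Function.Periodic (wronskian G) T := by
  intro x
  have h : frame G (x + T) = frame G x * A.1ᵀ := by
    ext i k
    rw [frame_apply, iteratedDeriv_add_right_mulVec hG hT, Matrix.mul_apply]
    simp [Matrix.mulVec, dotProduct, mul_comm, frame]
  rw [wronskian_eq_det_frame, h, Matrix.det_mul, Matrix.det_transpose, A.2, mul_one,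
    wronskian_eq_det_frame]

/-- The matrix of `f G, (f G)', …` with respect to the frame of `G`. -/
noncomputable def leibnizMatrix (d : ℕ) (f : ℝ → ℝ) (x : ℝ) : Matrix (Fin (d + 1)) (Fin (d + 1)) ℝ :=
  Matrix.of fun i j => if (j : ℕ) ≤ i then ((i : ℕ).choose j : ℝ) * iteratedDeriv (i - j) f x else 0

theorem frame_smul {f : ℝ → ℝ} {G : ℝ → Fin (d + 1) → ℝ} (hf : ContDiff ℝ ∞ f)
    (hG : ContDiff ℝ ∞ G) (x : ℝ) :
    frame (fun x => f x • G x) x = leibnizMatrix d f x * frame G x := by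
  ext i k
  rw [frame_apply, iteratedDeriv_smul_of_contDiff hf hG, Matrix.mul_apply, Finset.sum_apply]
  refine Eq.trans ?_ (Fin.sum_univ_eq_sum_range (fun j : ℕ => (if j ≤ (i : ℕ) then
    ((i : ℕ).choose j : ℝ) * iteratedDeriv (i - j) f x else 0) * iteratedDeriv j G x k) (d + 1)).symm
  refine Finset.sum_subset_zero_on_sdiff (Finset.range_mono i.2) (fun j hj => ?_) fun j hj => ?_
  · simp only [Finset.mem_sdiff, Finset.mem_range] at hj
    rw [if_neg (by omega), zero_mul]
  · rw [Finset.mem_range] at hj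
    rw [if_pos (by omega)]
    rfl

theorem leibnizMatrix_trace (f : ℝ → ℝ) (x : ℝ) :
    (leibnizMatrix d f x).trace = ((d : ℝ) + 1) * f x := by
  simp [Matrix.trace, leibnizMatrix]

/-- The Leibniz matrix is lower triangular with `f` on the diagonal. -/
theorem wronskian_smul {f : ℝ → ℝ} {G : ℝ → Fin (d + 1) → ℝ} (hf : ContDiff ℝ ∞ f)
    (hG : ContDiff ℝ ∞ G) (x : ℝ) :
    wronskian (fun x => f x • G x) x = f x ^ (d + 1) * wronskian G x := by
  rw [wronskian_eq_det_frame, frame_smul hf hG, Matrix.det_mul, Matrix.det_of_isLowerTriangular]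
  · simp [leibnizMatrix, wronskian_eq_det_frame]
  · intro i j hij
    have : (i : ℕ) < j := hij
    simp [leibnizMatrix, this.not_ge, -Fin.val_fin_le]

end Frame

/-! ### Dual curves -/

section Dual

variable {d : ℕ}

theorem hasDerivAt_dotProduct {n : ℕ} {y z y' z' : ℝ → Fin n → ℝ} {x : ℝ}
    (hy : HasDerivAt y (y' x) x) (hz : HasDerivAt z (z' x) x) :
    HasDerivAt (fun x => y x ⬝ᵥ z x) (y' x ⬝ᵥ z x + y x ⬝ᵥ z' x) x := by
  refine (HasDerivAt.fun_sum fun i _ =>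
    (hasDerivAt_pi.1 hy i).mul (hasDerivAt_pi.1 hz i)).congr_deriv ?_
  rw [Finset.sum_add_distrib]
  rfl

/-- Differentiating a constant pairing moves one derivative across it with a sign. Iterating this
makes the duality between `y` and `z` symmetric. -/
theorem dotProduct_iteratedDeriv_succ {y z : ℝ → Fin (d + 1) → ℝ} (hy : ContDiff ℝ ∞ y)
    (hz : ContDiff ℝ ∞ z) {i j : ℕ} {c : ℝ}
    (h : ∀ x, iteratedDeriv i y x ⬝ᵥ iteratedDeriv j z x = c) (x : ℝ) :
    iteratedDeriv (i + 1) y x ⬝ᵥ iteratedDeriv j z x =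
      -(iteratedDeriv i y x ⬝ᵥ iteratedDeriv (j + 1) z x) := by
  have h1 := hasDerivAt_dotProduct (y' := iteratedDeriv (i + 1) y) (z' := iteratedDeriv (j + 1) z)
    (hasDerivAt_iteratedDeriv hy i x) (hasDerivAt_iteratedDeriv hz j x)
  rw [funext h] at h1
  exact eq_neg_of_add_eq_zero_left (h1.unique (hasDerivAt_const x c))

theorem dotProduct_iteratedDeriv_eq_zero {y z : ℝ → Fin (d + 1) → ℝ} (hy : ContDiff ℝ ∞ y)
    (hz : ContDiff ℝ ∞ z) (h : ∀ j < d, ∀ x, y x ⬝ᵥ iteratedDeriv j z x = 0) (i : ℕ) :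
    ∀ j, i + j < d → ∀ x, iteratedDeriv i y x ⬝ᵥ iteratedDeriv j z x = 0 := by
  induction i with
  | zero => simpa using h
  | succ i ih =>
    intro j hj x
    rw [dotProduct_iteratedDeriv_succ hy hz (ih j (by omega)), ih (j + 1) (by omega), neg_zero]

theorem dotProduct_iteratedDeriv_eq_neg_one_pow {y z : ℝ → Fin (d + 1) → ℝ} (hy : ContDiff ℝ ∞ y)
    (hz : ContDiff ℝ ∞ z) (h : ∀ j < d, ∀ x, y x ⬝ᵥ iteratedDeriv j z x = 0)
    (h1 : ∀ x, y x ⬝ᵥ iteratedDeriv d z x = 1) (i : ℕ) :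
    ∀ j, i + j = d → ∀ x, iteratedDeriv i y x ⬝ᵥ iteratedDeriv j z x = (-1) ^ i := by
  induction i with
  | zero =>
    intro j hj x
    rw [zero_add] at hj
    simp [hj, h1]
  | succ i ih =>
    intro j hj x
    rw [dotProduct_iteratedDeriv_succ hy hz (dotProduct_iteratedDeriv_eq_zero hy hz h i j (by omega)),
      ih (j + 1) (by omega), pow_succ]
    ring

/-- The dual of the dual curve is the curve itself, up to a universal constant. -/
theorem exists_crossProd_dual_eq_smul (d : ℕ) : ∃ c : ℝ, c ≠ 0 ∧
    ∀ y z : ℝ → Fin (d + 1) → ℝ, ContDiff ℝ ∞ y → ContDiff ℝ ∞ z → (∀ x, wronskian z x = 1) →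
      (∀ j < d, ∀ x, y x ⬝ᵥ iteratedDeriv j z x = 0) → (∀ x, y x ⬝ᵥ iteratedDeriv d z x = 1) →
      ∀ x, crossProd (fun i : Fin d => iteratedDeriv (i : ℕ) y x) = c • z x := by
  -- The pairings `y^{(i)} · z^{(j)}` vanish for `i + j < d` and are `±1` for `i + j = d`. Reversing
  -- the columns makes this matrix lower triangular, so its determinant is the sign `s` of the
  -- reversal times the product `a` of the diagonal.
  let s : ℝ := ((Equiv.Perm.sign (Fin.revPerm (n := d + 1)) : ℤ) : ℝ)
  let a : ℝ := ∏ i : Fin (d + 1), (-1 : ℝ) ^ (i : ℕ)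
  have hs : s * s = 1 := by
    rcases Int.units_eq_one_or (Equiv.Perm.sign (Fin.revPerm (n := d + 1))) with h | h <;>
      simp [s, h]
  have ha : a ≠ 0 := Finset.prod_ne_zero_iff.2 fun i _ => by simp
  have hs0 : s ≠ 0 := fun h => by simp [h] at hs
  refine ⟨(-1) ^ d * (s * a), by simp [hs0, ha], fun y z hy hz hW h0 h1 x => ?_⟩
  let N := frame y x
  have hdet : N.det = s * a := by
    have h2 : ((N * (frame z x)ᵀ).submatrix id Fin.revPerm).det = a := by
      have hentry : ∀ i j : Fin (d + 1), (N * (frame z x)ᵀ).submatrix id Fin.revPerm i j =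
          iteratedDeriv (i : ℕ) y x ⬝ᵥ iteratedDeriv (d - j) z x := fun i j => by
        simp only [Matrix.submatrix_apply, Matrix.mul_apply, Matrix.transpose_apply, id,
          Fin.revPerm_apply, frame_apply, N, Fin.val_rev, Nat.add_sub_add_right]
        rfl
      rw [Matrix.det_of_isLowerTriangular]
      · refine Finset.prod_congr rfl fun i _ => ?_
        rw [hentry]
        exact dotProduct_iteratedDeriv_eq_neg_one_pow hy hz h0 h1 i _ (by omega) x
      · intro i j hij
        have hij' : (i : ℕ) < j := hij
        rw [hentry]
        exact dotProduct_iteratedDeriv_eq_zero hy hz h0 i _ (by omega) x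
    rw [Matrix.det_permute', Matrix.det_mul, Matrix.det_transpose, ← wronskian_eq_det_frame z, hW,
      mul_one] at h2
    rw [← h2, ← mul_assoc, hs, one_mul]
  have hN : snocMatrix (fun i : Fin d => iteratedDeriv (i : ℕ) y x) (iteratedDeriv d y x) = N := by
    ext i : 1
    induction i using Fin.lastCases with
    | last => rw [snocMatrix_last]; rfl
    | cast i => rw [snocMatrix_castSucc]; rfl
  rw [← sub_eq_zero]
  -- The two vectors are compared through their pairings with the rows of the invertible matrix `N`.
  refine Matrix.eq_zero_of_mulVec_eq_zero (M := N) (by rw [hdet]; exact mul_ne_zero hs0 ha) ?_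
  rw [← hN]
  refine mulVec_snocMatrix_eq_zero (fun i => ?_) ?_
  · rw [dotProduct_sub, dotProduct_crossProd_self (fun i : Fin d => iteratedDeriv (i : ℕ) y x),
      dotProduct_smul, ← iteratedDeriv_zero (f := z),
      dotProduct_iteratedDeriv_eq_zero hy hz h0 i 0 (by simp)]
    simp
  · rw [dotProduct_sub, dotProduct_crossProd, hN, hdet, dotProduct_smul,
      ← iteratedDeriv_zero (f := z), dotProduct_iteratedDeriv_eq_neg_one_pow hy hz h0 h1 d 0 (by simp)]
    rw [smul_eq_mul, mul_right_comm, ← pow_add, ← two_mul]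
    simp

/-- The power `w ^ (-1/(n+1))` is needed only near `1`, but joint smoothness is required for all
`(ε, x)`, including points where the Wronskian vanishes; hence the cut-off. -/
theorem exists_smooth_root (n : ℕ) : ∃ ρ : ℝ → ℝ, ContDiff ℝ ∞ ρ ∧ ρ 1 = 1 ∧
    ∀ w, |w - 1| < 1 / 2 → ρ w ^ (n + 1) * w = 1 := by
  let χ : ContDiffBump (1 : ℝ) := ⟨1 / 2, 3 / 4, by norm_num, by norm_num⟩
  let φ : ℝ → ℝ := fun w => χ w * w + (1 - χ w)
  have hφ : ContDiff ℝ ∞ φ := by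
    have h : ContDiff ℝ ∞ fun w => χ w := χ.contDiff
    exact (h.mul contDiff_id).add (contDiff_const.sub h)
  have hφ1 : ∀ w, |w - 1| < 1 / 2 → φ w = w := fun w hw => by
    have : χ w = 1 := χ.one_of_mem_closedBall (by
      rw [Metric.mem_closedBall, Real.dist_eq]; exact hw.le)
    simp [φ, this]
  have hpos : ∀ w, 0 < φ w := fun w => by
    by_cases hw : |w - 1| < 3 / 4
    · have h1 : 0 < w := by linarith [(abs_lt.1 hw).1]
      have h2 : 0 < χ w := χ.pos_of_mem_ball (by rw [Metric.mem_ball, Real.dist_eq]; exact hw)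
      have h3 : χ w ≤ 1 := χ.le_one
      have := mul_pos h2 h1
      simp only [φ]
      linarith
    · have : χ w = 0 := χ.zero_of_le_dist (by rw [Real.dist_eq]; exact not_lt.1 hw)
      simp [φ, this]
  refine ⟨fun w => (φ w) ^ (-(1 / ((n : ℝ) + 1))), hφ.rpow_const_of_ne fun w => (hpos w).ne', ?_,
    fun w hw => ?_⟩
  · simp only
    rw [hφ1 1 (by norm_num), Real.one_rpow]
  · have hw0 : 0 < w := hφ1 w hw ▸ hpos w
    have hn : (n : ℝ) + 1 ≠ 0 := by positivity
    simp only
    rw [hφ1 w hw, ← Real.rpow_natCast, ← Real.rpow_mul hw0.le]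
    push_cast
    rw [neg_mul, one_div, inv_mul_cancel₀ hn, Real.rpow_neg_one, inv_mul_cancel₀ hw0.ne']

end Dual

/-! ### The hyperplanes through `d` points of a curve -/

section Envelope

variable {d : ℕ}

/-- Vectors spanning, for `ε ≠ 0`, the same subspace as the points `G (x + k_l ε)`, and depending
smoothly on `ε`. -/
noncomputable def envBasis (k : Fin d → ℝ) (G : ℝ → Fin (d + 1) → ℝ) (j : Fin d) (ε x : ℝ) :
    Fin (d + 1) → ℝ :=
  iteratedDeriv (j : ℕ) G x + ((j : ℕ).factorial * ε ^ (d - j) : ℝ) •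
    ∑ l, ((Matrix.vandermonde k)⁻¹ j l * k l ^ d) • taylorRemainder (d - 1) G (k l * ε) x

/-- The equation of the hyperplane through the points `G (x + k_l ε)`, extended to `ε = 0`. -/
noncomputable def envCovector (k : Fin d → ℝ) (G : ℝ → Fin (d + 1) → ℝ) (ε x : ℝ) :
    Fin (d + 1) → ℝ :=
  crossProd fun j => envBasis k G j ε x

theorem jointlySmooth_envBasis (k : Fin d → ℝ) {G : ℝ → Fin (d + 1) → ℝ} (hG : ContDiff ℝ ∞ G)
    (j : Fin d) : JointlySmooth (envBasis k G j) := by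
  refine ContDiff.add ((JointlySmooth.of_right hG).iteratedDeriv j) (ContDiff.smul
    (contDiff_const.mul (contDiff_fst.pow _))
    (ContDiff.sum fun l _ => ContDiff.const_smul _ ?_))
  exact (jointlySmooth_taylorRemainder hG (d - 1)).comp_mul_left (k l)

theorem jointlySmooth_envCovector (k : Fin d → ℝ) {G : ℝ → Fin (d + 1) → ℝ}
    (hG : ContDiff ℝ ∞ G) : JointlySmooth (envCovector k G) :=
  contDiff_crossProd fun j => jointlySmooth_envBasis k hG j

/-- The Taylor remainders at the `d` points form a vector indexed by `l`, and the inverse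
Vandermonde matrix distributes it over the `d` Taylor terms. A remainder carries `ε ^ d` and the
term of index `j` only `ε ^ j`, so the correction keeps the positive power `ε ^ (d - j)`. -/
theorem point_eq_sum_envBasis (hd : 1 ≤ d) {k : Fin d → ℝ} (hk : Function.Injective k)
    {G : ℝ → Fin (d + 1) → ℝ} (hG : ContDiff ℝ ∞ G) (ε x : ℝ) (l : Fin d) :
    G (x + k l * ε) = ∑ j : Fin d, ((k l * ε) ^ (j : ℕ) / ((j : ℕ).factorial : ℝ)) •
      envBasis k G j ε x := by
  have hB : IsUnit (Matrix.vandermonde k).det :=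
    (Matrix.det_vandermonde_ne_zero_iff.2 hk).isUnit
  have hinv : ∀ l', ∑ j : Fin d, k l ^ (j : ℕ) * (Matrix.vandermonde k)⁻¹ j l' =
      if l = l' then 1 else 0 := fun l' => by
    have := congrFun (congrFun (Matrix.mul_nonsing_inv _ hB) l) l'
    rw [Matrix.mul_apply, Matrix.one_apply] at this
    exact this
  have hT := taylor_eq hG (d - 1) (k l * ε) x
  rw [Nat.sub_add_cancel hd] at hT
  rw [hT, ← Fin.sum_univ_eq_sum_range
    (fun j => ((k l * ε) ^ j / (j.factorial : ℝ)) • iteratedDeriv j G x)]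
  simp only [envBasis, smul_add, Finset.sum_add_distrib]
  congr 1
  have h1 : ∀ j : Fin d, ((k l * ε) ^ (j : ℕ) / ((j : ℕ).factorial : ℝ)) •
      (((j : ℕ).factorial * ε ^ (d - j) : ℝ) • ∑ l', ((Matrix.vandermonde k)⁻¹ j l' * k l' ^ d) •
        taylorRemainder (d - 1) G (k l' * ε) x) =
      ∑ l', (ε ^ d * k l' ^ d * (k l ^ (j : ℕ) * (Matrix.vandermonde k)⁻¹ j l')) •
        taylorRemainder (d - 1) G (k l' * ε) x := by
    intro j
    rw [smul_smul, Finset.smul_sum]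
    refine Finset.sum_congr rfl fun l' _ => ?_
    rw [smul_smul]
    congr 1
    have hf : ((j : ℕ).factorial : ℝ) ≠ 0 := by positivity
    rw [show ε ^ d = ε ^ (j : ℕ) * ε ^ (d - j) by rw [← pow_add, Nat.add_sub_cancel' j.2.le]]
    rw [mul_pow]
    field_simp
  simp only [h1]
  rw [Finset.sum_comm]
  simp only [← Finset.sum_smul, ← Finset.mul_sum, hinv]
  simp [mul_pow, mul_comm]

/-- The change of basis is a Vandermonde matrix with rescaled columns, invertible for `ε ≠ 0` and
independent of `x`. -/
theorem exists_det_points_eq_mul (hd : 1 ≤ d) {k : Fin d → ℝ} (hk : Function.Injective k)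
    {G : ℝ → Fin (d + 1) → ℝ} (hG : ContDiff ℝ ∞ G) {ε : ℝ} (hε : ε ≠ 0) : ∃ c : ℝ, c ≠ 0 ∧
    ∀ x w, (snocMatrix (fun l => G (x + k l * ε)) w).det = c * (envCovector k G ε x ⬝ᵥ w) := by
  refine ⟨(Matrix.of fun l j : Fin d => (k l * ε) ^ (j : ℕ) / ((j : ℕ).factorial : ℝ)).det, ?_,
    fun x w => ?_⟩
  · have h := Matrix.det_mul_row (fun j : Fin d => (((j : ℕ).factorial : ℝ))⁻¹)
      (Matrix.vandermonde fun l => k l * ε)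
    have h2 : (Matrix.of fun l j : Fin d => (k l * ε) ^ (j : ℕ) / ((j : ℕ).factorial : ℝ)) =
        Matrix.of fun i j : Fin d => (((j : ℕ).factorial : ℝ))⁻¹ *
          Matrix.vandermonde (fun l => k l * ε) i j := by
      ext i j
      simp [Matrix.vandermonde, div_eq_inv_mul]
    rw [h2, h]
    refine mul_ne_zero (Finset.prod_ne_zero_iff.2 fun j _ => by positivity)
      (Matrix.det_vandermonde_ne_zero_iff.2 fun a b hab => hk (mul_right_cancel₀ hε hab))
  · rw [dotProduct_comm, envCovector, dotProduct_crossProd, ← det_snocMatrix_sum]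
    congr 2
    exact funext fun l => point_eq_sum_envBasis hd hk hG ε x l

theorem envBasis_zero (k : Fin d → ℝ) (G : ℝ → Fin (d + 1) → ℝ) (j : Fin d) (x : ℝ) :
    envBasis k G j 0 x = iteratedDeriv (j : ℕ) G x := by
  have : d - (j : ℕ) ≠ 0 := by omega
  simp [envBasis, this]

theorem envCovector_zero_dotProduct (k : Fin d → ℝ) (G : ℝ → Fin (d + 1) → ℝ) (x : ℝ) {j : ℕ}
    (hj : j < d) : envCovector k G 0 x ⬝ᵥ iteratedDeriv j G x = 0 := by
  rw [dotProduct_comm, ← envBasis_zero k G ⟨j, hj⟩, envCovector]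
  exact dotProduct_crossProd_self (fun j => envBasis k G j 0 x) ⟨j, hj⟩

theorem envCovector_zero_dotProduct_top (k : Fin d → ℝ) {G : ℝ → Fin (d + 1) → ℝ} {x : ℝ}
    (hW : wronskian G x = 1) : envCovector k G 0 x ⬝ᵥ iteratedDeriv d G x = 1 := by
  rw [dotProduct_comm, envCovector, dotProduct_crossProd, ← hW, wronskian_eq_det_frame]
  congr 1
  ext i : 1
  induction i using Fin.lastCases with
  | last => rw [snocMatrix_last]; rfl
  | cast i => rw [snocMatrix_castSucc, envBasis_zero]; rfl

/-- The inverse transpose. -/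
def contragredient (M : Matrix.SpecialLinearGroup (Fin (d + 1)) ℝ) :
    Matrix.SpecialLinearGroup (Fin (d + 1)) ℝ := M⁻¹.transpose

/-- The basis vectors are multiplied by `M`, so the covector is multiplied by the inverse transpose.
The second dualization, by `crossProd_contragredient`, brings `M` back. -/
theorem envCovector_add (k : Fin d → ℝ) {M : Matrix.SpecialLinearGroup (Fin (d + 1)) ℝ}
    {G : ℝ → Fin (d + 1) → ℝ} (hG : IsNormalizedLift M G) (ε x : ℝ) :
    envCovector k G ε (x + 2 * Real.pi) = (contragredient M).1 *ᵥ envCovector k G ε x := by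
  have h : ∀ j, envBasis k G j ε (x + 2 * Real.pi) = M.1 *ᵥ envBasis k G j ε x := by
    intro j
    have hR : ∀ h, taylorRemainder (d - 1) G h (x + 2 * Real.pi) =
        M.1 *ᵥ taylorRemainder (d - 1) G h x := fun h =>
      taylorRemainder_add (LinearMap.toContinuousLinearMap M.1.mulVecLin) hG.smooth hG.monodromy _ h x
    simp only [envBasis, hR, iteratedDeriv_add_right_mulVec hG.smooth hG.monodromy,
      Matrix.mulVec_add, Matrix.mulVec_smul, Matrix.mulVec_sum]
  simp only [envCovector, h]
  exact crossProd_mulVec M _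

theorem crossProd_contragredient (M : Matrix.SpecialLinearGroup (Fin (d + 1)) ℝ)
    (v : Fin d → Fin (d + 1) → ℝ) :
    crossProd (fun i => (contragredient M).1 *ᵥ v i) = M.1 *ᵥ crossProd v := by
  rw [crossProd_mulVec]
  congr 1
  have : (contragredient M)⁻¹ = M.transpose := by
    rw [inv_eq_iff_eq_inv]
    ext i j
    simp only [contragredient, Matrix.SpecialLinearGroup.coe_inv,
      Matrix.SpecialLinearGroup.coe_transpose]
    rw [← Matrix.adjugate_transpose]
  rw [this]
  simp [Matrix.SpecialLinearGroup.coe_transpose]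

theorem jointlySmooth_crossProd_iteratedDeriv {H : ℝ → ℝ → Fin (d + 1) → ℝ} (hH : JointlySmooth H) :
    JointlySmooth fun ε x => crossProd fun i : Fin d => iteratedDeriv (i : ℕ) (H ε) x :=
  contDiff_crossProd fun i => hH.iteratedDeriv i

/-- A function that is close to `1` at `ε = 0` is uniformly so for small `ε`, if it is periodic. -/
theorem eventually_forall_abs_sub_one_lt {W : ℝ → ℝ → ℝ} (hW : JointlySmooth W)
    (h0 : ∀ x, W 0 x = 1) (hper : ∀ ε, Function.Periodic (W ε) (2 * Real.pi)) :
    ∀ᶠ ε in 𝓝 (0 : ℝ), ∀ x, |W ε x - 1| < 1 / 2 := by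
  have h1 : ∀ᶠ ε in 𝓝 (0 : ℝ), ∀ x ∈ Icc 0 (0 + 2 * Real.pi), |W ε x - 1| < 1 / 2 := by
    refine isCompact_Icc.eventually_forall_of_forall_eventually fun x _ => ?_
    have hc : ContinuousAt (fun z : ℝ × ℝ => |W z.1 z.2 - 1|) (0, x) :=
      (hW.continuous.sub continuous_const).abs.continuousAt
    refine hc.eventually_lt continuousAt_const ?_
    simp [h0]
  filter_upwards [h1] with ε hε x
  obtain ⟨y, hy, hxy⟩ := (hper ε).exists_mem_Ico₀ Real.two_pi_pos x
  rw [hxy]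
  exact hε y ⟨hy.1, by simpa using hy.2.le⟩

/-- The normalized lifts of the envelopes form a smooth family through `G`. -/
theorem exists_jointlySmooth_envelope (k : Fin d → ℝ)
    {M : Matrix.SpecialLinearGroup (Fin (d + 1)) ℝ} {G : ℝ → Fin (d + 1) → ℝ}
    (hG : IsNormalizedLift M G) : ∃ Λ : ℝ → ℝ → Fin (d + 1) → ℝ, JointlySmooth Λ ∧ Λ 0 = G ∧
      ∀ᶠ ε in 𝓝 (0 : ℝ), IsNormalizedLift M (Λ ε) ∧
        (∀ j < d, ∀ x, envCovector k G ε x ⬝ᵥ iteratedDeriv j (Λ ε) x = 0) ∧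
        ∀ x, crossProd (fun i : Fin d => iteratedDeriv (i : ℕ) (envCovector k G ε) x) ≠ 0 := by
  let H := envCovector k G
  have hH : JointlySmooth H := jointlySmooth_envCovector k hG.smooth
  obtain ⟨c, hc, hdual⟩ := exists_crossProd_dual_eq_smul d
  -- The dual of the covector curve is the envelope up to scale; the factor `c⁻¹` makes it equal `G`
  -- at `ε = 0`.
  let X : ℝ → ℝ → Fin (d + 1) → ℝ := fun ε x =>
    c⁻¹ • crossProd fun i : Fin d => iteratedDeriv (i : ℕ) (H ε) x
  have hX : JointlySmooth X := ContDiff.const_smul c⁻¹ (jointlySmooth_crossProd_iteratedDeriv hH)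
  have hX0 : X 0 = G := by
    ext1 x
    simp only [X]
    rw [hdual (H 0) G (hH.contDiff_right 0) hG.smooth hG.wronskian_eq_one
      (fun j hj x => envCovector_zero_dotProduct k G x hj)
      (fun x => envCovector_zero_dotProduct_top k (hG.wronskian_eq_one x)), smul_smul,
      inv_mul_cancel₀ hc, one_smul]
  have hXM : ∀ ε x, X ε (x + 2 * Real.pi) = M.1 *ᵥ X ε x := by
    intro ε x
    simp only [X]
    simp only [iteratedDeriv_add_right_mulVec (hH.contDiff_right ε) (envCovector_add k hG ε)]
    rw [crossProd_contragredient, Matrix.mulVec_smul]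
  let W : ℝ → ℝ → ℝ := fun ε x => wronskian (X ε) x
  have hW : JointlySmooth W := jointlySmooth_wronskian hX
  have hWper : ∀ ε, Function.Periodic (W ε) (2 * Real.pi) := fun ε =>
    wronskian_periodic M (hX.contDiff_right ε) (hXM ε)
  have hW0 : ∀ x, W 0 x = 1 := fun x => by simp only [W, hX0, hG.wronskian_eq_one]
  obtain ⟨ρ, hρ, hρ1, hρW⟩ := exists_smooth_root d
  have hρs : JointlySmooth fun ε x => ρ (W ε x) := ContDiff.comp hρ hW
  have hΛ : JointlySmooth fun ε x => ρ (W ε x) • X ε x := ContDiff.smul hρs hX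
  refine ⟨fun ε x => ρ (W ε x) • X ε x, hΛ, ?_, ?_⟩
  · ext1 x
    simp [hW0, hρ1, hX0]
  filter_upwards [eventually_forall_abs_sub_one_lt hW hW0 hWper] with ε hε
  have horth : ∀ (i : Fin d) x, iteratedDeriv (i : ℕ) (H ε) x ⬝ᵥ X ε x = 0 := fun i x => by
    simp only [X]
    rw [dotProduct_smul,
      dotProduct_crossProd_self (fun i : Fin d => iteratedDeriv (i : ℕ) (H ε) x) i, smul_zero]
  refine ⟨⟨hΛ.contDiff_right ε, fun x => ?_, fun x => ?_⟩, fun j hj x => ?_, fun x h => ?_⟩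
  · rw [wronskian_smul (hρs.contDiff_right ε) (hX.contDiff_right ε)]
    exact hρW _ (hε x)
  · simp only [hWper ε x, hXM, Matrix.mulVec_smul]
  -- `Λ` is orthogonal to the derivatives of `H` by construction; moving derivatives across the
  -- pairing makes `H` orthogonal to those of `Λ`.
  · rw [dotProduct_comm]
    have := dotProduct_iteratedDeriv_eq_zero (hΛ.contDiff_right ε) (hH.contDiff_right ε)
      (fun i hi x => by
        rw [smul_dotProduct, dotProduct_comm, horth ⟨i, hi⟩ x, smul_zero]) j 0 (by omega) x
    simpa using this
  -- A zero cross product would make the Wronskian zero, contradicting that it is within `1/2` of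
  -- one.
  · have hX : X ε x = 0 := by simp only [X, H, h, smul_zero]
    have hz : W ε x = 0 := by
      simp only [W, wronskian_eq_det_frame]
      exact Matrix.det_eq_zero_of_row_eq_zero 0 fun j => by simp [frame_apply, hX]
    have := hε x
    rw [hz] at this
    norm_num at this

/-- Up to the sign, there is only one normalized lift of an envelope. -/
theorem eq_or_eq_neg_of_envelope {H Λ L : ℝ → Fin (d + 1) → ℝ} (hH : ContDiff ℝ ∞ H)
    (hΛ : ContDiff ℝ ∞ Λ) (hL : ContDiff ℝ ∞ L) (hWΛ : ∀ x, wronskian Λ x = 1)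
    (hWL : ∀ x, wronskian L x = 1) (hHΛ : ∀ j < d, ∀ x, H x ⬝ᵥ iteratedDeriv j Λ x = 0)
    (hHL : ∀ j < d, ∀ x, H x ⬝ᵥ iteratedDeriv j L x = 0)
    (hX : ∀ x, crossProd (fun i : Fin d => iteratedDeriv (i : ℕ) H x) ≠ 0) :
    L = Λ ∨ L = -Λ := by
  have hΛ0 : ∀ x, Λ x ≠ 0 := fun x h => by
    have hz : wronskian Λ x = 0 := by
      rw [wronskian_eq_det_frame]
      exact Matrix.det_eq_zero_of_row_eq_zero 0 fun j => by simp [frame_apply, h]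
    exact one_ne_zero ((hWΛ x).symm.trans hz)
  let f : ℝ → ℝ := fun x => (L x ⬝ᵥ Λ x) / (Λ x ⬝ᵥ Λ x)
  have hLf : L = fun x => f x • Λ x := by
    ext1 x
    refine eq_smul_of_dotProduct_eq_zero (hX x) (hΛ0 x) (fun i => ?_) fun i => ?_
    · simpa using dotProduct_iteratedDeriv_eq_zero hH hΛ hHΛ i 0 (by simp) x
    · simpa using dotProduct_iteratedDeriv_eq_zero hH hL hHL i 0 (by simp) x
  have hdot : ∀ {y z : ℝ → Fin (d + 1) → ℝ}, ContDiff ℝ ∞ y → ContDiff ℝ ∞ z →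
      ContDiff ℝ ∞ fun x => y x ⬝ᵥ z x := fun hy hz =>
    ContDiff.sum fun i _ => (contDiff_pi.1 hy i).mul (contDiff_pi.1 hz i)
  have hf : ContDiff ℝ ∞ f := (hdot hL hΛ).div (hdot hΛ hΛ)
    fun x h => hΛ0 x (dotProduct_self_eq_zero.1 h)
  -- Equal Wronskians give `f ^ (d + 1) = 1`, so `|f| = 1`; a continuous function with values `±1`
  -- on the line is constant.
  have hf1 : ∀ x, f x ^ 2 = 1 := fun x => by
    have h1 : f x ^ (d + 1) = 1 := by
      have := wronskian_smul hf hΛ x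
      rw [← hLf, hWL, hWΛ, mul_one] at this
      exact this.symm
    have h2 : |f x| = 1 := by
      rw [← pow_eq_one_iff_of_nonneg (abs_nonneg _) (Nat.succ_ne_zero d), ← abs_pow, h1, abs_one]
    rw [← sq_abs, h2, one_pow]
  rcases isPreconnected_univ.eq_one_or_eq_neg_one_of_sq_eq hf.continuous.continuousOn
    (fun x _ => by simpa using hf1 x) with h | h
  · left
    rw [hLf]
    ext1 x
    simp [h (mem_univ x)]
  · right
    rw [hLf]
    ext1 x
    simp [h (mem_univ x)]

end Envelope

/-! ### Second order expansions -/

section Expansion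

variable {E : Type} [NormedAddCommGroup E] [NormedSpace ℝ E]

/-- `f ε = a₀ + ε a₁ + ε² a₂ + ε³ r ε` with a continuous function `r`. -/
def HasExpansion (f : ℝ → E) (a₀ a₁ a₂ : E) : Prop :=
  ∃ r : ℝ → E, Continuous r ∧ ∀ ε, f ε = a₀ + ε • a₁ + ε ^ 2 • a₂ + ε ^ 3 • r ε

theorem HasExpansion.add {f g : ℝ → E} {a₀ a₁ a₂ b₀ b₁ b₂ : E} (hf : HasExpansion f a₀ a₁ a₂)
    (hg : HasExpansion g b₀ b₁ b₂) :
    HasExpansion (fun ε => f ε + g ε) (a₀ + b₀) (a₁ + b₁) (a₂ + b₂) := by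
  obtain ⟨r, hr, h⟩ := hf
  obtain ⟨s, hs, h'⟩ := hg
  refine ⟨fun ε => r ε + s ε, hr.add hs, fun ε => ?_⟩
  beta_reduce
  rw [h, h']
  module

theorem HasExpansion.const (a : E) : HasExpansion (fun _ => a) a 0 0 :=
  ⟨fun _ => 0, continuous_const, fun ε => by simp⟩

theorem HasExpansion.sum {ι : Type} {s : Finset ι} {f : ι → ℝ → E} {a₀ a₁ a₂ : ι → E}
    (hf : ∀ i ∈ s, HasExpansion (f i) (a₀ i) (a₁ i) (a₂ i)) :
    HasExpansion (fun ε => ∑ i ∈ s, f i ε) (∑ i ∈ s, a₀ i) (∑ i ∈ s, a₁ i) (∑ i ∈ s, a₂ i) := by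
  classical
  induction s using Finset.induction_on with
  | empty => simpa using HasExpansion.const (0 : E)
  | insert i s hi ih =>
    simp only [Finset.sum_insert hi]
    exact (hf i (by simp)).add (ih fun j hj => hf j (by simp [hj]))

theorem HasExpansion.smul {f : ℝ → ℝ} {g : ℝ → E} {a₀ a₁ a₂ : ℝ} {b₀ b₁ b₂ : E}
    (hf : HasExpansion f a₀ a₁ a₂) (hg : HasExpansion g b₀ b₁ b₂) :
    HasExpansion (fun ε => f ε • g ε) (a₀ • b₀) (a₀ • b₁ + a₁ • b₀)
      (a₀ • b₂ + a₁ • b₁ + a₂ • b₀) := by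
  obtain ⟨r, hr, h⟩ := hf
  obtain ⟨s, hs, h'⟩ := hg
  refine ⟨fun ε => a₁ • b₂ + a₂ • b₁ + ε • a₂ • b₂ + (a₀ + ε * a₁ + ε ^ 2 * a₂) • s ε +
    r ε • (b₀ + ε • b₁ + ε ^ 2 • b₂ + ε ^ 3 • s ε), by fun_prop, fun ε => ?_⟩
  beta_reduce
  rw [h, h']
  simp only [smul_eq_mul]
  module

theorem HasExpansion.apply {n : ℕ} {f : ℝ → Fin n → ℝ} {a₀ a₁ a₂ : Fin n → ℝ}
    (hf : HasExpansion f a₀ a₁ a₂) (i : Fin n) :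
    HasExpansion (fun ε => f ε i) (a₀ i) (a₁ i) (a₂ i) := by
  obtain ⟨r, hr, h⟩ := hf
  exact ⟨fun ε => r ε i, (continuous_apply i).comp hr, fun ε => by beta_reduce; rw [h]; rfl⟩

theorem HasExpansion.dotProduct {n : ℕ} {f g : ℝ → Fin n → ℝ} {a₀ a₁ a₂ b₀ b₁ b₂ : Fin n → ℝ}
    (hf : HasExpansion f a₀ a₁ a₂) (hg : HasExpansion g b₀ b₁ b₂) :
    HasExpansion (fun ε => f ε ⬝ᵥ g ε) (a₀ ⬝ᵥ b₀) (a₀ ⬝ᵥ b₁ + a₁ ⬝ᵥ b₀)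
      (a₀ ⬝ᵥ b₂ + a₁ ⬝ᵥ b₁ + a₂ ⬝ᵥ b₀) := by
  have := HasExpansion.sum (s := Finset.univ) fun i _ => (hf.apply i).smul (hg.apply i)
  simp only [Finset.sum_add_distrib, smul_eq_mul] at this
  exact this

theorem eq_zero_of_eventually_smul_eq_zero {r : ℝ → E} (hr : Continuous r) {a : E}
    (h : ∀ᶠ ε in 𝓝[>] (0 : ℝ), a + ε • r ε = 0) : a = 0 := by
  have h1 : Tendsto (fun ε : ℝ => a + ε • r ε) (𝓝[>] 0) (𝓝 (a + (0 : ℝ) • r 0)) :=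
    ((continuous_const.add (continuous_id.smul hr)).tendsto 0).mono_left nhdsWithin_le_nhds
  rw [zero_smul, add_zero] at h1
  exact tendsto_nhds_unique h1 (tendsto_const_nhds.congr' (h.mono fun ε hε => hε.symm))

/-- The coefficients are peeled off by dividing by powers of `ε`. Positive `ε` suffice because the
remainder is continuous at `0`. -/
theorem HasExpansion.eq_zero {f : ℝ → E} {a₀ a₁ a₂ : E} (hf : HasExpansion f a₀ a₁ a₂)
    (h0 : ∀ᶠ ε in 𝓝[>] (0 : ℝ), f ε = 0) : a₀ = 0 ∧ a₁ = 0 ∧ a₂ = 0 := by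
  obtain ⟨r, hr, h⟩ := hf
  have e0 : a₀ = 0 := eq_zero_of_eventually_smul_eq_zero (r := fun ε => a₁ + ε • a₂ + ε ^ 2 • r ε)
    (by fun_prop) (h0.mono fun ε hε => by rw [← hε, h]; module)
  have e1 : a₁ = 0 := eq_zero_of_eventually_smul_eq_zero (r := fun ε => a₂ + ε • r ε)
    (by fun_prop) (by
      filter_upwards [h0, self_mem_nhdsWithin] with ε hε hpos
      refine smul_right_injective E (ne_of_gt (mem_Ioi.1 hpos)) ?_
      simp only [smul_zero]
      rw [← hε, h, e0]
      module)
  have e2 : a₂ = 0 := eq_zero_of_eventually_smul_eq_zero (r := r) hr (by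
      filter_upwards [h0, self_mem_nhdsWithin] with ε hε hpos
      refine smul_right_injective E (pow_ne_zero 2 (ne_of_gt (mem_Ioi.1 hpos))) ?_
      simp only [smul_zero]
      rw [← hε, h, e0, e1]
      module)
  exact ⟨e0, e1, e2⟩

theorem HasExpansion.unique {f : ℝ → E} {a₀ a₁ a₂ b₀ b₁ b₂ : E} (hf : HasExpansion f a₀ a₁ a₂)
    (hg : HasExpansion f b₀ b₁ b₂) : a₀ = b₀ ∧ a₁ = b₁ ∧ a₂ = b₂ := by
  have h := hf.add ((HasExpansion.const (-1 : ℝ)).smul hg)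
  have := h.eq_zero (Eventually.of_forall fun ε => by simp)
  simpa [← sub_eq_add_neg, sub_eq_zero] using this

/-- Hadamard's lemma three times. A jointly smooth remainder allows differentiating the expansion in
`x` and bounding it on compact sets. -/
theorem JointlySmooth.exists_expansion [CompleteSpace E] {F : ℝ → ℝ → E} (hF : JointlySmooth F) :
    ∃ (A₁ A₂ : ℝ → E) (R : ℝ → ℝ → E), ContDiff ℝ ∞ A₁ ∧ ContDiff ℝ ∞ A₂ ∧ JointlySmooth R ∧
      ∀ ε x, F ε x = F 0 x + ε • A₁ x + ε ^ 2 • A₂ x + ε ^ 3 • R ε x := by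
  obtain ⟨R₁, hR₁, h₁⟩ := hF.exists_eq_add_smul
  obtain ⟨R₂, hR₂, h₂⟩ := hR₁.exists_eq_add_smul
  obtain ⟨R₃, hR₃, h₃⟩ := hR₂.exists_eq_add_smul
  refine ⟨R₁ 0, R₂ 0, R₃, hR₁.contDiff_right 0, hR₂.contDiff_right 0, hR₃, fun ε x => ?_⟩
  rw [h₁, h₂, h₃]
  module

theorem HasExpansion.of_contDiff [CompleteSpace E] {f : ℝ → E} (hf : ContDiff ℝ ∞ f) :
    ∃ a₁ a₂, HasExpansion f (f 0) a₁ a₂ := by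
  obtain ⟨A₁, A₂, R, -, -, hR, h⟩ :=
    JointlySmooth.exists_expansion (F := fun ε _ => f ε) (hf.comp contDiff_fst)
  exact ⟨A₁ 0, A₂ 0, fun ε => R ε 0, (hR.contDiff_left 0).continuous, fun ε => h ε 0⟩

theorem HasExpansion.sq_smul [CompleteSpace E] {s : ℝ → E} (hs : ContDiff ℝ ∞ s) :
    HasExpansion (fun ε => ε ^ 2 • s ε) 0 0 (s 0) := by
  obtain ⟨R, hR, h⟩ :=
    JointlySmooth.exists_eq_add_smul (F := fun ε _ => s ε) (hs.comp contDiff_fst)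
  refine ⟨fun ε => R ε 0, (hR.contDiff_left 0).continuous, fun ε => ?_⟩
  beta_reduce
  rw [h ε 0]
  module

theorem iteratedDeriv_expansion {F R : ℝ → ℝ → E} {A₀ A₁ A₂ : ℝ → E} (h₀ : ContDiff ℝ ∞ A₀)
    (h₁ : ContDiff ℝ ∞ A₁) (h₂ : ContDiff ℝ ∞ A₂) (hR : JointlySmooth R)
    (h : ∀ ε x, F ε x = A₀ x + ε • A₁ x + ε ^ 2 • A₂ x + ε ^ 3 • R ε x) (j : ℕ) (ε x : ℝ) :
    iteratedDeriv j (F ε) x = iteratedDeriv j A₀ x + ε • iteratedDeriv j A₁ x +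
      ε ^ 2 • iteratedDeriv j A₂ x + ε ^ 3 • iteratedDeriv j (R ε) x := by
  have hj : ∀ {y : ℝ → E}, ContDiff ℝ ∞ y → ContDiffAt ℝ j y x := fun hy =>
    (hy.of_le (by exact_mod_cast le_top)).contDiffAt
  have hs : ∀ {y : ℝ → E} (c : ℝ), ContDiff ℝ ∞ y → ContDiff ℝ ∞ (c • y) := fun c hy =>
    hy.const_smul c
  have hF : F ε = A₀ + ε • A₁ + ε ^ 2 • A₂ + ε ^ 3 • R ε := funext (h ε)
  have hRε := hR.contDiff_right ε
  have hadd : ∀ {y z : ℝ → E}, ContDiff ℝ ∞ y → ContDiff ℝ ∞ z →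
      iteratedDeriv j (y + z) x = iteratedDeriv j y x + iteratedDeriv j z x := fun hy hz =>
    iteratedDeriv_add (hj hy) (hj hz)
  have ha : ∀ {y z : ℝ → E}, ContDiff ℝ ∞ y → ContDiff ℝ ∞ z → ContDiff ℝ ∞ (y + z) :=
    fun hy hz => hy.add hz
  rw [hF, hadd (ha (ha h₀ (hs ε h₁)) (hs _ h₂)) (hs _ hRε), hadd (ha h₀ (hs ε h₁)) (hs _ h₂),
    hadd h₀ (hs ε h₁), iteratedDeriv_const_smul (hj h₁),
    iteratedDeriv_const_smul (hj h₂), iteratedDeriv_const_smul (hj hRε)]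

theorem hasExpansion_iteratedDeriv {F R : ℝ → ℝ → E} {A₀ A₁ A₂ : ℝ → E} (h₀ : ContDiff ℝ ∞ A₀)
    (h₁ : ContDiff ℝ ∞ A₁) (h₂ : ContDiff ℝ ∞ A₂) (hR : JointlySmooth R)
    (h : ∀ ε x, F ε x = A₀ x + ε • A₁ x + ε ^ 2 • A₂ x + ε ^ 3 • R ε x) (j : ℕ) (x : ℝ) :
    HasExpansion (fun ε => iteratedDeriv j (F ε) x) (iteratedDeriv j A₀ x) (iteratedDeriv j A₁ x)
      (iteratedDeriv j A₂ x) :=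
  ⟨fun ε => iteratedDeriv j (R ε) x, ((hR.iteratedDeriv j).contDiff_left x).continuous,
    fun ε => iteratedDeriv_expansion h₀ h₁ h₂ hR h j ε x⟩

end Expansion

/-! ### Interpolation coefficients -/

section Vandermonde

open Polynomial

/-- Newton's identity `2 e₂ = p₁² - p₂`, proved by adjoining one root at a time. -/
theorem two_mul_coeff_prod_X_sub_C {ι : Type} [DecidableEq ι] (k : ι → ℝ) (s : Finset ι) :
    ∀ n, s.card = n + 2 →
      2 * (∏ i ∈ s, (X - C (k i))).coeff n = (∑ i ∈ s, k i) ^ 2 - ∑ i ∈ s, k i ^ 2 := by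
  induction s using Finset.induction_on with
  | empty => simp
  | insert a s ha ih =>
    intro n hn
    rw [Finset.card_insert_of_notMem ha] at hn
    have h1 : (∏ i ∈ s, (X - C (k i))).coeff n = -∑ i ∈ s, k i := by
      rw [← prod_X_sub_C_coeff_card_pred s k (by omega)]
      congr 1
      omega
    rw [Finset.prod_insert ha, Finset.sum_insert ha, Finset.sum_insert ha, sub_mul, coeff_sub,
      coeff_C_mul, h1]
    cases n with
    | zero =>
      obtain ⟨b, rfl⟩ := Finset.card_eq_one.1 (by omega : s.card = 1)
      simp
      ring
    | succ n =>
      rw [coeff_X_mul]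
      linear_combination ih n (by omega)

variable {d : ℕ}

/-- The monic polynomial with roots `k_l` expresses `k_l ^ d` through lower powers, so its negated
coefficients solve the Vandermonde system with right side `k_l ^ d`. -/
theorem sum_vandermonde_inv_mul_pow {k : Fin d → ℝ} (hk : Function.Injective k) (j : Fin d) :
    ∑ l, (Matrix.vandermonde k)⁻¹ j l * k l ^ d = -(∏ l, (X - C (k l))).coeff j := by
  have hB : IsUnit (Matrix.vandermonde k).det :=
    (Matrix.det_vandermonde_ne_zero_iff.2 hk).isUnit
  let q : ℝ[X] := ∏ l, (X - C (k l))
  have hq : q.Monic := monic_prod_of_monic _ _ fun l _ => monic_X_sub_C _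
  have hdeg : q.natDegree = d := by
    simp [q, natDegree_prod_of_monic _ _ fun l _ => monic_X_sub_C (k l)]
  have h1 : (Matrix.vandermonde k) *ᵥ (fun j : Fin d => -q.coeff j) = fun l => k l ^ d := by
    ext l
    have h2 : q.eval (k l) = 0 := by
      rw [eval_prod]
      exact Finset.prod_eq_zero (Finset.mem_univ l) (by simp)
    rw [eval_eq_sum_range, hdeg, Finset.sum_range_succ, ← hdeg, hq.coeff_natDegree, hdeg, one_mul,
      ← Fin.sum_univ_eq_sum_range (fun i => q.coeff i * k l ^ i)] at h2
    simp only [Matrix.mulVec, dotProduct, Matrix.vandermonde_apply, mul_neg, Finset.sum_neg_distrib]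
    rw [neg_eq_iff_add_eq_zero, ← h2]
    congr 1
    exact Finset.sum_congr rfl fun i _ => mul_comm _ _
  have h3 : (fun j : Fin d => -q.coeff j) = (Matrix.vandermonde k)⁻¹ *ᵥ fun l => k l ^ d := by
    rw [← h1, Matrix.mulVec_mulVec, Matrix.nonsing_inv_mul _ hB, Matrix.one_mulVec]
  exact (congrFun h3 j).symm

/-- The relevant coefficient is minus the sum of the roots. This is the purpose of centring the
offsets. -/
theorem sum_vandermonde_inv_eq_zero {k : Fin d → ℝ} (hk : Function.Injective k)
    (hsum : ∑ l, k l = 0) {j : Fin d} (hj : (j : ℕ) + 1 = d) :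
    ∑ l, (Matrix.vandermonde k)⁻¹ j l * k l ^ d = 0 := by
  have := prod_X_sub_C_coeff_card_pred Finset.univ k (by simp; omega)
  rw [hsum, Finset.card_univ, Fintype.card_fin, show d - 1 = j by omega] at this
  rw [sum_vandermonde_inv_mul_pow hk, this, neg_zero, neg_zero]

theorem sum_vandermonde_inv_eq_half {k : Fin d → ℝ} (hk : Function.Injective k)
    (hsum : ∑ l, k l = 0) {j : Fin d} (hj : (j : ℕ) + 2 = d) :
    ∑ l, (Matrix.vandermonde k)⁻¹ j l * k l ^ d = (∑ l, k l ^ 2) / 2 := by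
  have := two_mul_coeff_prod_X_sub_C k Finset.univ j (by simp [hj])
  rw [hsum] at this
  rw [sum_vandermonde_inv_mul_pow hk]
  linarith

end Vandermonde

/-! ### The expansion of the envelopes -/

section EnvelopeExpansion

variable {d : ℕ}

/-- The constant of the continuous limit for the offsets `k_l ε`. -/
noncomputable def limitConst (k : Fin d → ℝ) : ℝ :=
  -- For `d = 1` the field `G'' + u₀ G` is zero, so any nonzero constant serves.
  if 2 ≤ d then (∑ l, k l ^ 2) / 2 * (d - 2).factorial / d.factorial else 1

theorem limitConst_ne_zero {k : Fin d → ℝ} (hk : Function.Injective k) : limitConst k ≠ 0 := by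
  unfold limitConst
  split_ifs with h
  · have h2 : ∑ l, k l ^ 2 ≠ 0 := by
      intro h0
      rw [Finset.sum_eq_zero_iff_of_nonneg fun _ _ => sq_nonneg _] at h0
      have h3 : ∀ l, k l = 0 := fun l => pow_eq_zero_iff two_ne_zero |>.1 (h0 l (Finset.mem_univ l))
      have := hk ((h3 ⟨0, by omega⟩).trans (h3 ⟨1, by omega⟩).symm)
      simp at this
    positivity
  · exact one_ne_zero

/-- The operator has no `∂^d` term, so `G^{(d+1)}` lies in the span of `G, …, G^{(d-1)}`, which the
limit covector annihilates. -/
theorem envCovector_zero_dotProduct_succ (k : Fin d → ℝ) {G : ℝ → Fin (d + 1) → ℝ}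
    {u : Fin d → ℝ → ℝ} (hu : HasCoeffs G u) (x : ℝ) :
    envCovector k G 0 x ⬝ᵥ iteratedDeriv (d + 1) G x = 0 := by
  rw [eq_neg_of_add_eq_zero_left (hu x), dotProduct_neg, dotProduct_sum, neg_eq_zero]
  refine Finset.sum_eq_zero fun j _ => ?_
  rw [dotProduct_smul, envCovector_zero_dotProduct k G x j.2, smul_zero]

/-- The covector annihilates `envBasis`, so its pairing with `G^{(j)}` equals minus that with the
correction term, of order `ε ^ (d - j)`. This contributes at order two for `j = d - 2`. For `j = d -
1` the first order vanishes by centring, and the second since the remainder then starts with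
`G^{(d+1)}`. -/
theorem hasExpansion_envCovector (hd : 1 ≤ d) {k : Fin d → ℝ} (hk : Function.Injective k)
    (hsum : ∑ l, k l = 0) {G : ℝ → Fin (d + 1) → ℝ} (hG : ContDiff ℝ ∞ G) {u : Fin d → ℝ → ℝ}
    (hu : HasCoeffs G u) (x : ℝ) (hW : wronskian G x = 1) {j : ℕ} (hj : j < d) :
    HasExpansion (fun ε => envCovector k G ε x ⬝ᵥ iteratedDeriv j G x) 0 0
      (if j + 2 = d then -limitConst k else 0) := by
  let B := (Matrix.vandermonde k)⁻¹
  let T : ℕ → ℝ → Fin (d + 1) → ℝ := fun n ε =>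
    ∑ l, (B ⟨j, hj⟩ l * k l ^ (n + 1)) • taylorRemainder n G (k l * ε) x
  let H : ℝ → Fin (d + 1) → ℝ := fun ε => envCovector k G ε x
  have hT : ∀ n, ContDiff ℝ ∞ (T n) := fun n => ContDiff.sum fun l _ => ContDiff.const_smul _
    (((jointlySmooth_taylorRemainder hG n).contDiff_left x).comp (contDiff_const.mul contDiff_id))
  have hH : ContDiff ℝ ∞ H := (jointlySmooth_envCovector k hG).contDiff_left x
  have hdot : ∀ {y z : ℝ → Fin (d + 1) → ℝ}, ContDiff ℝ ∞ y → ContDiff ℝ ∞ z →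
      ContDiff ℝ ∞ fun ε => y ε ⬝ᵥ z ε := fun hy hz =>
    ContDiff.sum fun i _ => (contDiff_pi.1 hy i).mul (contDiff_pi.1 hz i)
  have hT0 : ∀ n, T n 0 = ((∑ l, B ⟨j, hj⟩ l * k l ^ (n + 1)) / ((n + 1).factorial : ℝ)) •
      iteratedDeriv (n + 1) G x := fun n => by
    simp only [T, mul_zero]
    rw [← Finset.sum_smul, taylorRemainder_succ hG n, zero_smul, add_zero, smul_smul]
    congr 1
    ring
  have hTsucc : ∀ n ε, T n ε = ((∑ l, B ⟨j, hj⟩ l * k l ^ (n + 1)) / ((n + 1).factorial : ℝ)) •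
      iteratedDeriv (n + 1) G x + ε • T (n + 1) ε := fun n ε => by
    simp only [T]
    rw [Finset.sum_div, Finset.sum_smul, Finset.smul_sum, ← Finset.sum_add_distrib]
    refine Finset.sum_congr rfl fun l _ => ?_
    rw [taylorRemainder_succ hG n]
    module
  have hη : ∀ ε, H ε ⬝ᵥ iteratedDeriv j G x =
      -(j.factorial * ε ^ (d - j) * (H ε ⬝ᵥ T (d - 1) ε)) := fun ε => by
    have h := dotProduct_crossProd_self (fun j => envBasis k G j ε x) ⟨j, hj⟩
    rw [dotProduct_comm, envBasis, dotProduct_add, dotProduct_smul, smul_eq_mul] at h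
    have h2 : T (d - 1) ε = ∑ l, ((Matrix.vandermonde k)⁻¹ ⟨j, hj⟩ l * k l ^ d) •
        taylorRemainder (d - 1) G (k l * ε) x := by
      simp only [T, B, Nat.sub_add_cancel hd]
    rw [h2]
    exact eq_neg_of_add_eq_zero_left h
  change HasExpansion (fun ε => H ε ⬝ᵥ iteratedDeriv j G x) _ _ _
  by_cases hj2 : j + 2 ≤ d
  · have hs : ContDiff ℝ ∞ fun ε => -(j.factorial * ε ^ (d - j - 2) * (H ε ⬝ᵥ T (d - 1) ε)) :=
      ((contDiff_const.mul (contDiff_id.pow _)).mul (hdot hH (hT _))).neg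
    convert! HasExpansion.sq_smul hs using 1
    · ext1 ε
      rw [hη, smul_eq_mul, show d - j = 2 + (d - j - 2) by omega, pow_add]
      simp only [Nat.add_sub_cancel_left]
      ring
    · split_ifs with h
      · have h0 : d - j - 2 = 0 := by omega
        rw [h0, hT0, dotProduct_smul, Nat.sub_add_cancel hd, envCovector_zero_dotProduct_top k hW,
          sum_vandermonde_inv_eq_half hk hsum (j := ⟨j, hj⟩) h, limitConst, if_pos (by omega),
          show d - 2 = j by omega]
        simp only [smul_eq_mul]
        ring
      · rw [zero_pow (by omega)]
        simp
  · have hj1 : j + 1 = d := by omega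
    have hs : ContDiff ℝ ∞ fun ε => -(j.factorial * (H ε ⬝ᵥ T d ε)) :=
      (contDiff_const.mul (hdot hH (hT _))).neg
    convert! HasExpansion.sq_smul hs using 1
    · ext1 ε
      -- Centring removes the `G^{(d)}` term, which gains one power of `ε`.
      have h3 : T (d - 1) ε = ε • T d ε := by
        rw [hTsucc, Nat.sub_add_cancel hd, sum_vandermonde_inv_eq_zero hk hsum (j := ⟨j, hj⟩) hj1]
        simp
      rw [hη, h3, show d - j = 1 by omega, dotProduct_smul, smul_eq_mul, smul_eq_mul]
      ring
    · rw [if_neg (by omega), hT0, dotProduct_smul, envCovector_zero_dotProduct_succ k hu]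
      simp

/-- A vector field annihilated by the dual curve, with its first derivatives, is tangent to the
curve of lines. -/
theorem exists_eq_smul_of_envCovector (k : Fin d → ℝ) {G y : ℝ → Fin (d + 1) → ℝ}
    (hG : ContDiff ℝ ∞ G) (hW : ∀ x, wronskian G x = 1) (hy : ContDiff ℝ ∞ y)
    (h : ∀ j < d, ∀ x, envCovector k G 0 x ⬝ᵥ iteratedDeriv j y x = 0) :
    ∃ f : ℝ → ℝ, ContDiff ℝ ∞ f ∧ y = fun x => f x • G x := by
  obtain ⟨c, hc, hdual⟩ := exists_crossProd_dual_eq_smul d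
  have hH := (jointlySmooth_envCovector k hG).contDiff_right 0
  have h0 : ∀ j < d, ∀ x, envCovector k G 0 x ⬝ᵥ iteratedDeriv j G x = 0 := fun j hj x =>
    envCovector_zero_dotProduct k G x hj
  have hG0 : ∀ x, G x ≠ 0 := fun x h => by
    have hz : wronskian G x = 0 := by
      rw [wronskian_eq_det_frame]
      exact Matrix.det_eq_zero_of_row_eq_zero 0 fun j => by simp [frame_apply, h]
    exact one_ne_zero ((hW x).symm.trans hz)
  have hX := hdual (envCovector k G 0) G hH hG hW h0
    fun x => envCovector_zero_dotProduct_top k (hW x)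
  have hdot : ∀ {y z : ℝ → Fin (d + 1) → ℝ}, ContDiff ℝ ∞ y → ContDiff ℝ ∞ z →
      ContDiff ℝ ∞ fun x => y x ⬝ᵥ z x := fun hy hz =>
    ContDiff.sum fun i _ => (contDiff_pi.1 hy i).mul (contDiff_pi.1 hz i)
  refine ⟨fun x => (y x ⬝ᵥ G x) / (G x ⬝ᵥ G x), (hdot hy hG).div (hdot hG hG)
    fun x h => hG0 x (dotProduct_self_eq_zero.1 h), ?_⟩
  ext1 x
  refine eq_smul_of_dotProduct_eq_zero (v := fun i : Fin d => iteratedDeriv (i : ℕ) _ x)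
    (by rw [hX]; exact smul_ne_zero hc (hG0 x)) (hG0 x) (fun i => ?_) fun i => ?_
  · simpa using dotProduct_iteratedDeriv_eq_zero hH hG h0 i 0 (by simp) x
  · simpa using dotProduct_iteratedDeriv_eq_zero hH hy h i 0 (by simp) x

end EnvelopeExpansion

theorem sub_one_lt_self {d : ℕ} (hd : 1 ≤ d) : d - 1 < d := by omega

/-! ### Second-order terms of the envelopes and of their operators -/

section SecondOrder

variable {d : ℕ}

/-- The coordinates of `G^{(i+2)}` in the moving frame, with the diagonal one made explicit. -/
theorem exists_coords_iteratedDeriv_add_two (hd : 1 ≤ d) {G : ℝ → Fin (d + 1) → ℝ}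
    (hG : ContDiff ℝ ∞ G) {u : Fin d → ℝ → ℝ} (hu : HasCoeffs G u)
    (hus : ∀ j, ContDiff ℝ ∞ (u j)) (x : ℝ) (i : Fin (d + 1)) :
    ∃ p : Fin (d + 1) → ℝ, ∑ m, p m • iteratedDeriv (m : ℕ) G x = iteratedDeriv (i + 2) G x ∧
      p i = if d ≤ (i : ℕ) + 1 then -u ⟨d - 1, sub_one_lt_self hd⟩ x else 0 := by
  have htop : ∀ x, iteratedDeriv (d + 1) G x = ∑ j : Fin d, (-u j x) • iteratedDeriv (j : ℕ) G x :=
    fun x => by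
      rw [eq_neg_of_add_eq_zero_left (hu x)]
      simp
  by_cases h1 : (i : ℕ) + 2 ≤ d
  · refine ⟨Pi.single ⟨i + 2, by omega⟩ 1, ?_, ?_⟩
    · simp [Pi.single_apply]
    · rw [if_neg (by omega), Pi.single_apply, if_neg]
      exact fun h => by simpa using congrArg Fin.val h
  by_cases h2 : (i : ℕ) + 1 = d
  · refine ⟨Fin.snoc (α := fun _ => ℝ) (fun j => -u j x) 0, ?_, ?_⟩
    · rw [Fin.sum_univ_castSucc, show (i : ℕ) + 2 = d + 1 by omega, htop]
      simp
    · have hi : i = Fin.castSucc ⟨d - 1, sub_one_lt_self hd⟩ := Fin.ext (by simp; omega)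
      rw [if_pos (by omega)]
      conv_lhs => rw [hi]
      rw [Fin.snoc_castSucc (α := fun _ => ℝ)]
  · have hi : (i : ℕ) = d := by omega
    -- For `i = d` the relation for `G^{(d+1)}` is differentiated once; only the summand `-u_{d-1}
    -- G^{(d)}` contributes to the diagonal coordinate.
    refine ⟨fun m => Fin.snoc (α := fun _ => ℝ) (fun j => -deriv (u j) x) 0 m +
      Fin.cons (α := fun _ => ℝ) 0 (fun j => -u j x) m, ?_, ?_⟩
    · simp only [add_smul, Finset.sum_add_distrib]
      rw [Fin.sum_univ_castSucc, Fin.sum_univ_succ]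
      simp only [Fin.snoc_castSucc, Fin.snoc_last, Fin.cons_succ, Fin.cons_zero, zero_smul,
        zero_add, add_zero, Fin.val_succ, Fin.val_castSucc]
      have h := HasDerivAt.fun_sum (u := Finset.univ) fun (j : Fin d) _ =>
        (((hus j).differentiable (by simp) x).hasDerivAt.neg).smul (hasDerivAt_iteratedDeriv hG j x)
      have h' := hasDerivAt_iteratedDeriv hG (d + 1) x
      rw [funext htop] at h'
      rw [hi, h'.unique h, Finset.sum_add_distrib]
      exact add_comm (G := Fin (d + 1) → ℝ) _ _
    · have hi' : i = Fin.last d := Fin.ext hi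
      have hl : Fin.last d = Fin.succ ⟨d - 1, sub_one_lt_self hd⟩ := Fin.ext (by simp; omega)
      rw [if_pos (by omega), hi']
      beta_reduce
      rw [Fin.snoc_last (α := fun _ => ℝ), zero_add, hl, Fin.cons_succ (α := fun _ => ℝ)]

/-- Only the indices `d - 1` and `d` contribute, so `∂²` has trace `-2 u_{d-1}` in the moving frame.
This is the source of the numerator in `2/(d+1)`. -/
theorem sum_ite_le_add_one (hd : 1 ≤ d) (a : ℝ) :
    ∑ i : Fin (d + 1), (if d ≤ (i : ℕ) + 1 then a else 0) = 2 * a := by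
  obtain ⟨n, rfl⟩ : ∃ n, d = n + 1 := ⟨d - 1, by omega⟩
  rw [Fin.sum_univ_castSucc, Fin.sum_univ_castSucc]
  have : ∀ i : Fin n, ¬ n ≤ (i : ℕ) := fun i => by omega
  simp [this]
  ring

/-- At each order the orthogonality relations determine the term up to a function multiple of `G`,
and the Wronskian condition, through a trace, determines that function. -/
theorem envelope_expansion (hd : 1 ≤ d) {k : Fin d → ℝ} (hk : Function.Injective k)
    (hsum : ∑ l, k l = 0) {G : ℝ → Fin (d + 1) → ℝ} (hG : ContDiff ℝ ∞ G)
    (hW : ∀ x, wronskian G x = 1) {u : Fin d → ℝ → ℝ}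
    (hu : HasCoeffs G u) (hus : ∀ j, ContDiff ℝ ∞ (u j)) {Λ : ℝ → ℝ → Fin (d + 1) → ℝ}
    (hΛ : JointlySmooth Λ) (h0 : Λ 0 = G) (hWΛ : ∀ᶠ ε in 𝓝[>] (0 : ℝ), ∀ x, wronskian (Λ ε) x = 1)
    (hH : ∀ᶠ ε in 𝓝[>] (0 : ℝ), ∀ j < d, ∀ x,
      envCovector k G ε x ⬝ᵥ iteratedDeriv j (Λ ε) x = 0) :
    ∃ R : ℝ → ℝ → Fin (d + 1) → ℝ, JointlySmooth R ∧ ∀ ε x, Λ ε x = G x +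
      ε ^ 2 • limitConst k •
        (iteratedDeriv 2 G x + (2 / ((d : ℝ) + 1) * u ⟨d - 1, sub_one_lt_self hd⟩ x) • G x) +
      ε ^ 3 • R ε x := by
  obtain ⟨A₁, A₂, R, hA₁, hA₂, hR, hexp⟩ := hΛ.exists_expansion
  rw [h0] at hexp
  have hd1 : (d : ℝ) + 1 ≠ 0 := by positivity
  have hHexp : ∀ x, ∃ a₁ a₂, HasExpansion (fun ε => envCovector k G ε x) (envCovector k G 0 x) a₁ a₂ :=
    fun x => HasExpansion.of_contDiff ((jointlySmooth_envCovector k hG).contDiff_left x)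
  choose H₁ H₂ hHx using hHexp
  have hmatch : ∀ j < d, ∀ x, H₁ x ⬝ᵥ iteratedDeriv j G x = 0 ∧
      H₂ x ⬝ᵥ iteratedDeriv j G x = if j + 2 = d then -limitConst k else 0 := by
    intro j hj x
    have h1 := (hHx x).dotProduct (HasExpansion.const (iteratedDeriv j G x))
    have h2 := h1.unique (hasExpansion_envCovector hd hk hsum hG hu x (hW x) hj)
    simpa using h2.2
  -- Orders one and two of the envelope equations. The covector's own variation enters only through
  -- its pairings with `G^{(j)}`, known from `hmatch`, and with `A₁^{(j)}`, which will vanish.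
  have hord : ∀ j < d, ∀ x, envCovector k G 0 x ⬝ᵥ iteratedDeriv j A₁ x = 0 ∧
      envCovector k G 0 x ⬝ᵥ iteratedDeriv j A₂ x + H₁ x ⬝ᵥ iteratedDeriv j A₁ x +
        (if j + 2 = d then -limitConst k else 0) = 0 := by
    intro j hj x
    have h1 := (hHx x).dotProduct (hasExpansion_iteratedDeriv hG hA₁ hA₂ hR hexp j x)
    have h2 := (h1.eq_zero (hH.mono fun ε h => h j hj x)).2
    rw [(hmatch j hj x).1, (hmatch j hj x).2, add_zero] at h2
    exact h2
  have hframe : ∀ ε x (i m : Fin (d + 1)), frame (Λ ε) x i m = frame G x i m +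
      ε * iteratedDeriv i A₁ x m + ε ^ 2 * iteratedDeriv i A₂ x m +
        ε ^ 3 * iteratedDeriv i (R ε) x m := fun ε x i m => by
    rw [frame_apply, iteratedDeriv_expansion hG hA₁ hA₂ hR hexp]
    rfl
  have hRc : ∀ x (i m : Fin (d + 1)), Continuous fun ε => iteratedDeriv i (R ε) x m := fun x i m =>
    (continuous_apply m).comp ((hR.iteratedDeriv i).contDiff_left x).continuous
  have hlim : ∀ {g : ℝ → ℝ}, Continuous g → ∀ {a : ℝ}, g 0 = a → Tendsto g (𝓝[>] 0) (𝓝 a) :=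
    fun hg _ ha => ha ▸ (hg.tendsto 0).mono_left nhdsWithin_le_nhds
  have hFdet : ∀ x, (frame G x).det = 1 := hW
  obtain ⟨f₁, hf₁, hA₁f⟩ := exists_eq_smul_of_envCovector k hG hW hA₁ fun j hj x => (hord j hj x).1
  have hA₁0 : A₁ = fun _ => 0 := by
    have hf0 : ∀ x, f₁ x = 0 := by
      intro x
      have htr := trace_eq_zero_of_det_add (l := 𝓝[>] (0 : ℝ)) (t := fun ε => ε) (hFdet x)
        (N := fun ε => Matrix.of fun i m => iteratedDeriv i A₁ x m + ε * iteratedDeriv i A₂ x m +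
          ε ^ 2 * iteratedDeriv i (R ε) x m) (P := leibnizMatrix d f₁ x)
        nhdsWithin_le_nhds (by
          filter_upwards [self_mem_nhdsWithin] with ε hε using ne_of_gt hε)
        (fun i m => by
          have := hRc x i m
          refine hlim (by simp only [Matrix.of_apply]; fun_prop) ?_
          rw [← frame_smul hf₁ hG, frame_apply, ← hA₁f]
          simp)
        (by
          filter_upwards [hWΛ] with ε hε
          rw [← hε x, wronskian_eq_det_frame]
          congr 1
          ext i m
          rw [hframe]
          simp
          ring)
      rw [leibnizMatrix_trace] at htr
      exact (mul_eq_zero.1 htr).resolve_left hd1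
    rw [hA₁f]
    ext1 x
    rw [hf0, zero_smul]
  have hA₁d : ∀ j x, iteratedDeriv j A₁ x = 0 := fun j x => by
    rw [hA₁0]
    simp
  set C := limitConst k with hC
  have hG2 : ContDiff ℝ ∞ (iteratedDeriv 2 G) := contDiff_iteratedDeriv hG 2
  have hder : ∀ j x, iteratedDeriv j (A₂ - C • iteratedDeriv 2 G) x =
      iteratedDeriv j A₂ x - C • iteratedDeriv (j + 2) G x := by
    intro j x
    have hj : ∀ {y : ℝ → Fin (d + 1) → ℝ}, ContDiff ℝ ∞ y → ContDiffAt ℝ j y x := fun hy =>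
      (hy.of_le (by exact_mod_cast le_top)).contDiffAt
    have hCG : ContDiff ℝ ∞ (C • iteratedDeriv 2 G) := hG2.const_smul C
    rw [iteratedDeriv_sub (hj hA₂) (hj hCG), iteratedDeriv_const_smul (hj hG2),
      iteratedDeriv_eq_iterate, iteratedDeriv_eq_iterate, iteratedDeriv_eq_iterate,
      iteratedDeriv_eq_iterate, Function.iterate_add_apply]
  -- The term `-C` at `j = d - 2` is cancelled by `C G''`, since `H_0 · G^{(d)} = 1`. For other `j <
  -- d` both contributions vanish.
  obtain ⟨f₂, hf₂, hA₂f⟩ := exists_eq_smul_of_envCovector k hG hW (hA₂.sub (hG2.const_smul C))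
    (fun j hj x => by
      change _ ⬝ᵥ iteratedDeriv j (A₂ - C • iteratedDeriv 2 G) x = 0
      have h1 := (hord j hj x).2
      rw [hA₁d, dotProduct_zero, add_zero] at h1
      rw [hder, dotProduct_sub, dotProduct_smul, eq_neg_of_add_eq_zero_left h1]
      split_ifs with h
      · rw [h, envCovector_zero_dotProduct_top k (hW x)]
        simp
      · by_cases h3 : j + 2 < d
        · rw [envCovector_zero_dotProduct k G x h3]
          simp
        · rw [show j + 2 = d + 1 by omega, envCovector_zero_dotProduct_succ k hu]
          simp)
  have hf₂x : ∀ x, f₂ x = C * (2 / ((d : ℝ) + 1) * u ⟨d - 1, sub_one_lt_self hd⟩ x) := by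
    intro x
    choose p hp hpd using exists_coords_iteratedDeriv_add_two hd hG hu hus x
    have htr := trace_eq_zero_of_det_add (l := 𝓝[>] (0 : ℝ)) (t := fun ε => ε ^ 2) (hFdet x)
      (N := fun ε => Matrix.of fun i m => iteratedDeriv i A₂ x m + ε * iteratedDeriv i (R ε) x m)
      (P := C • Matrix.of p + leibnizMatrix d f₂ x)
      (hlim (by fun_prop) (by simp)) (by
        filter_upwards [self_mem_nhdsWithin] with ε hε using pow_ne_zero 2 (ne_of_gt hε))
      (fun i m => by
        have := hRc x i m
        refine hlim (by simp only [Matrix.of_apply]; fun_prop) ?_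
        rw [Matrix.add_mul, Matrix.smul_mul, ← frame_smul hf₂ hG, Matrix.add_apply, frame_apply,
          ← hA₂f]
        change _ = _ + iteratedDeriv i (A₂ - C • iteratedDeriv 2 G) x m
        have hpm : (Matrix.of p * frame G x) i m = iteratedDeriv (i + 2) G x m := by
          rw [← hp, Matrix.mul_apply, Finset.sum_apply]
          rfl
        rw [hder, Matrix.smul_apply, hpm]
        simp)
      (by
        filter_upwards [hWΛ] with ε hε
        rw [← hε x, wronskian_eq_det_frame]
        congr 1
        ext i m
        rw [hframe, hA₁d]
        simp
        ring)
    -- The trace condition reads `-2 C u_{d-1} + (d + 1) f₂ = 0`.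
    rw [Matrix.trace_add, Matrix.trace_smul, leibnizMatrix_trace, Matrix.trace] at htr
    simp only [Matrix.diag_apply, Matrix.of_apply, hpd, sum_ite_le_add_one hd, smul_eq_mul] at htr
    field_simp
    linarith
  refine ⟨R, hR, fun ε x => ?_⟩
  have h2 : A₂ x = C • iteratedDeriv 2 G x + f₂ x • G x := by
    have := congrFun hA₂f x
    rw [← this]
    simp
  rw [hexp, hA₁0, h2, hf₂x]
  module

/-- The operators of the envelopes: their first order terms vanish, and the second order terms
describe the variation of the curve. -/
theorem curveCoeff_expansion {G Y : ℝ → Fin (d + 1) → ℝ} (hG : ContDiff ℝ ∞ G)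
    (hW : ∀ x, wronskian G x = 1) (hY : ContDiff ℝ ∞ Y) {u : Fin d → ℝ → ℝ} (hu : HasCoeffs G u)
    {Λ R : ℝ → ℝ → Fin (d + 1) → ℝ} (hΛ : JointlySmooth Λ) (hR : JointlySmooth R)
    (hWΛ : ∀ᶠ ε in 𝓝[>] (0 : ℝ), ∀ x, wronskian (Λ ε) x = 1)
    (hexp : ∀ ε x, Λ ε x = G x + ε ^ 2 • Y x + ε ^ 3 • R ε x) :
    ∃ (w : Fin d → ℝ → ℝ) (r : Fin d → ℝ → ℝ → ℝ), (∀ j, JointlySmooth (r j)) ∧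
      (∀ j ε x, curveCoeff (Λ ε) j.castSucc x = u j x + ε ^ 2 * w j x + ε ^ 3 * r j ε x) ∧
      ∀ x, iteratedDeriv (d + 1) Y x + ∑ j : Fin d, (u j x • iteratedDeriv (j : ℕ) Y x +
        w j x • iteratedDeriv (j : ℕ) G x) = 0 := by
  have h0 : Λ 0 = G := funext fun x => by simp [hexp]
  have hu0 : ∀ (j : Fin d), curveCoeff (Λ 0) j.castSucc = u j := fun j => by
    rw [h0]
    exact congrFun ((hasCoeffs_curveCoeff hG hW).unique hW hu) j
  choose a₁ a₂ r ha₁ ha₂ hr hc using fun j : Fin d =>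
    (jointlySmooth_curveCoeff hΛ j.castSucc).exists_expansion
  have hexp' : ∀ ε x, Λ ε x = G x + ε • (0 : Fin (d + 1) → ℝ) + ε ^ 2 • Y x + ε ^ 3 • R ε x :=
    fun ε x => by rw [hexp, smul_zero, add_zero]
  have hderiv := fun j x => hasExpansion_iteratedDeriv hG contDiff_const hY hR hexp' j x
  simp only [iteratedDeriv_const, ite_self] at hderiv
  have hcx : ∀ j x, HasExpansion (fun ε => curveCoeff (Λ ε) j.castSucc x) (u j x) (a₁ j x)
      (a₂ j x) := fun j x =>
    ⟨fun ε => r j ε x, ((hr j).contDiff_left x).continuous, fun ε => by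
      simp only [smul_eq_mul]
      have := hc j ε x
      rw [hu0] at this
      exact this⟩
  -- The equation satisfied by `Λ ε` is expanded; each of its orders vanishes separately.
  have hzero : ∀ x, _ := fun x =>
    ((hderiv (d + 1) x).add (HasExpansion.sum (s := Finset.univ) fun (j : Fin d) _ =>
      (hcx j x).smul (hderiv j x))).eq_zero (by
        filter_upwards [hWΛ] with ε hε using hasCoeffs_curveCoeff (hΛ.contDiff_right ε) hε x)
  have ha₁0 : ∀ j x, a₁ j x = 0 := fun j x => by
    have h1 := (hzero x).2.1
    simp only [smul_zero, zero_add] at h1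
    exact congrFun (eq_zero_of_sum_frame' (hW x) (c := fun j => a₁ j x) h1) j
  refine ⟨a₂, r, hr, fun j ε x => ?_, fun x => ?_⟩
  · have := hc j ε x
    rw [hu0, ha₁0] at this
    simpa using this
  · have h2 := (hzero x).2.2
    simpa [ha₁0] using h2

end SecondOrder

/-! ### The commutator of `∂² + 2/(d+1) u_{d-1}` with `L` -/

section Commutator

variable {d : ℕ}

/-- The differential operator `∂^{d+1} + ∑ u_j ∂^j`. -/
noncomputable def diffL (u : Fin d → ℝ → ℝ) (f : ℝ → ℝ) (x : ℝ) : ℝ :=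
  iteratedDeriv (d + 1) f x + ∑ j : Fin d, u j x * iteratedDeriv (j : ℕ) f x

/-- The differential operator `∂² + q`. -/
noncomputable def diffQ (q f : ℝ → ℝ) (x : ℝ) : ℝ := iteratedDeriv 2 f x + q x * f x

/-- `T` is a differential operator of order less than `n`. -/
def IsDiffOpLT (n : ℕ) (T : (ℝ → ℝ) → ℝ → ℝ) : Prop :=
  ∃ w : Fin n → ℝ → ℝ, ∀ f : ℝ → ℝ, ContDiff ℝ ∞ f → ∀ x,
    T f x = ∑ j : Fin n, w j x * iteratedDeriv (j : ℕ) f x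

theorem IsDiffOpLT.add {n : ℕ} {S T : (ℝ → ℝ) → ℝ → ℝ} (hS : IsDiffOpLT n S)
    (hT : IsDiffOpLT n T) : IsDiffOpLT n fun f x => S f x + T f x := by
  obtain ⟨v, hv⟩ := hS
  obtain ⟨w, hw⟩ := hT
  refine ⟨fun j x => v j x + w j x, fun f hf x => ?_⟩
  beta_reduce
  rw [hv f hf, hw f hf, ← Finset.sum_add_distrib]
  exact Finset.sum_congr rfl fun j _ => by ring

theorem IsDiffOpLT.zero (n : ℕ) : IsDiffOpLT n fun _ _ => 0 :=
  ⟨fun _ _ => 0, fun f _ x => by simp⟩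

theorem IsDiffOpLT.sum {n : ℕ} {ι : Type} {s : Finset ι} {T : ι → (ℝ → ℝ) → ℝ → ℝ}
    (hT : ∀ i ∈ s, IsDiffOpLT n (T i)) : IsDiffOpLT n fun f x => ∑ i ∈ s, T i f x := by
  classical
  induction s using Finset.induction_on with
  | empty => simpa using IsDiffOpLT.zero n
  | insert i s hi ih =>
    simp only [Finset.sum_insert hi]
    exact (hT i (by simp)).add (ih fun j hj => hT j (by simp [hj]))

theorem IsDiffOpLT.monomial {n j : ℕ} (hj : j < n) (a : ℝ → ℝ) :
    IsDiffOpLT n fun f x => a x * iteratedDeriv j f x :=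
  ⟨fun i x => if i = ⟨j, hj⟩ then a x else 0, fun f _ x => by simp⟩

theorem iteratedDeriv_mul_of_contDiff {f g : ℝ → ℝ} (hf : ContDiff ℝ ∞ f) (hg : ContDiff ℝ ∞ g)
    (n : ℕ) (x : ℝ) : iteratedDeriv n (fun x => f x * g x) x = f x * iteratedDeriv n g x +
      ∑ j ∈ Finset.range n,
        ((n.choose j : ℝ) * iteratedDeriv (n - j) f x) * iteratedDeriv j g x := by
  have := iteratedDeriv_smul_of_contDiff hf hg n x
  simp only [smul_eq_mul] at this
  rw [this, Finset.sum_range_succ, add_comm]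
  simp

theorem iteratedDeriv_add_of_contDiff {f g : ℝ → ℝ} (hf : ContDiff ℝ ∞ f) (hg : ContDiff ℝ ∞ g)
    (n : ℕ) (x : ℝ) : iteratedDeriv n (fun x => f x + g x) x =
      iteratedDeriv n f x + iteratedDeriv n g x :=
  iteratedDeriv_add (hf.of_le (by exact_mod_cast le_top)).contDiffAt
    (hg.of_le (by exact_mod_cast le_top)).contDiffAt

theorem iteratedDeriv_sum_of_contDiff {m : ℕ} {f : Fin m → ℝ → ℝ} (hf : ∀ j, ContDiff ℝ ∞ (f j))
    (n : ℕ) (x : ℝ) :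
    iteratedDeriv n (fun x => ∑ j, f j x) x = ∑ j, iteratedDeriv n (f j) x :=
  iteratedDeriv_fun_sum fun j _ => ((hf j).of_le (by exact_mod_cast le_top)).contDiffAt

theorem iteratedDeriv_iteratedDeriv (f : ℝ → ℝ) (m n : ℕ) (x : ℝ) :
    iteratedDeriv m (iteratedDeriv n f) x = iteratedDeriv (n + m) f x := by
  rw [iteratedDeriv_eq_iterate, iteratedDeriv_eq_iterate, iteratedDeriv_eq_iterate, add_comm,
    Function.iterate_add_apply]

/-- The terms with undifferentiated coefficients cancel. The coefficient of `∂^d` is `2 u_{d-1}' -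
(d + 1) q'`, which is zero exactly by the choice of `q`. -/
theorem isDiffOpLT_commutator (hd : 1 ≤ d) {u : Fin d → ℝ → ℝ} (hu : ∀ j, ContDiff ℝ ∞ (u j))
    {q : ℝ → ℝ} (hq : q = fun x => 2 / ((d : ℝ) + 1) * u ⟨d - 1, sub_one_lt_self hd⟩ x) :
    IsDiffOpLT d fun f x => diffQ q (diffL u f) x - diffL u (diffQ q f) x := by
  have hqs : ContDiff ℝ ∞ q := hq ▸ contDiff_const.mul (hu _)
  have hq' : ∀ x, ((d : ℝ) + 1) * iteratedDeriv 1 q x =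
      2 * iteratedDeriv 1 (u ⟨d - 1, sub_one_lt_self hd⟩) x := by
    intro x
    have hd1 : (d : ℝ) + 1 ≠ 0 := by positivity
    rw [hq, iteratedDeriv_const_mul_field]
    field_simp
  -- What survives the cancellations, written as a sum of monomials of order below `d`.
  have hrest : IsDiffOpLT d fun f x =>
      (∑ j : Fin d, iteratedDeriv 2 (u j) x * iteratedDeriv (j : ℕ) f x +
        ∑ j : Fin d, (if (j : ℕ) + 1 < d then
          (2 * iteratedDeriv 1 (u j) x) * iteratedDeriv (j + 1) f x else 0)) +
      (∑ i ∈ Finset.range d,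
        (-(((d + 1).choose i : ℝ) * iteratedDeriv (d + 1 - i) q x)) * iteratedDeriv i f x +
      ∑ j : Fin d, ∑ i ∈ Finset.range j,
        (-(u j x * (((j : ℕ).choose i : ℝ) * iteratedDeriv (j - i) q x))) *
          iteratedDeriv i f x) := by
    refine ((IsDiffOpLT.sum fun j _ => IsDiffOpLT.monomial j.2 _).add
      (IsDiffOpLT.sum fun j _ => ?_)).add ((IsDiffOpLT.sum fun i hi =>
        IsDiffOpLT.monomial (Finset.mem_range.1 hi) _).add
      (IsDiffOpLT.sum fun j _ => IsDiffOpLT.sum fun i hi =>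
        IsDiffOpLT.monomial ((Finset.mem_range.1 hi).trans j.2) _))
    by_cases h : (j : ℕ) + 1 < d
    · simp only [h, if_true]
      exact IsDiffOpLT.monomial h _
    · simp only [h, if_false]
      exact IsDiffOpLT.zero d
  obtain ⟨w, hw⟩ := hrest
  refine ⟨w, fun f hf x => ?_⟩
  rw [← hw f hf x]
  have hfs := fun j => contDiff_iteratedDeriv hf j
  have e1 : iteratedDeriv 2 (diffL u f) x = iteratedDeriv (d + 3) f x +
      ∑ j : Fin d, (u j x * iteratedDeriv (j + 2) f x +
        (iteratedDeriv 2 (u j) x * iteratedDeriv (j : ℕ) f x +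
        (2 * iteratedDeriv 1 (u j) x) * iteratedDeriv (j + 1) f x)) := by
    have h1 := iteratedDeriv_add_of_contDiff (hfs (d + 1))
      (ContDiff.sum (s := Finset.univ) fun (j : Fin d) _ => (hu j).mul (hfs j)) 2 x
    have h2 := iteratedDeriv_sum_of_contDiff
      (f := fun (j : Fin d) x => u j x * iteratedDeriv (j : ℕ) f x)
      (fun j => (hu j).mul (hfs j)) 2 x
    refine h1.trans ?_
    rw [h2, iteratedDeriv_iteratedDeriv]
    congr 1
    refine Finset.sum_congr rfl fun j _ => ?_
    rw [iteratedDeriv_mul_of_contDiff (hu j) (hfs j), iteratedDeriv_iteratedDeriv]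
    simp [Finset.sum_range_succ, -iteratedDeriv_one, iteratedDeriv_iteratedDeriv]
  have e2 : ∀ n, iteratedDeriv n (diffQ q f) x = iteratedDeriv (n + 2) f x +
      (q x * iteratedDeriv n f x + ∑ j ∈ Finset.range n,
        ((n.choose j : ℝ) * iteratedDeriv (n - j) q x) * iteratedDeriv j f x) := fun n => by
    have h1 := iteratedDeriv_add_of_contDiff (hfs 2) (hqs.mul hf) n x
    refine h1.trans ?_
    rw [iteratedDeriv_iteratedDeriv, iteratedDeriv_mul_of_contDiff hqs hf, add_comm 2 n]
  have e3 : ∑ j : Fin d, (2 * iteratedDeriv 1 (u j) x) * iteratedDeriv (j + 1) f x =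
      ∑ j : Fin d, (if (j : ℕ) + 1 < d then
          (2 * iteratedDeriv 1 (u j) x) * iteratedDeriv (j + 1) f x else 0) +
        (2 * iteratedDeriv 1 (u ⟨d - 1, sub_one_lt_self hd⟩) x) * iteratedDeriv d f x := by
    rw [← sub_eq_iff_eq_add', ← Finset.sum_sub_distrib,
      Finset.sum_eq_single (⟨d - 1, sub_one_lt_self hd⟩ : Fin d)]
    · rw [if_neg (by simp; omega), sub_zero]
      simp only [Nat.sub_add_cancel hd]
    · intro j _ hj
      have : (j : ℕ) ≠ d - 1 := fun h => hj (Fin.ext h)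
      rw [if_pos (by omega), sub_self]
    · simp
  have e4 := e2 (d + 1)
  rw [Finset.sum_range_succ] at e4
  simp only [Nat.choose_succ_self_right, Nat.cast_add, Nat.cast_one, Nat.add_sub_cancel_left,
    hq'] at e4
  simp only [diffQ, diffL] at e1 e2 e4 ⊢
  rw [e1, e4]
  simp only [e2]
  simp only [mul_add, Finset.sum_add_distrib, e3, Finset.mul_sum, neg_mul, Finset.sum_neg_distrib]
  simp only [mul_assoc, mul_left_comm (q x)]
  ring

end Commutator

/-! ### Fractional powers of `L` -/

namespace PsiDO

theorem ext_of_eq {A B : PsiDO} (ho : A.order = B.order) (hc : ∀ s, A.coeff s = B.coeff s) :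
    A = B := by
  cases A
  cases B
  simp only [PsiDO.mk.injEq]
  exact ⟨ho, funext hc⟩

theorem pow_order {P : PsiDO} (h : P.order = 1) (n : ℕ) : (P.pow n).order = n := by
  induction n with
  | zero => rfl
  | succ n ih =>
    change P.order + (P.pow n).order = _
    rw [h, ih]
    push_cast
    ring

theorem comp_coeff_zero {A B : PsiDO} (x : ℝ) :
    (A.comp B).coeff 0 x = A.coeff 0 x * B.coeff 0 x := by
  simp [comp]

theorem pow_coeff_zero {P : PsiDO} (h : ∀ x, P.coeff 0 x = 1) (n : ℕ) (x : ℝ) :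
    (P.pow n).coeff 0 x = 1 := by
  induction n with
  | zero => simp [pow, one]
  | succ n ih => rw [pow, comp_coeff_zero, h, ih, one_mul]

theorem comp_coeff_congr {A A' B B' : PsiDO} (ho : A.order = A'.order) {s : ℕ}
    (hA : ∀ i ≤ s, A.coeff i = A'.coeff i) (hB : ∀ i ≤ s, B.coeff i = B'.coeff i) :
    (A.comp B).coeff s = (A'.comp B').coeff s := by
  ext x
  simp only [comp]
  refine Finset.sum_congr rfl fun p hp => Finset.sum_congr rfl fun q hq => ?_
  rw [Finset.HasAntidiagonal.mem_antidiagonal] at hp hq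
  rw [ho, hA p.1 (by omega), hB q.1 (by omega)]

/-- At index `s` an unknown coefficient occurs only against a leading one, without derivatives; all
other products involve indices below `s`. -/
theorem comp_coeff_sub {A A' B B' : PsiDO} (ho : A.order = A'.order) {s : ℕ} (hs : 1 ≤ s)
    (hA : ∀ i < s, A.coeff i = A'.coeff i) (hB : ∀ i < s, B.coeff i = B'.coeff i)
    (hA0 : ∀ x, A.coeff 0 x = 1) (hB0 : ∀ x, B.coeff 0 x = 1) (x : ℝ) :
    (A.comp B).coeff s x - (A'.comp B').coeff s x =
      (A.coeff s x - A'.coeff s x) + (B.coeff s x - B'.coeff s x) := by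
  have hA0' : ∀ x, A'.coeff 0 x = 1 := fun x => by rw [← hA 0 hs, hA0]
  have hB0' : ∀ x, B'.coeff 0 x = 1 := fun x => by rw [← hB 0 hs, hB0]
  simp only [comp]
  rw [← Finset.sum_sub_distrib, Finset.sum_eq_add (s, 0) (0, s)]
  · congr 1
    · simp [hB0, hB0']
    · rw [← Finset.sum_sub_distrib, Finset.sum_eq_single (s, 0)]
      · simp [hA0, hA0']
      · intro q hq hne
        rw [Finset.HasAntidiagonal.mem_antidiagonal] at hq
        have hq1 : q.1 < s := by
          rcases Nat.lt_or_ge q.1 s with h | h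
          · exact h
          · exact absurd (Prod.ext (by simp at hq ⊢; omega) (by simp at hq ⊢; omega)) hne
        rw [ho, hA 0 hs, hB _ hq1, sub_self]
      · simp
  · exact fun h => by simp at h; omega
  · rintro p hp ⟨hne1, hne2⟩
    rw [Finset.HasAntidiagonal.mem_antidiagonal] at hp
    have hp1 : p.1 < s := by
      rcases Nat.lt_or_ge p.1 s with h | h
      · exact h
      · exact absurd (Prod.ext (by simp; omega) (by simp; omega)) hne1
    have hp2 : p.2 < s := by
      rcases Nat.lt_or_ge p.2 s with h | h
      · exact h
      · exact absurd (Prod.ext (by simp; omega) (by simp; omega)) hne2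
    rw [sub_eq_zero]
    refine Finset.sum_congr rfl fun q hq => ?_
    rw [Finset.HasAntidiagonal.mem_antidiagonal] at hq
    rw [ho, hA _ hp1, hB q.1 (by omega)]
  · simp
  · simp

theorem pow_coeff_congr {P P' : PsiDO} (ho : P.order = P'.order) {s : ℕ}
    (h : ∀ i < s, P.coeff i = P'.coeff i) (n : ℕ) :
    ∀ i < s, (P.pow n).coeff i = (P'.pow n).coeff i := by
  induction n with
  | zero => exact fun i _ => rfl
  | succ n ih =>
    exact fun i hi => comp_coeff_congr ho (fun j hj => h j (by omega)) fun j hj => ih j (by omega)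

/-- The coefficient of index `s` of `P^n` is `n` times that of `P`, up to a function of the
coefficients of smaller index. -/
theorem pow_coeff_sub {P P' : PsiDO} (ho : P.order = P'.order) {s : ℕ} (hs : 1 ≤ s)
    (h : ∀ i < s, P.coeff i = P'.coeff i) (h0 : ∀ x, P.coeff 0 x = 1) (n : ℕ) (x : ℝ) :
    (P.pow n).coeff s x - (P'.pow n).coeff s x = n * (P.coeff s x - P'.coeff s x) := by
  induction n with
  | zero => simp [pow]
  | succ n ih =>
    rw [pow, pow, comp_coeff_sub ho hs h (pow_coeff_congr ho h n) h0 (pow_coeff_zero h0 n), ih]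
    push_cast
    ring

/-- The operator `∂`. -/
def partialOp : PsiDO := ⟨1, fun s _ => if s = 0 then 1 else 0⟩

theorem partialOp_pow_coeff (n s : ℕ) (x : ℝ) :
    (partialOp.pow n).coeff s x = if s = 0 then 1 else 0 := by
  induction n generalizing s x with
  | zero => rfl
  | succ n ih =>
    have hc : ∀ i, (partialOp.pow n).coeff i = fun _ => if i = 0 then 1 else 0 :=
      fun i => funext (ih i)
    simp only [pow, comp, hc, iteratedDeriv_const]
    split_ifs with hs
    · subst hs
      simp [partialOp]
    · refine Finset.sum_eq_zero fun p hp => Finset.sum_eq_zero fun q hq => ?_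
      rw [Finset.HasAntidiagonal.mem_antidiagonal] at hp hq
      by_cases h1 : p.1 = 0
      · by_cases h2 : q.2 = 0
        · rw [if_pos h2, if_neg (by omega)]
          simp
        · rw [if_neg h2]
          simp
      · simp [partialOp, h1]

/-- All coefficients are smooth and periodic. -/
def IsPeriodic (A : PsiDO) (T : ℝ) : Prop :=
  ∀ s, ContDiff ℝ ∞ (A.coeff s) ∧ Function.Periodic (A.coeff s) T

theorem IsPeriodic.comp {A B : PsiDO} {T : ℝ} (hA : A.IsPeriodic T) (hB : B.IsPeriodic T) :
    (A.comp B).IsPeriodic T := by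
  refine fun s => ⟨?_, fun x => ?_⟩
  · simp only [PsiDO.comp]
    exact ContDiff.sum fun (p : ℕ × ℕ) _ => ContDiff.sum fun (q : ℕ × ℕ) _ =>
      contDiff_const.mul ((hA p.1).1.mul (contDiff_iteratedDeriv (hB q.1).1 q.2))
  · simp only [PsiDO.comp]
    refine Finset.sum_congr rfl fun p _ => Finset.sum_congr rfl fun q _ => ?_
    have h := congrFun (iteratedDeriv_comp_add_const q.2 (B.coeff q.1) T) x
    rw [(hA p.1).2 x, ← h, funext (hB q.1).2]

theorem IsPeriodic.pow {A : PsiDO} {T : ℝ} (hA : A.IsPeriodic T) (n : ℕ) :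
    (A.pow n).IsPeriodic T := by
  induction n with
  | zero => exact fun s => ⟨contDiff_const, fun x => rfl⟩
  | succ n ih => exact hA.comp ih

end PsiDO

section Root

variable {d : ℕ}

/-- The coefficients of `L^{1/(d+1)}`. -/
noncomputable def rootCoeff (u : Fin d → ℝ → ℝ) (s : ℕ) : ℝ → ℝ := fun x =>
  if s = 0 then 1 else
    ((lOp u).coeff s x - ((PsiDO.mk 1 fun i => if i < s then rootCoeff u i else fun _ => 0).pow
      (d + 1)).coeff s x) / ((d : ℝ) + 1)
termination_by s

/-- `L^{1/(d+1)}` with all coefficients from the index `s` on replaced by zero. -/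
noncomputable def truncRoot (u : Fin d → ℝ → ℝ) (s : ℕ) : PsiDO :=
  ⟨1, fun i => if i < s then rootCoeff u i else fun _ => 0⟩

theorem rootCoeff_zero (u : Fin d → ℝ → ℝ) (x : ℝ) : rootCoeff u 0 x = 1 := by
  rw [rootCoeff, if_pos rfl]

theorem rootCoeff_of_ne_zero (u : Fin d → ℝ → ℝ) {s : ℕ} (hs : s ≠ 0) :
    rootCoeff u s = fun x =>
      ((lOp u).coeff s x - ((truncRoot u s).pow (d + 1)).coeff s x) / ((d : ℝ) + 1) := by
  ext x
  rw [rootCoeff, if_neg hs]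
  rfl

theorem lOp_isPeriodic {u : Fin d → ℝ → ℝ} {T : ℝ} (hu : ∀ j, ContDiff ℝ ∞ (u j))
    (hper : ∀ j, Function.Periodic (u j) T) : (lOp u).IsPeriodic T := by
  intro s
  by_cases h0 : s = 0
  · have : (lOp u).coeff s = fun _ => 1 := by ext x; simp [lOp, h0]
    rw [this]
    exact ⟨contDiff_const, fun x => rfl⟩
  by_cases h : 2 ≤ s ∧ s ≤ d + 1
  · have : (lOp u).coeff s = u ⟨d + 1 - s, by omega⟩ := by ext x; simp [lOp, h0, h]
    rw [this]
    exact ⟨hu _, hper _⟩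
  · have : (lOp u).coeff s = fun _ => 0 := by ext x; simp [lOp, h0, h]
    rw [this]
    exact ⟨contDiff_const, fun x => rfl⟩

theorem rootCoeff_smooth_periodic {u : Fin d → ℝ → ℝ} {T : ℝ} (hu : ∀ j, ContDiff ℝ ∞ (u j))
    (hper : ∀ j, Function.Periodic (u j) T) (s : ℕ) :
    ContDiff ℝ ∞ (rootCoeff u s) ∧ Function.Periodic (rootCoeff u s) T := by
  induction s using Nat.strong_induction_on with
  | _ s ih =>
    by_cases hs : s = 0
    · have : rootCoeff u s = fun _ => 1 := by ext x; rw [hs, rootCoeff_zero]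
      rw [this]
      exact ⟨contDiff_const, fun x => rfl⟩
    have htr : (truncRoot u s).IsPeriodic T := fun i => by
      by_cases hi : i < s
      · simpa [truncRoot, hi] using ih i hi
      · simp only [truncRoot, hi, if_false]
        exact ⟨contDiff_const, fun x => rfl⟩
    rw [rootCoeff_of_ne_zero u hs]
    have h1 := lOp_isPeriodic hu hper s
    have h2 := htr.pow (d + 1) s
    refine ⟨(h1.1.sub h2.1).div_const _, fun x => ?_⟩
    beta_reduce
    rw [h1.2, h2.2]

/-- By `PsiDO.pow_coeff_sub` the equation at index `s` is linear in the new coefficient with factor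
`d + 1`, so the recursion of `rootCoeff` solves it index by index. -/
theorem exists_isRootOfL {u : Fin d → ℝ → ℝ} (hu : ∀ j, ContDiff ℝ ∞ (u j))
    (hper : ∀ j, Function.Periodic (u j) (2 * Real.pi)) : ∃ P, IsRootOfL u P := by
  refine ⟨⟨1, rootCoeff u⟩, rfl, rootCoeff_zero u, fun s => (rootCoeff_smooth_periodic hu hper s).1,
    fun s => (rootCoeff_smooth_periodic hu hper s).2, ?_⟩
  refine PsiDO.ext_of_eq ?_ fun s => ?_
  · rw [PsiDO.pow_order rfl]
    simp [lOp]
  · ext x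
    by_cases hs : s = 0
    · rw [hs, PsiDO.pow_coeff_zero (rootCoeff_zero u)]
      simp [lOp]
    · have h := PsiDO.pow_coeff_sub (P := ⟨1, rootCoeff u⟩) (P' := truncRoot u s) rfl
        (Nat.one_le_iff_ne_zero.2 hs) (fun i hi => by simp [truncRoot, hi]) (rootCoeff_zero u)
        (d + 1) x
      have h2 : (truncRoot u s).coeff s x = 0 := by simp [truncRoot]
      have hd1 : (d : ℝ) + 1 ≠ 0 := by positivity
      simp only [h2, rootCoeff_of_ne_zero u hs] at h
      push_cast at h
      rw [sub_zero, mul_div_cancel₀ _ hd1] at h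
      linarith

theorem lOp_diffPart (u : Fin d → ℝ → ℝ) (f : ℝ → ℝ) : (lOp u).diffPart f = diffL u f := by
  ext x
  have h1 : ((lOp u).order + 1).toNat = d + 1 + 1 := by simp only [lOp]; omega
  rw [PsiDO.diffPart, h1, Finset.sum_range_succ', Finset.sum_range_succ', diffL, add_comm]
  have e0 : (lOp u).coeff 0 x * iteratedDeriv ((lOp u).order - (0 : ℕ)).toNat f x =
      iteratedDeriv (d + 1) f x := by
    rw [show ((lOp u).order - (0 : ℕ)).toNat = d + 1 by simp only [lOp]; omega]
    simp [lOp]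
  have e1 : (lOp u).coeff (0 + 1) x * iteratedDeriv ((lOp u).order - (0 + 1 : ℕ)).toNat f x = 0 := by
    simp [lOp]
  rw [e0, e1, add_zero]
  congr 1
  -- Pseudo-differential coefficients are indexed by descending order, the `u_j` by ascending order.
  rw [← Equiv.sum_comp Fin.revPerm, ← Fin.sum_univ_eq_sum_range (fun s =>
    (lOp u).coeff (s + 1 + 1) x * iteratedDeriv ((lOp u).order - (s + 1 + 1 : ℕ)).toNat f x) d]
  refine Finset.sum_congr rfl fun s _ => ?_
  have hs := s.2
  rw [show ((lOp u).order - ((s : ℕ) + 1 + 1 : ℕ)).toNat = d - (s + 1) by simp only [lOp]; omega]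
  have hc : (lOp u).coeff ((s : ℕ) + 1 + 1) x = u s.rev x := by
    simp only [lOp]
    rw [if_neg (by omega), dif_pos (by omega)]
    congr 1
    exact Fin.ext (by simp only [Fin.val_rev]; omega)
  rw [hc]
  simp [Fin.val_rev]

/-- Comparing `P` with `∂` through `PsiDO.pow_coeff_sub` at indices one and two gives `P = ∂ +
u_{d-1}/(d+1) ∂⁻¹ + ⋯` for every root, so the differential part of `P²` does not depend on the root
chosen. -/
theorem IsRootOfL.sq_diffPart (hd : 1 ≤ d) {u : Fin d → ℝ → ℝ} {P : PsiDO} (hP : IsRootOfL u P)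
    (f : ℝ → ℝ) : (P.pow 2).diffPart f =
      diffQ (fun x => 2 / ((d : ℝ) + 1) * u ⟨d - 1, sub_one_lt_self hd⟩ x) f := by
  have hd1 : (d : ℝ) + 1 ≠ 0 := by positivity
  have ho : P.order = PsiDO.partialOp.order := hP.order_eq
  have h0 : P.coeff 0 = PsiDO.partialOp.coeff 0 := funext fun x => by
    rw [hP.monic]
    simp [PsiDO.partialOp]
  have hlt1 : ∀ i < 1, P.coeff i = PsiDO.partialOp.coeff i := fun i hi => by
    rw [Nat.lt_one_iff.1 hi, h0]
  have hpow1 : ∀ n x, (P.pow n).coeff 1 x = n * P.coeff 1 x := fun n x => by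
    have := PsiDO.pow_coeff_sub ho le_rfl hlt1 hP.monic n x
    rwa [PsiDO.partialOp_pow_coeff, if_neg one_ne_zero, sub_zero,
      show PsiDO.partialOp.coeff 1 x = 0 by simp [PsiDO.partialOp], sub_zero] at this
  have hc1 : ∀ x, P.coeff 1 x = 0 := fun x => by
    have h := hpow1 (d + 1) x
    rw [hP.pow_eq, show (lOp u).coeff 1 x = 0 by simp [lOp]] at h
    push_cast at h
    exact (mul_eq_zero.1 h.symm).resolve_left hd1
  have hlt2 : ∀ i < 2, P.coeff i = PsiDO.partialOp.coeff i := fun i hi => by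
    interval_cases i
    · exact h0
    · ext x
      rw [hc1]
      simp [PsiDO.partialOp]
  have hpow2 : ∀ n x, (P.pow n).coeff 2 x = n * P.coeff 2 x := fun n x => by
    have := PsiDO.pow_coeff_sub ho one_le_two hlt2 hP.monic n x
    rwa [PsiDO.partialOp_pow_coeff, if_neg two_ne_zero, sub_zero,
      show PsiDO.partialOp.coeff 2 x = 0 by simp [PsiDO.partialOp], sub_zero] at this
  have hc2 : ∀ x, P.coeff 2 x = u ⟨d - 1, sub_one_lt_self hd⟩ x / ((d : ℝ) + 1) := fun x => by
    have h := hpow2 (d + 1) x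
    rw [hP.pow_eq, show (lOp u).coeff 2 x = u ⟨d - 1, sub_one_lt_self hd⟩ x by
      simp only [lOp]
      rw [if_neg two_ne_zero, dif_pos ⟨le_rfl, by omega⟩]
      congr 1] at h
    push_cast at h
    rw [h, mul_div_cancel_left₀ _ hd1]
  ext x
  have hord : (P.pow 2).order = 2 := PsiDO.pow_order hP.order_eq 2
  rw [PsiDO.diffPart, hord, show ((2 : ℤ) + 1).toNat = 3 from rfl, Finset.sum_range_succ,
    Finset.sum_range_succ, Finset.sum_range_one, PsiDO.pow_coeff_zero hP.monic, hpow1, hpow2, hc1,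
    hc2, diffQ]
  simp only [Nat.cast_zero, Nat.cast_one, Nat.cast_ofNat, sub_zero, sub_self, mul_zero, zero_mul,
    add_zero, one_mul, Int.toNat_zero, iteratedDeriv_zero]
  rw [show (2 : ℤ).toNat = 2 from rfl]
  ring

theorem IsKdVField.eq_commutator (hd : 1 ≤ d) {u w : Fin d → ℝ → ℝ} (h : IsKdVField 2 u w)
    {f : ℝ → ℝ} (hf : ContDiff ℝ ∞ f) (x : ℝ) :
    ∑ j : Fin d, w j x * iteratedDeriv (j : ℕ) f x =
      diffQ (fun x => 2 / ((d : ℝ) + 1) * u ⟨d - 1, sub_one_lt_self hd⟩ x) (diffL u f) x -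
        diffL u (diffQ (fun x => 2 / ((d : ℝ) + 1) * u ⟨d - 1, sub_one_lt_self hd⟩ x) f) x := by
  obtain ⟨P, hP, hw⟩ := h
  rw [hw f hf x, lOp_diffPart, lOp_diffPart, hP.sq_diffPart hd, hP.sq_diffPart hd]

theorem exists_isKdVField (hd : 1 ≤ d) {u : Fin d → ℝ → ℝ} (hu : ∀ j, ContDiff ℝ ∞ (u j))
    (hper : ∀ j, Function.Periodic (u j) (2 * Real.pi)) : ∃ w, IsKdVField 2 u w := by
  obtain ⟨P, hP⟩ := exists_isRootOfL hu hper
  obtain ⟨w, hw⟩ := isDiffOpLT_commutator hd hu rfl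
  refine ⟨w, P, hP, fun f hf x => ?_⟩
  rw [lOp_diffPart, lOp_diffPart, hP.sq_diffPart hd, hP.sq_diffPart hd]
  exact (hw f hf x).symm

/-- The variation of the operator along the vector field `Q₂ G` is the commutator `[Q₂, L]`. -/
theorem IsKdVField.sum_smul_iteratedDeriv (hd : 1 ≤ d) {u w : Fin d → ℝ → ℝ}
    (h : IsKdVField 2 u w) (hus : ∀ j, ContDiff ℝ ∞ (u j)) {G : ℝ → Fin (d + 1) → ℝ}
    (hG : ContDiff ℝ ∞ G) (hu : HasCoeffs G u) {Y : ℝ → Fin (d + 1) → ℝ}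
    (hY : Y = fun x => iteratedDeriv 2 G x +
      (2 / ((d : ℝ) + 1) * u ⟨d - 1, sub_one_lt_self hd⟩ x) • G x) (x : ℝ) :
    ∑ j : Fin d, w j x • iteratedDeriv (j : ℕ) G x =
      -(iteratedDeriv (d + 1) Y x + ∑ j : Fin d, u j x • iteratedDeriv (j : ℕ) Y x) := by
  have hap : ∀ {y : ℝ → Fin (d + 1) → ℝ}, ContDiff ℝ ∞ y → ∀ i j x,
      iteratedDeriv j y x i = iteratedDeriv j (fun x => y x i) x := fun hy i j x =>
    (iteratedDeriv_clm_comp (ContinuousLinearMap.proj (R := ℝ) i) hy j x).symm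
  have hYs : ContDiff ℝ ∞ Y := hY ▸ (contDiff_iteratedDeriv hG 2).add
    (ContDiff.smul (contDiff_const.mul (hus _)) hG)
  ext i
  have hGi : ContDiff ℝ ∞ fun x => G x i := contDiff_pi.1 hG i
  have h1 := h.eq_commutator hd hGi x
  -- The components of `G` are in the kernel of the operator, so only one half of the commutator
  -- remains.
  have hL : diffL u (fun x => G x i) = fun _ => 0 := by
    ext x
    have := congrFun (hu x) i
    simp only [Pi.add_apply, Finset.sum_apply, Pi.smul_apply, smul_eq_mul, Pi.zero_apply,
      hap hG] at this
    exact this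
  have hQ : diffQ (fun x => 2 / ((d : ℝ) + 1) * u ⟨d - 1, sub_one_lt_self hd⟩ x) (fun x => G x i) =
      fun x => Y x i := by
    ext x
    rw [hY]
    simp only [diffQ, Pi.add_apply, Pi.smul_apply, smul_eq_mul, hap hG]
  rw [hL, hQ] at h1
  simp only [Finset.sum_apply, Pi.smul_apply, smul_eq_mul, Pi.neg_apply, Pi.add_apply, hap hG,
    hap hYs]
  rw [h1]
  simp [diffQ, diffL]

theorem IsKdVField.unique (hd : 1 ≤ d) {u w w' : Fin d → ℝ → ℝ} (h : IsKdVField 2 u w)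
    (h' : IsKdVField 2 u w') (hus : ∀ j, ContDiff ℝ ∞ (u j)) {G : ℝ → Fin (d + 1) → ℝ}
    (hG : ContDiff ℝ ∞ G) (hW : ∀ x, wronskian G x = 1) (hu : HasCoeffs G u) : w = w' := by
  ext j x
  have := eq_zero_of_sum_frame' (hW x) (c := fun j => w j x - w' j x) (by
    simp only [sub_smul, Finset.sum_sub_distrib]
    rw [h.sum_smul_iteratedDeriv hd hus hG hu rfl, h'.sum_smul_iteratedDeriv hd hus hG hu rfl,
      sub_self])
  exact sub_eq_zero.1 (congrFun this j)

end Root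

/-! ### Inverses of pentagram maps -/

section Inverse

variable {d : ℕ}

theorem offset_reversed_add (I : Fin (d - 1) → ℕ) (l : Fin d) :
    offset (reversed I) l + offset I l.rev = offset I (d - 1) := by
  have h1 : offset (reversed I) l =
      ∑ i ∈ Finset.univ.filter (fun i : Fin (d - 1) => ¬ i.val < l.rev.val), I i := by
    unfold offset reversed
    refine Finset.sum_nbij' (fun i => i.rev) (fun i => i.rev) ?_ ?_ ?_ ?_ ?_
    · intro i hi
      simp only [Finset.mem_filter, Finset.mem_univ, true_and, Fin.val_rev] at hi ⊢
      omega
    · intro i hi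
      simp only [Finset.mem_filter, Finset.mem_univ, true_and, Fin.val_rev] at hi ⊢
      omega
    · simp
    · simp
    · simp
  have h2 : offset I (d - 1) = ∑ i, I i := by
    unfold offset
    congr 1
    exact Finset.filter_true_of_mem fun i _ => i.2
  rw [h1, h2, add_comm]
  exact Finset.sum_filter_add_sum_filter_not _ _ _

theorem submodule_le_diagPlane (I : Fin (d - 1) → ℕ) (v : Polygon d) (k : ℤ) (l : Fin d) :
    (v (k + (offset I l : ℤ))).submodule ≤ diagPlane I v k :=
  le_iSup (fun l : Fin d => (v (k + (offset I l : ℤ))).submodule) l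

/-- `T_{R*,I*}` inverts `T_{I,R}`, up to a shift. -/
theorem IsPentagramImage.eq_shift {I R : Fin (d - 1) → ℕ} {v w v' : Polygon d}
    (h : IsPentagramImage I R v w) (h' : IsPentagramImage (reversed R) (reversed I) w v') (k : ℤ) :
    v' k = v (k + ((offset R (d - 1) + offset I (d - 1) : ℕ) : ℤ)) := by
  -- Each vertex of `w` used here lies on the shifted plane of `v`, and both spaces have dimension
  -- `d`.
  have hP : ∀ k, diagPlane (reversed R) w k = diagPlane I v (k + (offset R (d - 1) : ℤ)) := by
    intro k
    refine Submodule.eq_of_le_of_finrank_eq (iSup_le fun l => ?_) ((h'.1 k).trans (h.1 _).symm)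
    rw [← h.2]
    refine (iInf_le _ l.rev).trans (le_of_eq ?_)
    congr 1
    have := offset_reversed_add R l
    omega
  have hle : (v (k + ((offset R (d - 1) + offset I (d - 1) : ℕ) : ℤ))).submodule ≤
      (v' k).submodule := by
    rw [← h'.2]
    refine le_iInf fun l => ?_
    rw [hP]
    refine le_trans (le_of_eq ?_) (submodule_le_diagPlane I v _ l.rev)
    congr 2
    have := offset_reversed_add I l
    omega
  refine Projectivization.submodule_injective (Submodule.eq_of_le_of_finrank_eq hle ?_).symm
  rw [Projectivization.finrank_submodule, Projectivization.finrank_submodule]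

/-- The second composite is the first for the swapped, reversed tuples; reversal preserves the total
length, so the shift is the same. -/
theorem areInverseUpToShift_reversed (hd : 1 ≤ d) (I R : Fin (d - 1) → ℕ) :
    AreInverseUpToShift I R (reversed R) (reversed I) := by
  have hrev : ∀ I : Fin (d - 1) → ℕ, reversed (reversed I) = I := fun I => by
    ext i
    simp [reversed]
  have htot : ∀ I : Fin (d - 1) → ℕ, offset (reversed I) (d - 1) = offset I (d - 1) := fun I => by
    have := offset_reversed_add I ⟨d - 1, sub_one_lt_self hd⟩
    simpa [offset, show d - (d - 1 + 1) = 0 by omega] using this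
  refine ⟨_, fun v w v' h h' k => h.eq_shift h' k, fun v w v' h h' k => ?_⟩
  have := h.eq_shift (v' := v') (by rwa [hrev, hrev]) k
  rw [htot, htot, add_comm (offset I (d - 1))] at this
  exact this

theorem offset_lt_offset {I : Fin (d - 1) → ℕ} (hI : ∀ i, 0 < I i) {a b : Fin d} (hab : a < b) :
    offset I a < offset I b := by
  have hab' : (a : ℕ) < b := hab
  refine Finset.sum_lt_sum_of_subset (i := ⟨a, by omega⟩) (fun i hi => ?_) ?_ ?_ (hI _)
    fun _ _ _ => Nat.zero_le _
  · simp only [Finset.mem_filter, Finset.mem_univ, true_and] at hi ⊢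
    omega
  · simpa using hab
  · simp

theorem centeredOffset_injective {I : Fin (d - 1) → ℕ} (hI : ∀ i, 0 < I i) :
    Function.Injective (centeredOffset I) := by
  intro a b h
  have h1 : offset I a = offset I b := by
    have := sub_left_injective h
    exact_mod_cast this
  rcases lt_trichotomy a b with h2 | h2 | h2
  · exact absurd h1 (offset_lt_offset hI h2).ne
  · exact h2
  · exact absurd h1 (offset_lt_offset hI h2).ne'

theorem sum_centeredOffset (hd : 1 ≤ d) (I : Fin (d - 1) → ℕ) : ∑ l, centeredOffset I l = 0 := by
  have : (d : ℝ) ≠ 0 := by positivity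
  simp only [centeredOffset, Finset.sum_sub_distrib, Finset.sum_const, Finset.card_univ,
    Fintype.card_fin, nsmul_eq_mul]
  field_simp
  ring

end Inverse

/-! ### The continuous limit -/

section Limit

variable {d : ℕ}

theorem tendsto_mul_nhdsGT_zero {m : ℕ} (hm : 0 < m) :
    Tendsto (fun ε : ℝ => (m : ℝ) * ε) (𝓝[>] 0) (𝓝[>] 0) := by
  refine tendsto_nhdsWithin_iff.2 ⟨?_, ?_⟩
  · have : Tendsto (fun ε : ℝ => (m : ℝ) * ε) (𝓝 0) (𝓝 ((m : ℝ) * 0)) :=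
      (continuous_const.mul continuous_id).tendsto 0
    rw [mul_zero] at this
    exact this.mono_left nhdsWithin_le_nhds
  · filter_upwards [self_mem_nhdsWithin] with ε hε
    exact mem_Ioi.2 (mul_pos (Nat.cast_pos.2 hm) (mem_Ioi.1 hε))

theorem JointlySmooth.exists_norm_le {E : Type} [NormedAddCommGroup E] [NormedSpace ℝ E]
    {R : ℝ → ℝ → E} (hR : JointlySmooth R) (a b : ℝ) :
    ∃ K : ℝ, ∀ᶠ ε in 𝓝[>] (0 : ℝ), ∀ x ∈ Icc a b, ‖R ε x‖ ≤ K := by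
  obtain ⟨K, hK⟩ := (isCompact_Icc.prod isCompact_Icc :
    IsCompact (Icc (0 : ℝ) 1 ×ˢ Icc a b)).exists_bound_of_continuousOn hR.continuous.continuousOn
  refine ⟨K, ?_⟩
  filter_upwards [Ioo_mem_nhdsGT zero_lt_one] with ε hε x hx
  exact hK (ε, x) ⟨⟨hε.1.le, hε.2.le⟩, hx⟩

/-- For periodic functions, a second order expansion with smooth remainder is uniform. -/
theorem exists_abs_sub_le_of_periodic {c : ℝ → ℝ → ℝ} {u w : ℝ → ℝ} {r : ℝ → ℝ → ℝ}
    (hr : JointlySmooth r) (hc : ∀ᶠ ε in 𝓝[>] (0 : ℝ), Function.Periodic (c ε) (2 * Real.pi))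
    (hu : Function.Periodic u (2 * Real.pi))
    (hexp : ∀ ε x, c ε x = u x + ε ^ 2 * w x + ε ^ 3 * r ε x) :
    ∃ K : ℝ, ∀ᶠ ε in 𝓝[>] (0 : ℝ), ∀ x, |c ε x - u x - ε ^ 2 * w x| ≤ K * ε ^ 3 := by
  -- Periodicity passes from `c ε` and `u` to the `ε²` coefficient, by dividing by `ε²` and letting
  -- `ε → 0`.
  have hw : Function.Periodic w (2 * Real.pi) := by
    intro x
    rw [← sub_eq_zero]
    refine eq_zero_of_eventually_smul_eq_zero
      (r := fun ε => r ε (x + 2 * Real.pi) - r ε x)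
      ((hr.contDiff_left _).continuous.sub (hr.contDiff_left _).continuous) ?_
    filter_upwards [hc, self_mem_nhdsWithin] with ε hε hpos
    have h1 := hε x
    rw [hexp, hexp, hu x] at h1
    have hpos' : ε ^ 2 ≠ 0 := pow_ne_zero 2 (ne_of_gt hpos)
    refine mul_left_cancel₀ hpos' ?_
    rw [smul_eq_mul]
    linear_combination h1
  obtain ⟨K, hK⟩ := hr.exists_norm_le 0 (2 * Real.pi)
  refine ⟨K, ?_⟩
  filter_upwards [hK, hc, self_mem_nhdsWithin] with ε hε hcε hpos x
  have hper : Function.Periodic (fun x => c ε x - u x - ε ^ 2 * w x) (2 * Real.pi) := fun x => by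
    simp only [hcε x, hu x, hw x]
  obtain ⟨y, hy, hxy⟩ := hper.exists_mem_Ico₀ Real.two_pi_pos x
  have hpos' : 0 < ε := hpos
  rw [hxy, hexp, show u y + ε ^ 2 * w y + ε ^ 3 * r ε y - u y - ε ^ 2 * w y = r ε y * ε ^ 3 by ring,
    abs_mul, abs_of_pos (pow_pos hpos' 3)]
  exact mul_le_mul_of_nonneg_right (hε y ⟨hy.1, hy.2.le⟩) (pow_pos hpos' 3).le

theorem IsNormalizedLift.contDiff_curveCoeff {M : Matrix.SpecialLinearGroup (Fin (d + 1)) ℝ}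
    {G : ℝ → Fin (d + 1) → ℝ} (hG : IsNormalizedLift M G) (j : Fin (d + 1)) :
    ContDiff ℝ ∞ (curveCoeff G j) :=
  (jointlySmooth_curveCoeff (JointlySmooth.of_right hG.smooth) j).contDiff_right 0

/-- All envelope families of a curve agree for small `ε`. -/
theorem IsEnvelopeFamily.eventually_eq (hd : 1 ≤ d) {I : Fin (d - 1) → ℕ} (hI : ∀ i, 0 < I i)
    {m : ℕ} (hm : 0 < m) {G : ℝ → Fin (d + 1) → ℝ} (hG : ContDiff ℝ ∞ G)
    (hW : ∀ x, wronskian G x = 1) {Λ : ℝ → ℝ → Fin (d + 1) → ℝ} (hΛ : JointlySmooth Λ)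
    (hΛ0 : Λ 0 = G)
    (hev : ∀ᶠ ε in 𝓝[>] (0 : ℝ), (∀ x, wronskian (Λ ε) x = 1) ∧
      (∀ j < d, ∀ x, envCovector (centeredOffset I) G ε x ⬝ᵥ iteratedDeriv j (Λ ε) x = 0) ∧
      ∀ x, crossProd (fun i : Fin d =>
        iteratedDeriv (i : ℕ) (envCovector (centeredOffset I) G ε) x) ≠ 0)
    {L : ℝ → ℝ → Fin (d + 1) → ℝ} (hL : IsEnvelopeFamily I m G L) :
    ∀ᶠ ε in 𝓝[>] (0 : ℝ), L ε = Λ (m * ε) := by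
  have hm' := tendsto_mul_nhdsGT_zero hm
  -- The sign is decided at one point: `L ε = -Λ` would make this sum zero, while it tends to `2
  -- G(0) ≠ 0`.
  have hlim : Tendsto (fun ε : ℝ => L ε 0 + Λ (m * ε) 0) (𝓝[>] 0) (𝓝 (G 0 + G 0)) := by
    refine (hL.2 0).add ?_
    have h1 := ((hΛ.contDiff_left 0).continuous.tendsto 0)
    rw [hΛ0] at h1
    exact (h1.mono_left nhdsWithin_le_nhds).comp hm'
  have hG0 : G 0 + G 0 ≠ 0 := by
    intro h
    have h0 : G 0 = 0 := by
      rw [← two_smul ℝ] at h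
      exact (smul_eq_zero.1 h).resolve_left two_ne_zero
    have hz : wronskian G 0 = 0 := by
      rw [wronskian_eq_det_frame]
      exact Matrix.det_eq_zero_of_row_eq_zero 0 fun j => by simp [frame_apply, h0]
    exact one_ne_zero ((hW 0).symm.trans hz)
  filter_upwards [hL.1, hm'.eventually hev, hlim.eventually_ne hG0, hm'.eventually
    self_mem_nhdsWithin] with ε h1 h2 h3 h4
  obtain ⟨c, hc, hdet⟩ := exists_det_points_eq_mul hd (centeredOffset_injective hI) hG
    (ε := m * ε) (ne_of_gt h4)
  have hHL : ∀ j < d, ∀ x, envCovector (centeredOffset I) G (m * ε) x ⬝ᵥ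
      iteratedDeriv j (L ε) x = 0 := fun j hj x =>
    (mul_eq_zero.1 ((hdet x _).symm.trans (h1.osculating x ⟨j, hj⟩))).resolve_left hc
  rcases eq_or_eq_neg_of_envelope ((jointlySmooth_envCovector _ hG).contDiff_right (m * ε))
    (hΛ.contDiff_right (m * ε)) h1.smooth h2.1 h1.wronskian_eq_one h2.2.1
    hHL h2.2.2 with h | h
  · exact h
  · exact absurd (by rw [h]; simp) h3

/-- The expansion of the envelopes and of their operators. -/
theorem envelope_continuous_limit (hd : 1 ≤ d) {I : Fin (d - 1) → ℕ} (hI : ∀ i, 0 < I i)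
    {m : ℕ} (hm : 0 < m) {M : Matrix.SpecialLinearGroup (Fin (d + 1)) ℝ}
    {G : ℝ → Fin (d + 1) → ℝ} (hG : IsNormalizedLift M G) {C : ℝ}
    (hC : C = (m : ℝ) ^ 2 * limitConst (centeredOffset I)) :
    ∃ u : Fin d → ℝ → ℝ,
      HasCoeffs G u ∧ (∀ j, ContDiff ℝ ∞ (u j)) ∧
      (∀ j, Function.Periodic (u j) (2 * Real.pi)) ∧
      (∃ L : ℝ → ℝ → Fin (d + 1) → ℝ, IsEnvelopeFamily I m G L) ∧
      ∀ L : ℝ → ℝ → Fin (d + 1) → ℝ, IsEnvelopeFamily I m G L →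
        (∀ᶠ ε in 𝓝[>] (0 : ℝ), IsNormalizedLift M (L ε)) ∧
        (∀ r : ℝ, ∃ K : ℝ, ∀ᶠ ε in 𝓝[>] (0 : ℝ), ∀ x ∈ Icc (-r) r,
          ‖L ε x - G x - (ε ^ 2 * C) • (iteratedDeriv 2 G x +
            (2 / ((d : ℝ) + 1) * u ⟨d - 1, sub_one_lt_self hd⟩ x) • G x)‖ ≤ K * ε ^ 3) ∧
        ∃ (uε : ℝ → Fin d → ℝ → ℝ) (w : Fin d → ℝ → ℝ),
          (∀ᶠ ε in 𝓝[>] (0 : ℝ), HasCoeffs (L ε) (uε ε)) ∧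
          IsKdVField 2 u w ∧
          HasSecondOrderExpansion uε u (fun j x => C * w j x) := by
  have hk := centeredOffset_injective hI
  have hsum := sum_centeredOffset hd I
  let u : Fin d → ℝ → ℝ := fun j => curveCoeff G j.castSucc
  have hu : HasCoeffs G u := hasCoeffs_curveCoeff hG.smooth hG.wronskian_eq_one
  have hus : ∀ j, ContDiff ℝ ∞ (u j) := fun j => hG.contDiff_curveCoeff _
  have hup : ∀ j, Function.Periodic (u j) (2 * Real.pi) := fun j =>
    curveCoeff_periodic M hG.smooth hG.monodromy _
  have hm' := tendsto_mul_nhdsGT_zero hm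
  obtain ⟨Λ, hΛ, hΛ0, hev⟩ := exists_jointlySmooth_envelope (centeredOffset I) hG
  have hev' := hev.filter_mono (nhdsWithin_le_nhds (s := Ioi (0 : ℝ)))
  have hWΛ := hev'.mono fun ε h => h.1.wronskian_eq_one
  obtain ⟨R, hR, hexp⟩ := envelope_expansion hd hk hsum hG.smooth hG.wronskian_eq_one hu hus hΛ hΛ0
    hWΛ (hev'.mono fun ε h => h.2.1)
  set c := limitConst (centeredOffset I)
  let Q : ℝ → Fin (d + 1) → ℝ := fun x => iteratedDeriv 2 G x +
    (2 / ((d : ℝ) + 1) * u ⟨d - 1, sub_one_lt_self hd⟩ x) • G x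
  have hQ : ContDiff ℝ ∞ Q := (contDiff_iteratedDeriv hG.smooth 2).add
    (ContDiff.smul (contDiff_const.mul (hus _)) hG.smooth)
  obtain ⟨w', r, hr, hc, hw'⟩ := curveCoeff_expansion hG.smooth hG.wronskian_eq_one
    (hQ.const_smul c) hu hΛ hR hWΛ hexp
  obtain ⟨w, hw⟩ := exists_isKdVField hd hus hup
  -- Both tuples, applied to the frame of `G`, give `-c 𝓛 Q G`, and the frame is independent.
  have hww : ∀ j x, w' j x = c * w j x := by
    intro j x
    have hcQ : ∀ j, iteratedDeriv j (fun x => c • Q x) x = c • iteratedDeriv j Q x := fun j =>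
      iteratedDeriv_const_smul (hQ.of_le (by exact_mod_cast le_top)).contDiffAt c
    have h1 := hw' x
    simp only [hcQ, Finset.sum_add_distrib] at h1
    have h2 := hw.sum_smul_iteratedDeriv hd hus hG.smooth hu (Y := Q) rfl x
    have h4 : ∑ j : Fin d, u j x • c • iteratedDeriv (j : ℕ) Q x =
        c • ∑ j : Fin d, u j x • iteratedDeriv (j : ℕ) Q x := by
      rw [Finset.smul_sum]
      exact Finset.sum_congr rfl fun j _ => smul_comm _ _ _
    have h3 := eq_zero_of_sum_frame' (hG.wronskian_eq_one x) (c := fun j => w' j x - c * w j x) (by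
      simp only [sub_smul, mul_smul, Finset.sum_sub_distrib]
      rw [← Finset.smul_sum, h2, ← h1, h4]
      module)
    exact sub_eq_zero.1 (congrFun h3 j)
  refine ⟨u, hu, hus, hup, ⟨fun ε => Λ (m * ε), ?_, fun x => ?_⟩, fun L hL => ?_⟩
  · filter_upwards [hm'.eventually hev', hm'.eventually self_mem_nhdsWithin] with ε h1 h2
    obtain ⟨b, hb, hdet⟩ := exists_det_points_eq_mul hd hk hG.smooth (ε := m * ε) (ne_of_gt h2)
    refine ⟨h1.1.smooth, h1.1.wronskian_eq_one, fun x j => (hdet x _).trans ?_⟩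
    rw [h1.2.1 j j.2, mul_zero]
  · have h1 := (hΛ.contDiff_left x).continuous.tendsto 0
    rw [hΛ0] at h1
    exact (h1.mono_left nhdsWithin_le_nhds).comp hm'
  have hLΛ := hL.eventually_eq hd hI hm hG.smooth hG.wronskian_eq_one hΛ hΛ0
    (hev'.mono fun ε h => ⟨h.1.wronskian_eq_one, h.2⟩)
  have hLN : ∀ᶠ ε in 𝓝[>] (0 : ℝ), IsNormalizedLift M (L ε) := by
    filter_upwards [hLΛ, hm'.eventually hev'] with ε h1 h2
    rw [h1]
    exact h2.1
  refine ⟨hLN, fun a => ?_, fun ε j => curveCoeff (L ε) j.castSucc, w,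
    hLN.mono fun ε h => hasCoeffs_curveCoeff h.smooth h.wronskian_eq_one, hw, ?_⟩
  · obtain ⟨K, hK⟩ := hR.exists_norm_le (-a) a
    refine ⟨(m : ℝ) ^ 3 * K, ?_⟩
    filter_upwards [hLΛ, hm'.eventually hK, self_mem_nhdsWithin] with ε h1 h2 h3 x hx
    have h3' : 0 < ε := h3
    have h4 : L ε x - G x - (ε ^ 2 * C) • (iteratedDeriv 2 G x +
        (2 / ((d : ℝ) + 1) * u ⟨d - 1, sub_one_lt_self hd⟩ x) • G x) = (m * ε : ℝ) ^ 3 • R (m * ε) x := by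
      rw [h1, hexp, hC]
      module
    rw [h4, norm_smul, Real.norm_of_nonneg (by positivity)]
    calc (m * ε : ℝ) ^ 3 * ‖R (m * ε) x‖ ≤ (m * ε : ℝ) ^ 3 * K := by
          gcongr
          exact h2 x hx
      _ = (m : ℝ) ^ 3 * K * ε ^ 3 := by ring
  · choose K hK using fun j => exists_abs_sub_le_of_periodic (hr j)
      (hev'.mono fun ε h => curveCoeff_periodic M h.1.smooth h.1.monodromy j.castSucc) (hup j) (hc j)
    refine ⟨(m : ℝ) ^ 3 * ∑ j, |K j|, ?_⟩
    filter_upwards [hLΛ, hm'.eventually (eventually_all.2 hK), self_mem_nhdsWithin] with ε h1 h2 h3 j x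
    have h3' : 0 < ε := h3
    have h4 := h2 j x
    rw [hww] at h4
    rw [h1, hC, show ε ^ 2 * ((m : ℝ) ^ 2 * c * w j x) = (m * ε) ^ 2 * (c * w j x) by ring]
    refine h4.trans ?_
    have h5 : K j ≤ ∑ j, |K j| := (le_abs_self _).trans
      (Finset.single_le_sum (f := fun j => |K j|) (fun _ _ => abs_nonneg _) (Finset.mem_univ j))
    calc K j * (m * ε : ℝ) ^ 3 ≤ (∑ j, |K j|) * (m * ε : ℝ) ^ 3 := by gcongr
      _ = (m : ℝ) ^ 3 * (∑ j, |K j|) * ε ^ 3 := by ring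

theorem HasSecondOrderExpansion.unique {uε uε' : ℝ → Fin d → ℝ → ℝ} {u w w' : Fin d → ℝ → ℝ}
    (h : HasSecondOrderExpansion uε u w) (h' : HasSecondOrderExpansion uε' u w')
    (he : ∀ᶠ ε in 𝓝[>] (0 : ℝ), uε ε = uε' ε) : w = w' := by
  obtain ⟨K, hK⟩ := h
  obtain ⟨K', hK'⟩ := h'
  ext j x
  rw [← sub_eq_zero, ← abs_nonpos_iff]
  have hlim : Tendsto (fun ε : ℝ => (K + K') * ε) (𝓝[>] 0) (𝓝 0) := by
    have : Tendsto (fun ε : ℝ => (K + K') * ε) (𝓝 0) (𝓝 ((K + K') * 0)) :=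
      (continuous_const.mul continuous_id).tendsto 0
    rw [mul_zero] at this
    exact this.mono_left nhdsWithin_le_nhds
  refine ge_of_tendsto hlim ?_
  filter_upwards [hK, hK', he, self_mem_nhdsWithin] with ε h1 h2 h3 h4
  have h4' : 0 < ε := h4
  have h5 := h1 j x
  have h6 := h2 j x
  rw [h3] at h5
  have h7 : ε ^ 2 * |w j x - w' j x| ≤ ε ^ 2 * ((K + K') * ε) := by
    rw [← abs_of_pos (pow_pos h4' 2), ← abs_mul, abs_of_pos (pow_pos h4' 2)]
    rw [abs_le] at h5 h6 ⊢
    constructor <;> nlinarith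
  exact le_of_mul_le_mul_left h7 (pow_pos h4' 2)

/-- The continuous limit system is the `(2, d+1)`-KdV equation with rescaled time. -/
theorem solvesContinuousLimitAt_iff (hd : 1 ≤ d) {I : Fin (d - 1) → ℕ} (hI : ∀ i, 0 < I i)
    {m : ℕ} (hm : 0 < m) {C : ℝ} (hC : C = (m : ℝ) ^ 2 * limitConst (centeredOffset I))
    (hC0 : C ≠ 0) (u : ℝ → Fin d → ℝ → ℝ) (t : ℝ) (hut : IsCurveCoeffs (u t)) :
    SolvesContinuousLimitAt I m u t ↔ SolvesKdVAt 2 (fun s => u (s / C)) (C * t) := by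
  have hCt : C * t / C = t := mul_div_cancel_left₀ t hC0
  constructor
  · rintro ⟨w, ⟨M, G, L, uε, hG, hu, hL, huε, hexp⟩, hw⟩
    obtain ⟨u', hu', -, -, -, h⟩ := envelope_continuous_limit hd hI hm hG hC
    obtain rfl : u' = u t := hu'.unique hG.wronskian_eq_one hu
    obtain ⟨hN, -, uε', w', huε', hKdV, hexp'⟩ := h L hL
    -- The coefficients of a normalized curve are unique, so two second-order expansions of them
    -- have the same `ε²` term.
    have hww : w = fun j x => C * w' j x := hexp.unique hexp' (by
      filter_upwards [huε, huε', hN] with ε h1 h2 h3 using h1.unique h3.wronskian_eq_one h2)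
    refine ⟨w', by simpa only [hCt] using hKdV, fun j x => ?_⟩
    have h1 := hw j x
    rw [hww, ← hCt] at h1
    have h2 := HasDerivAt.comp (h := fun s => s / C) (C * t) h1 ((hasDerivAt_id (C * t)).div_const C)
    refine h2.congr_deriv ?_
    field_simp
  · rintro ⟨w, hKdV, hw⟩
    obtain ⟨M, G, hG, hu⟩ := hut
    simp only [hCt] at hKdV
    obtain ⟨u', hu', hus, -, ⟨L, hL⟩, h⟩ := envelope_continuous_limit hd hI hm hG hC
    obtain rfl : u' = u t := hu'.unique hG.wronskian_eq_one hu
    obtain ⟨hN, -, uε, w', huε, hKdV', hexp⟩ := h L hL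
    -- The given KdV field and the one from the envelope expansion may come from different roots;
    -- they act equally on `G`.
    obtain rfl : w = w' := hKdV.unique hd hKdV' hus hG.smooth hG.wronskian_eq_one hu
    refine ⟨fun j x => C * w j x, ⟨M, G, L, uε, hG, hu, hL, huε, hexp⟩, fun j x => ?_⟩
    have h2 := HasDerivAt.comp (h := fun s => C * s) t (hw j x) ((hasDerivAt_id t).const_mul C)
    have h3 : (fun s => u (s / C) j x) ∘ (fun s => C * s) = fun s => u s j x := by
      ext s
      simp [mul_div_cancel_left₀ s hC0]
    rw [h3] at h2
    refine h2.congr_deriv ?_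
    ring

end Limit

end PentagramLimit

/-! ### The main theorem -/

theorem mainTheorem9 (d : ℕ) (hd : 1 ≤ d) :
    -- the continuous limit of `T_{I,(m,…,m)}`
    (∀ (I : Fin (d - 1) → ℕ) (m : ℕ), (∀ i, 0 < I i) → 0 < m →
      ∃ C : ℝ, C ≠ 0 ∧
        -- expansion of the envelopes and of their operators, for every curve
        (∀ (M : Matrix.SpecialLinearGroup (Fin (d + 1)) ℝ) (G : ℝ → Fin (d + 1) → ℝ),
          IsNormalizedLift M G →
          ∃ u : Fin d → ℝ → ℝ,
            HasCoeffs G u ∧ (∀ j, ContDiff ℝ ∞ (u j)) ∧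
            (∀ j, Function.Periodic (u j) (2 * Real.pi)) ∧
            (∃ L : ℝ → ℝ → Fin (d + 1) → ℝ, IsEnvelopeFamily I m G L) ∧
            ∀ L : ℝ → ℝ → Fin (d + 1) → ℝ, IsEnvelopeFamily I m G L →
              (∀ᶠ ε in 𝓝[>] (0 : ℝ), IsNormalizedLift M (L ε)) ∧
              (∀ r : ℝ, ∃ K : ℝ, ∀ᶠ ε in 𝓝[>] (0 : ℝ), ∀ x ∈ Icc (-r) r,
                ‖L ε x - G x - (ε ^ 2 * C) • (iteratedDeriv 2 G x +
                  (2 / ((d : ℝ) + 1) * u ⟨d - 1, by omega⟩ x) • G x)‖ ≤ K * ε ^ 3) ∧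
              ∃ (uε : ℝ → Fin d → ℝ → ℝ) (w : Fin d → ℝ → ℝ),
                (∀ᶠ ε in 𝓝[>] (0 : ℝ), HasCoeffs (L ε) (uε ε)) ∧
                IsKdVField 2 u w ∧
                HasSecondOrderExpansion uε u (fun j x => C * w j x)) ∧
        -- the limit system is the `(2, d+1)`-KdV equation, with the time rescaled by `C`
        (∀ (u : ℝ → Fin d → ℝ → ℝ) (t : ℝ), IsCurveCoeffs (u t) →
          (SolvesContinuousLimitAt I m u t ↔ SolvesKdVAt 2 (fun s => u (s / C)) (C * t)))) ∧
    -- inverses of long-diagonal maps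
    (∀ (m : ℕ) (R : Fin (d - 1) → ℕ), 0 < m → IsLongDiagonalTuple d m R →
      AreInverseUpToShift (fun _ => m) R (reversed R) (fun _ => m) ∧
      ∃ C : ℝ, C ≠ 0 ∧
        ∀ (u : ℝ → Fin d → ℝ → ℝ) (t : ℝ), IsCurveCoeffs (u t) →
          (SolvesContinuousLimitAt (reversed R) m u t ↔
            SolvesKdVAt 2 (fun s => u (s / C)) (C * t))) := by
  have hpos : ∀ (I : Fin (d - 1) → ℕ) (m : ℕ), (∀ i, 0 < I i) → 0 < m →
      (m : ℝ) ^ 2 * limitConst (centeredOffset I) ≠ 0 := fun I m hI hm =>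
    mul_ne_zero (by positivity) (limitConst_ne_zero (centeredOffset_injective hI))
  refine ⟨fun I m hI hm => ⟨_, hpos I m hI hm,
    fun M G hG => envelope_continuous_limit hd hI hm hG rfl,
    solvesContinuousLimitAt_iff hd hI hm rfl (hpos I m hI hm)⟩,
    fun m R hm hR => ⟨areInverseUpToShift_reversed hd (fun _ => m) R, ?_⟩⟩
  -- The inverse map has `R` reversed as its jump tuple and `(m, …, m)` as its intersection tuple,
  -- so the first part applies to it.
  have hI : ∀ i, 0 < reversed R i := fun i => hR.1 _
  exact ⟨_, hpos _ m hI hm, solvesContinuousLimitAt_iff hd hI hm rfl (hpos _ m hI hm)⟩
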